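/- Fix $\alpha>0$, let $\psi(x)=|x|^{\alpha+1}e^{-1/|x|^{\alpha}}$ for $x\neq 0$, $\psi(0)=0$, $g=\psi'$, and on $\mathbb R^2$ let $A(x,y)=\mathrm{diag}(1,g(x)^2)$, $\nabla_A v=(\partial_x v,\,g\,\partial_y v)$, $L=\nabla\cdot A\nabla$. A subunit curve is a Lipschitz curve $\gamma:[0,s]\to\mathbb R^2$ with $(\gamma'(t)\cdot\xi)^2\le \xi^{T}A(\gamma(t))\xi$ for a.e. $t$ and all $\xi$; the subunit distance $d(p,q)$ is the infimum of the $s>0$ for which there is a subunit curve on $[0,s]$ from $p$ to $q$. Let $B=B(0,r)=\{q: d(0,q)<r\}$ and $d\mu=dx\,dy/|B|$. $W^{1,2}_A(B)$ is the space of $v\in L^2(B)$ whose distributional $A$-gradient $\nabla_A v$ is in $L^2(B)$, normed by $(\int_B |v|^2+|\nabla_A v|^2)^{1/2}$, and $(W^{1,2}_A)_0(B)$ is the closure in it of the Lipschitz functions with compact support in $B$. A function $u\in W^{1,2}_A(B)$ is a weak solution of $Lu=f$ in $B$ if for every $w\in (W^{1,2}_A)_0(B)$ the function $fw$ is integrable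 on $B$ and $\int_B \nabla_A w\cdot\nabla_A u=-\int_B f w$. A function $u$ is unbounded at the origin in $B$ if it is not essentially bounded on $U\cap B$ for any neighbourhood $U$ of the origin. For $N\ge 1$ let $\Phi_N$ be the even function with $\Phi_N(t)=t(\ln t)^N$ for $t\ge e^{2N}$ and $\Phi_N(t)=(2N)^N t$ for $0\le t\le e^{2N}$, and let $\Psi_N(t)=\Phi_N(t^2)$ (so $\Psi_N(t)=2^N t^2(\ln t)^N$ for $t\ge e^N$). For a Young function $\theta$ let $\tilde\theta(t)=\sup_s\{st-\theta(s)\}$ and $\|h\|_{L^\theta(B,d\mu)}=\inf\{k>0:\int_B\theta(h/k)\,d\mu\le 1\}$; $L^\theta(B)$ consists of the measurable $h$ of finite norm. Then there is $r_0>0$ (depending on $\alpha$) such that for every $0<r<r_0$ the following hold on $B=B(0,r)$. 1. (Orlicz–Sobolev inequality.) For every real $N\ge1$ with $\alpha N<1$ there is a constant $C$ such that $\|w\|_{L^{\Psi_N}(B,d\mu)}\le C\left(\int_B|\nabla_A w|^2\,d\mu\right)^{1/2}$ for all $w\in (W^{1,2}_A)_0(B)$. 2. (Explicit unbounded solution.)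 Let $\chi\in C^\infty(\mathbb R)$ with $\chi=1$ on $[-1,1]$ and $\chi=0$ off $[-2,2]$, and let $u(x,y)=\chi\left(\frac{y}{\psi(x)}\right)\ln\frac1{|x|}$ for $x\ne0$, $u(0,y)=0$. Then $u\in W^{1,2}_A(B)$, $u$ is unbounded at the origin, $u$ is a weak solution of $Lu=f$ in $B$ with $f=u_{xx}+g(x)^2u_{yy}$ (computed classically off the origin), and $f\in L^{\tilde\Phi_M}(B)$ for every $M>2+\frac2\alpha$. 3. (Zero boundary values.) There are functions $w$ and $h$ such that $w\in (W^{1,2}_A)_0(B)$, $w$ is unbounded at the origin, $w$ is a weak solution of $Lw=h$ in $B$, and $h\in L^{\tilde\Phi_M}(B)$ for every $M>2+\frac2\alpha$. Moreover, for every $N\ge1$ and every $M>2+2N$ there is $\alpha>0$ with $\alpha N<1$ and $M>2+\frac2\alpha$, so that for this $\alpha$ all of the above hold for these $N$ and $M$ simultaneously. In particular, the assumption $f\in L^\infty$ in the theorem "the $(\Psi_N,2)$ Orlicz–Sobolev inequality, $N>1$, implies that weak solutions in $(W^{1,2}_A)_0(B)$ of $Lu=f\in L^\infty(B)$ are bounded"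 cannot be relaxed to $f\in L^{\tilde\Phi_M}(B)$ with $M>2+2N$. -/

import Mathlib

open MeasureTheory Filter Topology
open scoped ENNReal ContDiff

noncomputable section

namespace Degen

/-! ## Young functions and Orlicz spaces -/

/-- The convex conjugate `t ↦ sup_s (s t - θ s) ∈ [0, ∞]` of a finite-valued Young function `θ`.
Since `θ 0 = 0` the supremum is nonnegative, so truncating each term at `0` changes nothing. -/
def convexConj (θ : ℝ → ℝ) (t : ℝ) : ℝ≥0∞ :=
  ⨆ s : ℝ, ENNReal.ofReal (s * t - θ s)

/-- The Luxemburg norm `inf {k > 0 : ∫ θ(f/k) dμ ≤ 1}`, equal to `∞` if there is no such `k`. -/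
def luxNorm {X : Type*} [MeasurableSpace X] (θ : ℝ → ℝ≥0∞) (μ : Measure X) (f : X → ℝ) : ℝ≥0∞ :=
  ⨅ (k : ℝ) (_ : 0 < k) (_ : ∫⁻ x, θ (f x / k) ∂μ ≤ 1), ENNReal.ofReal k

/-- `f ∈ L^θ(μ)`. -/
def MemOrlicz {X : Type*} [MeasurableSpace X] (θ : ℝ → ℝ≥0∞) (μ : Measure X) (f : X → ℝ) : Prop :=
  AEMeasurable f μ ∧ luxNorm θ μ f < ⊤

/-- The Orlicz bump function `Φ_N`, extended evenly to the line: with `E = e^{2N}`,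
`Φ_N(t) = |t| (ln |t|)^N` if `|t| ≥ E` and `Φ_N(t) = (ln E)^N |t|` if `|t| ≤ E`. -/
def bump (N : ℝ) (t : ℝ) : ℝ :=
  if Real.exp (2 * N) ≤ |t| then |t| * Real.log |t| ^ N else (2 * N) ^ N * |t|

/-- `Ψ_N(t) = Φ_N(t²)`, so that `Ψ_N(t) = 2^N t² (ln t)^N` for `t ≥ e^N`. -/
def bumpSq (N : ℝ) (t : ℝ) : ℝ := bump N (t ^ 2)

/-! ## The degenerate geometry of `A(x, y) = diag(1, g(x)²)` on the plane -/

/-- The bilinear form `ξᵗ A(p) η`, where `A(x, y) = diag(1, g(x)²)`. -/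
def aForm (g : ℝ → ℝ) (p ξ η : ℝ × ℝ) : ℝ := ξ.1 * η.1 + g p.1 ^ 2 * (ξ.2 * η.2)

/-- `γ : [0, r] → ℝ²` is a subunit curve: it is Lipschitz and
`(γ'(t) · ξ)² ≤ ξᵗ A(γ(t)) ξ` for a.e. `t ∈ [0, r]` and all `ξ`. -/
def IsSubunitCurve (g : ℝ → ℝ) (r : ℝ) (γ : ℝ → ℝ × ℝ) : Prop :=
  (∃ K, LipschitzOnWith K γ (Set.Icc 0 r)) ∧
    ∀ᵐ t ∂(volume.restrict (Set.Icc 0 r)), ∀ ξ : ℝ × ℝ,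
      ((deriv γ t).1 * ξ.1 + (deriv γ t).2 * ξ.2) ^ 2 ≤ aForm g (γ t) ξ ξ

/-- The subunit (control) distance. -/
def subunitDist (g : ℝ → ℝ) (p q : ℝ × ℝ) : ℝ≥0∞ :=
  ⨅ (r : ℝ) (_ : 0 < r) (_ : ∃ γ, IsSubunitCurve g r γ ∧ γ 0 = p ∧ γ r = q), ENNReal.ofReal r

/-- The subunit ball of center `p` and radius `r`. -/
def subunitBall (g : ℝ → ℝ) (p : ℝ × ℝ) (r : ℝ) : Set (ℝ × ℝ) :=
  {q | subunitDist g p q < ENNReal.ofReal r}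

/-- The normalized Lebesgue measure `dx / |B|` on `B`. -/
def avgMeasure (B : Set (ℝ × ℝ)) : Measure (ℝ × ℝ) := (volume B)⁻¹ • volume.restrict B

/-- The pointwise `A`-gradient `∇_A φ = (φ_x, g φ_y)` of a (Lipschitz) function;
it is `√A ∇φ` up to the sign of `g`. -/
def aGrad (g : ℝ → ℝ) (φ : ℝ × ℝ → ℝ) (p : ℝ × ℝ) : ℝ × ℝ :=
  (fderiv ℝ φ p (1, 0), g p.1 * fderiv ℝ φ p (0, 1))

/-- `v ∈ W_A^{1,2}(B)` with weak `A`-gradient `G = (∂_x v, g ∂_y v)`: both `v` and `G` are in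
`L²(B)`, and `G` is the distributional `A`-gradient of `v` in `B`. As `g` depends on `x` only, the
formal transpose of `g ∂_y` is `-g ∂_y`. -/
structure HasWeakAGrad (g : ℝ → ℝ) (B : Set (ℝ × ℝ)) (v : ℝ × ℝ → ℝ) (G : ℝ × ℝ → ℝ × ℝ) :
    Prop where
  memLp : MemLp v 2 (volume.restrict B)
  memLp_grad : MemLp G 2 (volume.restrict B)
  weak : ∀ φ : ℝ × ℝ → ℝ, ContDiff ℝ ∞ φ → HasCompactSupport φ → tsupport φ ⊆ B →
    ∫ p in B, v p * (aGrad g φ p).1 = - ∫ p in B, (G p).1 * φ p ∧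
    ∫ p in B, v p * (aGrad g φ p).2 = - ∫ p in B, (G p).2 * φ p

/-- `v ∈ W_A^{1,2}(B)`. -/
def MemSobolev (g : ℝ → ℝ) (B : Set (ℝ × ℝ)) (v : ℝ × ℝ → ℝ) : Prop :=
  ∃ G, HasWeakAGrad g B v G

/-- `v ∈ (W_A^{1,2})₀(B)` with weak `A`-gradient `G`: `v` is a limit in `W_A^{1,2}(B)` of Lipschitz
functions with compact support in `B`. -/
def HasWeakAGradZero (g : ℝ → ℝ) (B : Set (ℝ × ℝ)) (v : ℝ × ℝ → ℝ) (G : ℝ × ℝ → ℝ × ℝ) : Prop :=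
  HasWeakAGrad g B v G ∧
    ∃ φ : ℕ → ℝ × ℝ → ℝ,
      (∀ n, (∃ K, LipschitzWith K (φ n)) ∧ HasCompactSupport (φ n) ∧ tsupport (φ n) ⊆ B) ∧
      Tendsto (fun n => eLpNorm (fun p => v p - φ n p) 2 (volume.restrict B)) atTop (𝓝 0) ∧
      Tendsto (fun n => eLpNorm (fun p => G p - aGrad g (φ n) p) 2 (volume.restrict B))
        atTop (𝓝 0)

/-- `v ∈ (W_A^{1,2})₀(B)`. -/
def MemSobolevZero (g : ℝ → ℝ) (B : Set (ℝ × ℝ)) (v : ℝ × ℝ → ℝ) : Prop :=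
  ∃ G, HasWeakAGradZero g B v G

/-- `u ∈ W_A^{1,2}(B)` is a weak solution of `Lu = ∇ · A ∇u = f` in `B`:
`∫ ∇w · A ∇u = - ∫ f w` for all `w ∈ (W_A^{1,2})₀(B)` (where `∇w · A ∇u = ∇_A w · ∇_A u`). -/
def IsWeakSolution (g : ℝ → ℝ) (B : Set (ℝ × ℝ)) (f u : ℝ × ℝ → ℝ) : Prop :=
  ∃ G, HasWeakAGrad g B u G ∧ ∀ w H, HasWeakAGradZero g B w H →
    IntegrableOn (fun p => f p * w p) B ∧
    ∫ p in B, ((H p).1 * (G p).1 + (H p).2 * (G p).2) = - ∫ p in B, f p * w p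

/-- The `(Ψ, 2)` Orlicz–Sobolev inequality
`‖w‖_{L^Ψ(B, dμ)} ≤ C (∫_B |∇_A w|² dμ)^{1/2}` for all `w ∈ (W_A^{1,2})₀(B)`, `dμ = dx / |B|`. -/
def OrliczSobolev (g : ℝ → ℝ) (B : Set (ℝ × ℝ)) (Ψ : ℝ → ℝ) : Prop :=
  ∃ C : ℝ, 0 < C ∧ ∀ w G, HasWeakAGradZero g B w G →
    luxNorm (fun t => ENNReal.ofReal (Ψ t)) (avgMeasure B) w ≤
      ENNReal.ofReal (C * √(∫ p, ((G p).1 ^ 2 + (G p).2 ^ 2) ∂(avgMeasure B)))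

/-- `u` is essentially unbounded in `B` near the origin. -/
def UnboundedAtOrigin (B : Set (ℝ × ℝ)) (u : ℝ × ℝ → ℝ) : Prop :=
  ∀ U ∈ 𝓝 (0 : ℝ × ℝ), eLpNorm u ⊤ (volume.restrict (U ∩ B)) = ⊤

/-! ## The example -/

/-- `ψ(x) = |x|^{α+1} e^{-1/|x|^α}`, `ψ(0) = 0`. -/
def psi (α : ℝ) (x : ℝ) : ℝ := |x| ^ (α + 1) * Real.exp (-(1 / |x| ^ α))

/-- `g = ψ'`. -/
def gfun (α : ℝ) : ℝ → ℝ := deriv (psi α)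

/-- `u(x, y) = χ(y / ψ(x)) ln(1/|x|)` for `x ≠ 0` (and `u = 0` on the line `x = 0`). -/
def uExample (α : ℝ) (χ : ℝ → ℝ) (p : ℝ × ℝ) : ℝ :=
  χ (p.2 / psi α p.1) * Real.log (1 / |p.1|)

/-- The classical expression `Lu = u_xx + g(x)² u_yy`. -/
def opL (g : ℝ → ℝ) (u : ℝ × ℝ → ℝ) (p : ℝ × ℝ) : ℝ :=
  deriv (deriv fun s => u (s, p.2)) p.1 + g p.1 ^ 2 * deriv (deriv fun t => u (p.1, t)) p.2

end Degen

end

noncomputable section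

namespace Degen

/-! The ball `B` enters only through three facts: it lies in the strip `|x| < 1`, it has finite
nonzero measure, and it contains a box around the origin. The first holds because a subunit curve
moves horizontally at speed at most one. For the last, a curve first drifts away from the line `x =
0`, where `g` vanishes, and then has room to move vertically.

Orlicz–Sobolev inequality. For a Lipschitz `F ≥ 0` of compact support, integrating along slices
gives `F(x, y) ≤ a(y) = ∫ |F_x| ds` and `|g(x)| F(x, y) ≤ b(x) = ∫ |g F_y| dt`. Since `|g(x)| ≥ α
exp(-|x|^(-α))`, the second bound yields `log F ≤ log b(x) + |x|^(-α) + |log α|`. Hence `Φ_N(F) ≤ C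
a(y) (1 + b(x) + |x|^(-αN))`, a function of `y` times a function of `x`, and Fubini gives a finite
bound exactly because `αN < 1` makes `|x|^(-αN)` integrable (`exists_bump_le`,
`exists_lintegral_bump_le`). Taking `F = φ²` gives the quadratic form, scaling gives the Luxemburg
norm, and Fatou extends it to the closure (`orliczSobolev`).

Unbounded solution. The function `χ(y/ψ(x)) ℓ(x)` lives in `|y| ≤ 2ψ(x)`, whose section over `x` has
length `4ψ(x)`, exponentially small in `|x|^(-α)`. Because `g = ψ'`, both `∂_x` and `g ∂_y` cost
only a factor `ψ'/ψ`, of size `|x|^(-α-1)`, so all the quantities involved grow polynomially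
(`ansatz_bounds`) and are square integrable. Integration by parts on slices never meets the
singularity, since slices with `y ≠ 0` vanish near `x = 0`; this gives the weak equation for
Lipschitz tests, and `L²` limits give it for all tests.

The right-hand side is `O(|x|^(-(2α+2+ε)))`, while the conjugate of `Φ_M` is at most `|t|
exp(|t|^(1/M))`. The resulting exponential is beaten by `ψ` as soon as `(2α+2+ε)/M < α`, and such an
`ε > 0` exists when `M > 2 + 2/α` (`memOrlicz_opL_ansatz`).

Zero boundary values come from multiplying the logarithm by a cutoff in `x`: the support then fits
in the box, and cutting out the line `x = 0` gives the approximating Lipschitz functions. -/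

/-! ### The profile `ψ`, its derivative `g` and the logarithmic derivative `ψ'/ψ` -/

theorem hasDerivAt_abs_rpow {x : ℝ} (hx : x ≠ 0) (p : ℝ) :
    HasDerivAt (fun s : ℝ => |s| ^ p) (p * |x| ^ p / x) x := by
  have h := (hasDerivAt_abs hx).rpow_const (p := p) (Or.inl (abs_ne_zero.2 hx))
  convert h using 1
  rw [Real.rpow_sub_one (abs_ne_zero.2 hx)]
  rcases lt_or_gt_of_ne hx with h | h
  · simp [abs_of_neg h, h]; field_simp
  · simp [abs_of_pos h, h]; field_simp

theorem contDiffAt_abs_rpow {x : ℝ} (hx : x ≠ 0) (p : ℝ) {n : ℕ∞} :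
    ContDiffAt ℝ n (fun s : ℝ => |s| ^ p) x :=
  (contDiffAt_abs hx).rpow_const_of_ne (abs_ne_zero.2 hx)

theorem psi_eq (α x : ℝ) : psi α x = |x| ^ (α + 1) * Real.exp (-|x| ^ (-α)) := by
  simp [psi, Real.rpow_neg]

theorem psi_pos (α : ℝ) {x : ℝ} (hx : x ≠ 0) : 0 < psi α x := by
  rw [psi_eq]; positivity

theorem psi_neg (α x : ℝ) : psi α (-x) = psi α x := by simp [psi]

/-- This crude bound puts the thin region `|y| ≤ 2ψ(x)` inside the cone `|y| ≤ 2|x|`, so it meets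
the line `x = 0` only at the origin. -/
theorem psi_le_abs {α x : ℝ} (hα : 0 < α) (hx : |x| ≤ 1) : psi α x ≤ |x| := by
  rw [psi_eq]
  have h1 : |x| ^ (α + 1) ≤ |x| := by
    rcases eq_or_ne x 0 with rfl | h
    · simp [Real.zero_rpow (by positivity : α + 1 ≠ 0)]
    · calc |x| ^ (α + 1) ≤ |x| ^ (1 : ℝ) :=
          Real.rpow_le_rpow_of_exponent_ge (by positivity) hx (by linarith)
        _ = |x| := Real.rpow_one _
  have h2 : Real.exp (-|x| ^ (-α)) ≤ 1 := by
    rw [Real.exp_le_one_iff]; have : 0 ≤ |x| ^ (-α) := by positivity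
    linarith
  calc _ ≤ |x| * 1 := by gcongr
    _ = |x| := mul_one _

/-- The logarithmic derivative `ψ'/ψ`. -/
def logDerivPsi (α x : ℝ) : ℝ := (α + 1 + α * |x| ^ (-α)) / x

/-- The derivative of `ψ'/ψ`. -/
def logDerivPsi' (α x : ℝ) : ℝ := -(α + 1 + α * (α + 1) * |x| ^ (-α)) / x ^ 2

theorem hasDerivAt_psi (α : ℝ) {x : ℝ} (hx : x ≠ 0) :
    HasDerivAt (psi α) (psi α x * logDerivPsi α x) x := by
  have h := (hasDerivAt_abs_rpow hx (α + 1)).mul ((hasDerivAt_abs_rpow hx (-α)).neg.exp)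
  have e : psi α = fun s => |s| ^ (α + 1) * Real.exp (-|s| ^ (-α)) := funext (psi_eq α)
  rw [e]
  convert! h using 1
  simp only [logDerivPsi, Pi.neg_apply]
  field_simp

theorem contDiffAt_psi (α : ℝ) {x : ℝ} (hx : x ≠ 0) {n : ℕ∞} :
    ContDiffAt ℝ n (psi α) x := by
  have e : psi α = fun s => |s| ^ (α + 1) * Real.exp (-|s| ^ (-α)) := funext (psi_eq α)
  rw [e]
  exact (contDiffAt_abs_rpow hx _).mul ((contDiffAt_abs_rpow hx _).neg.exp)

theorem hasDerivAt_logDerivPsi (α : ℝ) {x : ℝ} (hx : x ≠ 0) :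
    HasDerivAt (logDerivPsi α) (logDerivPsi' α x) x := by
  have h := (((hasDerivAt_abs_rpow hx (-α)).const_mul α).const_add (α + 1)).div
    (hasDerivAt_id x) hx
  convert! h using 1
  simp only [logDerivPsi', id]
  field_simp
  ring

theorem measurable_psi (α : ℝ) : Measurable (psi α) := by
  have e : psi α = fun s => |s| ^ (α + 1) * Real.exp (-|s| ^ (-α)) := funext (psi_eq α)
  rw [e]; fun_prop

theorem measurable_logDerivPsi (α : ℝ) : Measurable (logDerivPsi α) := by
  unfold logDerivPsi; fun_prop

theorem measurable_gfun (α : ℝ) : Measurable (gfun α) := measurable_deriv _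

theorem gfun_eq (α : ℝ) {x : ℝ} (hx : x ≠ 0) : gfun α x = psi α x * logDerivPsi α x :=
  (hasDerivAt_psi α hx).deriv

/-- Reflection of `deriv` needs no differentiability, so the identity also holds at `0` and forces
`g(0) = 0`. -/
theorem gfun_neg (α x : ℝ) : gfun α (-x) = -gfun α x := by
  have h := deriv_comp_neg (f := psi α) (x := x)
  simp only [psi_neg] at h
  have h' : gfun α x = - gfun α (-x) := h
  linarith

theorem gfun_zero (α : ℝ) : gfun α 0 = 0 := by
  have := gfun_neg α 0
  simp at this; linarith

theorem gfun_eq_of_pos {α x : ℝ} (hx : 0 < x) :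
    gfun α x = ((α + 1) * x ^ α + α) * Real.exp (-x ^ (-α)) := by
  rw [gfun_eq α hx.ne', psi_eq, logDerivPsi, abs_of_pos hx, Real.rpow_add_one hx.ne',
    Real.rpow_neg hx.le]
  have : x ^ α ≠ 0 := by positivity
  field_simp

theorem abs_gfun (α x : ℝ) : |gfun α x| = |gfun α (|x|)| := by
  rcases le_total 0 x with h | h
  · rw [abs_of_nonneg h]
  · rw [abs_of_nonpos h, gfun_neg, abs_neg]

theorem abs_gfun_le {α x : ℝ} (hα : 0 < α) (hx : |x| ≤ 1) : |gfun α x| ≤ (2 * α + 1) * |x| ^ α := by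
  rw [abs_gfun]
  rcases eq_or_ne x 0 with rfl | h
  · simp [gfun_zero]; positivity
  have hp : 0 < |x| := abs_pos.2 h
  rw [gfun_eq_of_pos hp, abs_of_nonneg (by positivity)]
  have h1 : |x| ^ α ≤ 1 := Real.rpow_le_one hp.le hx hα.le
  -- With `t = |x|^(-α)` this is `exp(-t) ≤ 1/t`.
  have h2 : Real.exp (-|x| ^ (-α)) ≤ |x| ^ α := by
    rw [Real.exp_neg, Real.rpow_neg hp.le]
    apply inv_le_of_inv_le₀ (by positivity)
    linarith [Real.add_one_le_exp ((|x| ^ α)⁻¹)]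
  apply mul_le_mul _ h2 (by positivity) (by positivity)
  nlinarith

theorem abs_gfun_le_const {α x : ℝ} (hα : 0 < α) (hx : |x| ≤ 1) : |gfun α x| ≤ 2 * α + 1 := by
  refine (abs_gfun_le hα hx).trans ?_
  have h1 : |x| ^ α ≤ 1 := Real.rpow_le_one (abs_nonneg _) hx hα.le
  nlinarith

/-- The degeneracy quantified: `log (1/|g|)` is at most `|x|^(-α)` up to a constant. This is the
lower bound on `g` used both for the Orlicz–Sobolev inequality and for moving vertically in the
ball. -/
theorem le_gfun_of_pos {α x : ℝ} (hα : 0 < α) (hx : 0 < x) :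
    α * Real.exp (-x ^ (-α)) ≤ gfun α x := by
  rw [gfun_eq_of_pos hx]
  gcongr
  have : 0 ≤ (α + 1) * x ^ α := by positivity
  linarith

theorem le_abs_gfun {α x : ℝ} (hα : 0 < α) (hx : x ≠ 0) :
    α * Real.exp (-|x| ^ (-α)) ≤ |gfun α x| := by
  rw [abs_gfun]
  exact (le_gfun_of_pos hα (abs_pos.2 hx)).trans (le_abs_self _)

theorem continuous_gfun {α : ℝ} (hα : 0 < α) : Continuous (gfun α) := by
  rw [continuous_iff_continuousAt]
  intro x
  rcases eq_or_ne x 0 with rfl | hx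
  · rw [ContinuousAt, gfun_zero]
    have h : Tendsto (fun x : ℝ => (2 * α + 1) * |x| ^ α) (𝓝 0) (𝓝 0) := by
      have : Continuous (fun x : ℝ => (2 * α + 1) * |x| ^ α) :=
        continuous_const.mul (continuous_abs.rpow_const fun _ => Or.inr hα.le)
      simpa [Real.zero_rpow hα.ne'] using this.tendsto 0
    refine squeeze_zero_norm' ?_ h
    filter_upwards [Metric.closedBall_mem_nhds (0 : ℝ) one_pos] with x hx
    exact abs_gfun_le hα (by simpa using hx)
  · have : gfun α =ᶠ[𝓝 x] fun s => psi α s * logDerivPsi α s := by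
      filter_upwards [isOpen_ne.mem_nhds hx] with s hs using gfun_eq α hs
    refine ContinuousAt.congr ?_ this.symm
    exact (hasDerivAt_psi α hx).continuousAt.mul (hasDerivAt_logDerivPsi α hx).continuousAt

theorem abs_logDerivPsi_le {α x : ℝ} (hα : 0 < α) (hx : x ≠ 0) (hx1 : |x| < 1) :
    |logDerivPsi α x| ≤ (2 * α + 1) * |x| ^ (-α - 1) := by
  have hp : 0 < |x| := abs_pos.2 hx
  have h1 : 1 ≤ |x| ^ (-α) :=
    Real.one_le_rpow_of_pos_of_le_one_of_nonpos hp hx1.le (by linarith)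
  rw [logDerivPsi, abs_div, Real.rpow_sub_one hp.ne', abs_of_nonneg (by positivity), ← mul_div_assoc]
  gcongr
  nlinarith

theorem abs_logDerivPsi'_le {α x : ℝ} (hα : 0 < α) (hx : x ≠ 0) (hx1 : |x| < 1) :
    |logDerivPsi' α x| ≤ (α + 1) ^ 2 * |x| ^ (-α - 2) := by
  have hp : 0 < |x| := abs_pos.2 hx
  have h1 : 1 ≤ |x| ^ (-α) :=
    Real.one_le_rpow_of_pos_of_le_one_of_nonpos hp hx1.le (by linarith)
  rw [logDerivPsi', abs_div, abs_neg, Real.rpow_sub hp, abs_of_nonneg (by positivity),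
    ← mul_div_assoc, abs_of_nonneg (by positivity : 0 ≤ x ^ 2), Real.rpow_two, sq_abs]
  gcongr
  nlinarith

/-- In terms of `t = 1/|x|` the product is `t^(m-α-1) exp(C t^β - t^α)`, eventually at most one
since `β < α` and continuous on the remaining compact interval. It serves square integrability with
`C = β = 0`, and Orlicz integrability with `β = m/M`. -/
theorem exists_rpow_mul_exp_mul_psi_le {α β : ℝ} (hα : 0 < α) (hβ : β < α) (m C : ℝ) :
    ∃ K : ℝ, 0 ≤ K ∧ ∀ x : ℝ, x ≠ 0 → |x| < 1 →
      |x| ^ (-m) * Real.exp (C * |x| ^ (-β)) * psi α x ≤ K := by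
  have key : ∃ K : ℝ, ∀ t : ℝ, 1 ≤ t → t ^ (m - α - 1) * Real.exp (C * t ^ β - t ^ α) ≤ K := by
    set f : ℝ → ℝ := fun t => t ^ (m - α - 1) * Real.exp (C * t ^ β - t ^ α)
    have hlim : ∃ T : ℝ, ∀ t, T ≤ t → f t ≤ 1 := by
      -- Half of `t^α` absorbs `C t^β`; the other half beats the power of `t`.
      have h1 : ∀ᶠ t : ℝ in atTop, |C| * t ^ β ≤ t ^ α / 2 := by
        have h0 : Tendsto (fun t : ℝ => |C| * t ^ (-(α - β))) atTop (𝓝 (|C| * 0)) :=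
          (tendsto_rpow_neg_atTop (sub_pos.2 hβ)).const_mul _
        rw [mul_zero] at h0
        filter_upwards [h0.eventually (ge_mem_nhds (half_pos one_pos)),
          eventually_gt_atTop 0] with t ht ht0
        rw [neg_sub, Real.rpow_sub ht0, ← mul_div_assoc, div_le_iff₀ (by positivity)] at ht
        linarith
      have h2 : Tendsto (fun t : ℝ => (t ^ α) ^ ((m - α - 1) / α) * Real.exp (-(1 / 2) * t ^ α))
          atTop (𝓝 0) :=
        (tendsto_rpow_mul_exp_neg_mul_atTop_nhds_zero ((m - α - 1) / α) (1 / 2)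
          (by norm_num)).comp (tendsto_rpow_atTop hα)
      have h3 := h2.eventually (ge_mem_nhds one_pos)
      obtain ⟨T, hT⟩ := eventually_atTop.1 ((h1.and h3).and (eventually_gt_atTop (0 : ℝ)))
      refine ⟨T, fun t ht => ?_⟩
      obtain ⟨⟨h4, h5⟩, h6⟩ := hT t ht
      refine le_trans ?_ h5
      rw [← Real.rpow_mul h6.le, mul_div_cancel₀ _ hα.ne']
      simp only [f]
      gcongr
      have : C * t ^ β ≤ |C| * t ^ β := by gcongr; exact le_abs_self C
      linarith
    obtain ⟨T, hT⟩ := hlim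
    have hc : ContinuousOn f (Set.Icc 1 (max 1 T)) := by
      intro t ht
      have h0 : t ≠ 0 := by linarith [ht.1]
      apply ContinuousAt.continuousWithinAt
      have := fun p : ℝ => Real.continuousAt_rpow_const t p (Or.inl h0)
      exact (this _).mul (((continuousAt_const.mul (this _)).sub (this _)).rexp)
    obtain ⟨K, hK⟩ := (isCompact_Icc.bddAbove_image hc)
    refine ⟨max K 1, fun t ht => ?_⟩
    rcases le_total t (max 1 T) with h | h
    · exact (hK ⟨t, ⟨ht, h⟩, rfl⟩).trans (le_max_left _ _)
    · exact (hT t ((le_max_right _ _).trans h)).trans (le_max_right _ _)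
  obtain ⟨K, hK⟩ := key
  refine ⟨max K 0, le_max_right _ _, fun x hx hx1 =>
    le_trans ?_ ((hK |x|⁻¹ ?_).trans (le_max_left _ _))⟩
  · have hp : 0 < |x| := abs_pos.2 hx
    rw [psi_eq, Real.inv_rpow hp.le, Real.inv_rpow hp.le, Real.inv_rpow hp.le,
      ← Real.rpow_neg hp.le, ← Real.rpow_neg hp.le, ← Real.rpow_neg hp.le,
      show -(m - α - 1) = -m + (α + 1) by ring, Real.rpow_add hp (-m), sub_eq_add_neg (C * _),
      Real.exp_add]
    apply le_of_eq; ring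
  · exact (one_le_inv₀ (abs_pos.2 hx)).2 hx1.le

/-! ### Subunit curves and the size of subunit balls -/

theorem abs_sub_le_of_lipschitzOn_of_ae_deriv_le {f : ℝ → ℝ} {K : NNReal} {s M : ℝ}
    (hf : LipschitzOnWith K f (Set.Icc 0 s))
    (hd : ∀ᵐ t ∂(volume.restrict (Set.Icc 0 s)), |deriv f t| ≤ M) {t : ℝ}
    (ht : t ∈ Set.Icc 0 s) : |f t - f 0| ≤ M * t := by
  have hsub : Set.uIcc 0 t ⊆ Set.Icc 0 s := by
    rw [Set.uIcc_of_le ht.1]; exact Set.Icc_subset_Icc_right ht.2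
  have hac : AbsolutelyContinuousOnInterval f 0 t :=
    (hf.mono hsub).absolutelyContinuousOnInterval
  rw [← hac.integral_deriv_eq_sub]
  have := intervalIntegral.norm_integral_le_of_norm_le_const_ae (a := 0) (b := t) (C := M)
    (f := deriv f) ?_
  · simpa [abs_of_nonneg ht.1] using this
  · rw [ae_restrict_iff' measurableSet_Icc] at hd
    filter_upwards [hd] with x hx hx'
    exact hx (hsub (Set.uIoc_subset_uIcc hx'))

theorem ae_hasDerivAt_of_lipschitzOn {γ : ℝ → ℝ × ℝ} {K : NNReal} {s : ℝ}
    (hγ : LipschitzOnWith K γ (Set.Icc 0 s)) :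
    ∀ᵐ t ∂(volume.restrict (Set.Icc 0 s)), HasDerivAt γ (deriv γ t) t := by
  have h1 := hγ.ae_differentiableWithinAt (μ := volume) measurableSet_Icc
  -- The endpoints are null, and at interior points a derivative within the interval is a full
  -- derivative.
  rw [restrict_Ioo_eq_restrict_Icc.symm] at h1 ⊢
  filter_upwards [h1, ae_restrict_mem measurableSet_Ioo] with t ht ht'
  exact (ht.differentiableAt (Icc_mem_nhds ht'.1 ht'.2)).hasDerivAt

/-- Testing with `ξ = (1, 0)` bounds the horizontal speed by one. The curve therefore stays in `|x|
≤ 1`, where `|g| ≤ 2α + 1`, and testing with `ξ = (0, 1)` then bounds the vertical speed. -/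
theorem IsSubunitCurve.abs_le {α s : ℝ} (hα : 0 < α) (hs : s ≤ 1) {γ : ℝ → ℝ × ℝ}
    (hγ : IsSubunitCurve (gfun α) s γ) (h0 : γ 0 = (0, 0)) {t : ℝ} (ht : t ∈ Set.Icc 0 s) :
    |(γ t).1| ≤ t ∧ |(γ t).2| ≤ (2 * α + 1) * t := by
  obtain ⟨⟨K, hK⟩, hsub⟩ := hγ
  have hder := ae_hasDerivAt_of_lipschitzOn hK
  have hL1 : LipschitzOnWith (1 * K) (fun t => (γ t).1) (Set.Icc 0 s) :=
    LipschitzWith.prod_fst.comp_lipschitzOnWith hK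
  have hL2 : LipschitzOnWith (1 * K) (fun t => (γ t).2) (Set.Icc 0 s) :=
    LipschitzWith.prod_snd.comp_lipschitzOnWith hK
  have hd1 : ∀ᵐ t ∂(volume.restrict (Set.Icc 0 s)), |deriv (fun t => (γ t).1) t| ≤ 1 := by
    filter_upwards [hder, hsub] with t h1 h2
    have h3 := h2 (1, 0)
    simp only [aForm, mul_one, mul_zero, add_zero] at h3
    have h4 : HasDerivAt (fun t => (γ t).1) (deriv γ t).1 t := h1.fst
    rw [h4.deriv]
    exact (sq_le_one_iff_abs_le_one _).1 h3
  have hb1 : ∀ t ∈ Set.Icc 0 s, |(γ t).1| ≤ t := fun t ht => by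
    have := abs_sub_le_of_lipschitzOn_of_ae_deriv_le hL1 hd1 ht
    simpa [h0] using this
  have hd2 : ∀ᵐ t ∂(volume.restrict (Set.Icc 0 s)),
      |deriv (fun t => (γ t).2) t| ≤ 2 * α + 1 := by
    filter_upwards [hder, hsub, ae_restrict_mem measurableSet_Icc] with t h1 h2 ht
    have h3 := h2 (0, 1)
    simp only [aForm, mul_one, mul_zero, zero_add] at h3
    have h4 : HasDerivAt (fun t => (γ t).2) (deriv γ t).2 t := h1.snd
    rw [h4.deriv]
    exact (sq_le_sq.1 h3).trans (abs_gfun_le_const hα ((hb1 t ht).trans (ht.2.trans hs)))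
  refine ⟨hb1 t ht, ?_⟩
  have := abs_sub_le_of_lipschitzOn_of_ae_deriv_le hL2 hd2 ht
  simpa [h0] using this

/-- The subunit ball lies in a bounded strip. -/
theorem subunitBall_subset {α r : ℝ} (hα : 0 < α) (hr : r ≤ 1) {q : ℝ × ℝ}
    (hq : q ∈ subunitBall (gfun α) (0, 0) r) : |q.1| < r ∧ |q.2| ≤ 2 * α + 1 := by
  simp only [subunitBall, subunitDist, Set.mem_ofPred_eq, iInf_lt_iff] at hq
  obtain ⟨s, hs, ⟨γ, hγ, h0, h1⟩, hsr⟩ := hq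
  have hsr' : s < r := (ENNReal.ofReal_lt_ofReal_iff_of_nonneg hs.le).1 hsr
  have := hγ.abs_le hα (hsr'.le.trans hr) h0 (Set.right_mem_Icc.2 hs.le)
  rw [h1] at this
  exact ⟨this.1.trans_lt hsr', this.2.trans (by nlinarith)⟩

/-- Near the origin any point is joined to the origin by a short subunit curve. -/
theorem box_subset_subunitBall {α r : ℝ} (hα : 0 < α) (hr : 0 < r) :
    ∃ δ : ℝ, 0 < δ ∧ ∀ x y : ℝ, |x| ≤ δ → |y| ≤ δ → (x, y) ∈ subunitBall (gfun α) (0, 0) r := by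
  set s : ℝ := r / 2 with hs_def
  have hs : 0 < s := half_pos hr
  -- A lower bound for `g` along the path for `t` in `[s/4, 3s/4]`, where the first coordinate is,
  -- up to sign, at least `t(s-t)/(4s) ≥ 3s/64`.
  set c : ℝ := α * Real.exp (-(3 * s / 64) ^ (-α)) with hc_def
  have hc : 0 < c := by positivity
  refine ⟨min (s / 4) (c * s / 4), by positivity, fun x y hx hy => ?_⟩
  have hx' : |x| ≤ s / 4 := hx.trans (min_le_left _ _)
  have hy' : |y| ≤ c * s / 4 := hy.trans (min_le_right _ _)
  -- `σ` is the sign of `x`: the path is built on the side `x ≥ 0` and reflected, `g` being odd.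
  obtain ⟨σ, hσ, hσx⟩ : ∃ σ : ℝ, σ * σ = 1 ∧ σ * |x| = x := by
    rcases le_total 0 x with h | h
    · exact ⟨1, by norm_num, by rw [abs_of_nonneg h, one_mul]⟩
    · exact ⟨-1, by norm_num, by rw [abs_of_nonpos h]; ring⟩
  -- A straight path from `0` to `|x|` plus a parabolic bump that carries it away from the line `g =
  -- 0`, even when `x = 0`.
  set p : ℝ → ℝ := fun t => |x| * t / s + t * (s - t) / (4 * s) with hp_def
  have hgσ : ∀ z, gfun α (σ * z) = σ * gfun α z := by
    intro z
    rcases mul_self_eq_one_iff.1 hσ with h | h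
    · simp [h]
    · simp [h, gfun_neg]
  have hp : ∀ t, HasDerivAt p (|x| / s + (s - 2 * t) / (4 * s)) t := by
    intro t
    have h := (((hasDerivAt_id t).const_mul |x|).div_const s).add
      (((hasDerivAt_id t).mul ((hasDerivAt_id t).const_sub s)).div_const (4 * s))
    convert! h using 1
    simp only [id]; ring
  have hgc := continuous_gfun hα
  have hpc : Continuous p := continuous_iff_continuousAt.2 fun t => (hp t).continuousAt
  have hgp : Continuous fun t => gfun α (p t) := hgc.comp hpc
  set I : ℝ := ∫ t in (0 : ℝ)..s, gfun α (p t) with hI_def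
  have hp0 : ∀ t ∈ Set.Icc 0 s, 0 ≤ p t := fun t ht => by
    have h1 := ht.1
    have h2 : 0 ≤ s - t := sub_nonneg.2 ht.2
    simp only [hp_def]; positivity
  have hg0 : ∀ z, 0 ≤ z → 0 ≤ gfun α z := fun z hz => by
    rcases hz.eq_or_lt with rfl | h
    · rw [gfun_zero]
    · exact (by positivity : 0 ≤ α * Real.exp (-z ^ (-α))).trans (le_gfun_of_pos hα h)
  have hI : c * s / 2 ≤ I := by
    have h1 : ∫ t in (s / 4)..(3 * s / 4), c = c * s / 2 := by
      rw [intervalIntegral.integral_const, smul_eq_mul]; ring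
    rw [← h1]
    refine (intervalIntegral.integral_mono_on (g := fun t => gfun α (p t)) (by linarith)
      (by simp) (hgp.intervalIntegrable _ _) fun t ht => ?_).trans
      (intervalIntegral.integral_mono_interval (by linarith) (by linarith) (by linarith) ?_
        (hgp.intervalIntegrable _ _))
    · have h2 : 3 * s / 64 ≤ p t := by
        have : 0 ≤ |x| * t / s := by
          have : 0 ≤ t := by linarith [ht.1]
          positivity
        have h3 : 3 * s / 64 ≤ t * (s - t) / (4 * s) := by
          rw [le_div_iff₀ (by positivity)]
          nlinarith [ht.1, ht.2, mul_nonneg (sub_nonneg.2 ht.1) (sub_nonneg.2 ht.2)]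
        simp only [hp_def]; linarith
      have h3 : 0 < 3 * s / 64 := by positivity
      refine le_trans ?_ (le_gfun_of_pos hα (h3.trans_le h2))
      rw [hc_def]
      have := Real.rpow_le_rpow_of_nonpos h3 h2 (by linarith : -α ≤ 0)
      gcongr
    · filter_upwards [ae_restrict_mem measurableSet_Ioc] with t ht
      exact hg0 _ (hp0 t ⟨ht.1.le, ht.2⟩)
  have hIpos : 0 < I := lt_of_lt_of_le (by positivity) hI
  -- The vertical velocity is `k g(p(t))`, and `I` is the height reached with `k = 1`, so this `k`
  -- ends the curve at height `y`.
  set k : ℝ := y / I with hk_def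
  have hk : |k| ≤ 1 / 2 := by
    rw [hk_def, abs_div, abs_of_pos hIpos, div_le_iff₀ hIpos]
    linarith
  set γ : ℝ → ℝ × ℝ := fun t => (σ * p t, k * ∫ τ in (0 : ℝ)..t, gfun α (p τ)) with hγ_def
  have hγ' : ∀ t, HasDerivAt γ (σ * (|x| / s + (s - 2 * t) / (4 * s)), k * gfun α (p t)) t :=
    fun t => ((hp t).const_mul σ).prodMk
      ((intervalIntegral.integral_hasDerivAt_right (hgp.intervalIntegrable _ _)
        (hgp.stronglyMeasurableAtFilter _ _) hgp.continuousAt).const_mul k)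
  have hγC : ContDiff ℝ 1 γ := by
    rw [contDiff_one_iff_deriv]
    refine ⟨fun t => (hγ' t).differentiableAt, ?_⟩
    rw [funext fun t => (hγ' t).deriv]
    fun_prop
  have hlip : ∃ K, LipschitzOnWith K γ (Set.Icc 0 s) :=
    hγC.contDiffOn.exists_lipschitzOnWith one_ne_zero (convex_Icc 0 s) isCompact_Icc
  have hγs : γ s = (x, y) := by
    simp only [hγ_def, hp_def]
    rw [← hI_def, hk_def, div_mul_cancel₀ _ hIpos.ne']
    congr 1
    rw [sub_self, mul_zero, zero_div, add_zero, mul_div_cancel_right₀ _ hs.ne', hσx]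
  have hγ0 : γ 0 = (0, 0) := by simp [hγ_def, hp_def]
  have hsub : IsSubunitCurve (gfun α) s γ := by
    refine ⟨hlip, ?_⟩
    filter_upwards [ae_restrict_mem measurableSet_Icc] with t ht ξ
    rw [(hγ' t).deriv]
    simp only [aForm, hγ_def, hgσ]
    set a := |x| / s + (s - 2 * t) / (4 * s) with ha_def
    set G := gfun α (p t)
    have ha : |a| ≤ 1 / 2 := by
      have h1 : |x| / s ≤ 1 / 4 := by rw [div_le_iff₀ hs]; linarith
      have h2 : |(s - 2 * t) / (4 * s)| ≤ 1 / 4 := by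
        rw [abs_div, abs_of_pos (by positivity : 0 < 4 * s), div_le_iff₀ (by positivity), abs_le]
        constructor <;> linarith [ht.1, ht.2]
      have h3 := abs_add_le (|x| / s) ((s - 2 * t) / (4 * s))
      rw [abs_of_nonneg (by positivity : 0 ≤ |x| / s)] at h3
      linarith
    have ha2 : a ^ 2 ≤ 1 / 4 := by
      rw [← sq_abs]; nlinarith [abs_nonneg a]
    have hk2 : k ^ 2 ≤ 1 / 4 := by
      rw [← sq_abs]; nlinarith [abs_nonneg k]
    -- Since `(u + v)² ≤ 2(u² + v²)`, coefficients `a`, `k` of size at most `1/2` suffice for the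
    -- subunit condition.
    have h1 : (σ * a * ξ.1 + k * G * ξ.2) ^ 2 ≤ 2 * (a ^ 2 * ξ.1 ^ 2 + k ^ 2 * (G * ξ.2) ^ 2) := by
      have : a ^ 2 * ξ.1 ^ 2 = (σ * a * ξ.1) ^ 2 := by
        calc a ^ 2 * ξ.1 ^ 2 = (σ * σ) * (a ^ 2 * ξ.1 ^ 2) := by rw [hσ, one_mul]
          _ = _ := by ring
      rw [this]
      nlinarith [sq_nonneg (σ * a * ξ.1 - k * G * ξ.2)]
    have h2 : (σ * G) ^ 2 = G ^ 2 := by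
      calc (σ * G) ^ 2 = (σ * σ) * G ^ 2 := by ring
        _ = _ := by rw [hσ, one_mul]
    rw [h2]
    nlinarith [mul_le_mul_of_nonneg_right ha2 (sq_nonneg ξ.1),
      mul_le_mul_of_nonneg_right hk2 (sq_nonneg (G * ξ.2)), sq_nonneg ξ.1, sq_nonneg (G * ξ.2)]
  simp only [subunitBall, subunitDist, Set.mem_ofPred_eq, iInf_lt_iff]
  exact ⟨s, hs, ⟨γ, hsub, hγ0, hγs⟩, (ENNReal.ofReal_lt_ofReal_iff hr).2 (half_lt_self hr)⟩

/-! ### Calculus of compactly supported Lipschitz functions on the line -/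

theorem integrable_of_bounded_of_eq_zero {X : Type*} [NormedAddCommGroup X] [ProperSpace X]
    [MeasurableSpace X] {μ : Measure X} [IsFiniteMeasureOnCompacts μ] {f : X → ℝ} {c R : ℝ}
    (hf : AEStronglyMeasurable f μ) (hb : ∀ p, |f p| ≤ c) (h0 : ∀ p, R < ‖p‖ → f p = 0) :
    Integrable f μ := by
  have hsub : Function.support f ⊆ Metric.closedBall 0 R := by
    intro p hp
    by_contra h
    exact hp (h0 p (by simpa using h))
  rw [← integrableOn_iff_integrable_of_support_subset hsub]
  refine Measure.integrableOn_of_bounded (M := c)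
    (isCompact_closedBall (0 : X) R).measure_lt_top.ne hf ?_
  exact Eventually.of_forall hb

theorem exists_eq_zero_of_hasCompactSupport {X : Type*} [NormedAddCommGroup X] {f : X → ℝ}
    (hf : HasCompactSupport f) : ∃ R : ℝ, ∀ p, R < ‖p‖ → f p = 0 := by
  obtain ⟨R, hR⟩ := hf.isCompact.isBounded.subset_closedBall (0 : X)
  refine ⟨R, fun p hp => ?_⟩
  by_contra h
  have := hR (subset_tsupport f h)
  rw [mem_closedBall_zero_iff] at this
  linarith

theorem integral_eq_intervalIntegral_of_eq_zero {f : ℝ → ℝ} {R : ℝ} (hR : 0 ≤ R)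
    (h0 : ∀ x, R < |x| → f x = 0) : ∫ x, f x = ∫ x in (-(R + 1))..(R + 1), f x := by
  rw [intervalIntegral.integral_of_le (by linarith)]
  symm
  apply setIntegral_eq_integral_of_forall_compl_eq_zero
  intro x hx
  apply h0
  by_contra h
  rw [not_lt, abs_le] at h
  exact hx ⟨by linarith, by linarith⟩

theorem deriv_eq_zero_of_eq_zero {f : ℝ → ℝ} {R : ℝ} (h0 : ∀ x, R < |x| → f x = 0) {x : ℝ}
    (hx : R < |x|) : deriv f x = 0 := by
  have : f =ᶠ[𝓝 x] fun _ => 0 := by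
    filter_upwards [(isOpen_lt continuous_const continuous_abs).mem_nhds hx] with y hy
      using h0 y hy
  rw [this.deriv_eq, deriv_const]

/-- A Lipschitz function of compact support on the line is bounded by the integral of `|f'|`. -/
theorem abs_le_integral_abs_deriv {f : ℝ → ℝ} {K : NNReal} {R : ℝ} (hf : LipschitzWith K f)
    (h0 : ∀ x, R < |x| → f x = 0) (x : ℝ) : |f x| ≤ ∫ s, |deriv f s| := by
  have hint : Integrable (deriv f) volume :=
    integrable_of_bounded_of_eq_zero (c := K) (R := R)
      (measurable_deriv f).aestronglyMeasurable (fun p => norm_deriv_le_of_lipschitz hf)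
      (fun p hp => deriv_eq_zero_of_eq_zero h0 hp)
  set a : ℝ := -(|x| + |R| + 1) with ha
  have hax : a ≤ x := by
    have := neg_abs_le x
    have := abs_nonneg R
    linarith
  have hfa : f a = 0 := by
    apply h0
    rw [ha, abs_neg, abs_of_nonneg (by positivity)]
    have := le_abs_self R
    have := abs_nonneg x
    linarith
  have h := (hf.lipschitzOnWith
    (s := Set.uIcc a x)).absolutelyContinuousOnInterval.integral_deriv_eq_sub
  rw [hfa, sub_zero] at h
  rw [← h]
  refine (intervalIntegral.norm_integral_le_integral_norm (f := deriv f) (μ := volume) hax).trans ?_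
  rw [intervalIntegral.integral_of_le hax]
  exact setIntegral_le_integral hint.norm (Eventually.of_forall fun _ => norm_nonneg _)

/-- Lipschitz and `C¹` functions are absolutely continuous on compact intervals, so integration by
parts holds there, and the boundary terms vanish on an interval beyond the support of `φ`. -/
theorem integral_mul_deriv_eq_neg {f φ : ℝ → ℝ} {K : NNReal} {R : ℝ} (hf : ContDiff ℝ 1 f)
    (hφ : LipschitzWith K φ) (h0 : ∀ x, R < |x| → φ x = 0) :
    ∫ x, f x * deriv φ x = -∫ x, deriv f x * φ x := by
  have h0' : ∀ x, |R| < |x| → φ x = 0 := fun x hx => h0 x ((le_abs_self R).trans_lt hx)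
  rw [integral_eq_intervalIntegral_of_eq_zero (abs_nonneg R)
      (fun x hx => by rw [deriv_eq_zero_of_eq_zero h0' hx, mul_zero]),
    integral_eq_intervalIntegral_of_eq_zero (f := fun x => deriv f x * φ x) (abs_nonneg R)
      (fun x hx => by rw [h0' x hx, mul_zero])]
  rw [AbsolutelyContinuousOnInterval.integral_mul_deriv_eq_deriv_mul
    (hf.contDiffOn.absolutelyContinuousOnInterval)
    (hφ.lipschitzOnWith.absolutelyContinuousOnInterval)]
  have hb : |R| < |(|R| + 1)| := by
    rw [abs_of_nonneg (by positivity : 0 ≤ |R| + 1)]; linarith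
  rw [h0' (|R| + 1) hb, h0' (-(|R| + 1)) (by rw [abs_neg]; exact hb)]
  ring

/-! ### Slices of Lipschitz functions on the plane -/

theorem lipschitzWith_slice_fst {F : ℝ × ℝ → ℝ} {K : NNReal} (hF : LipschitzWith K F) (y : ℝ) :
    LipschitzWith K fun s => F (s, y) := by
  have h := hF.comp (LipschitzWith.prodMk_right y)
  rwa [mul_one] at h

theorem lipschitzWith_slice_snd {F : ℝ × ℝ → ℝ} {K : NNReal} (hF : LipschitzWith K F) (x : ℝ) :
    LipschitzWith K fun t => F (x, t) := by
  have h := hF.comp (LipschitzWith.prodMk_left x)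
  rwa [mul_one] at h

theorem slice_fst_eq_zero {F : ℝ × ℝ → ℝ} {R : ℝ} (h0 : ∀ p, R < ‖p‖ → F p = 0) (y x : ℝ)
    (hx : R < |x|) : F (x, y) = 0 :=
  h0 _ (hx.trans_le (norm_fst_le (x, y)))

theorem slice_snd_eq_zero {F : ℝ × ℝ → ℝ} {R : ℝ} (h0 : ∀ p, R < ‖p‖ → F p = 0) (x y : ℝ)
    (hy : R < |y|) : F (x, y) = 0 :=
  h0 _ (hy.trans_le (norm_snd_le (x, y)))

theorem hasDerivAt_slice_fst {F : ℝ × ℝ → ℝ} {x y : ℝ} (h : DifferentiableAt ℝ F (x, y)) :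
    HasDerivAt (fun s => F (s, y)) (fderiv ℝ F (x, y) (1, 0)) x :=
  h.hasFDerivAt.comp_hasDerivAt x ((hasDerivAt_id x).prodMk (hasDerivAt_const x y))

theorem hasDerivAt_slice_snd {F : ℝ × ℝ → ℝ} {x y : ℝ} (h : DifferentiableAt ℝ F (x, y)) :
    HasDerivAt (fun t => F (x, t)) (fderiv ℝ F (x, y) (0, 1)) y :=
  h.hasFDerivAt.comp_hasDerivAt y ((hasDerivAt_const y x).prodMk (hasDerivAt_id y))

theorem ae_ae_swap {P : ℝ × ℝ → Prop} (h : ∀ᵐ p : ℝ × ℝ, P p) : ∀ᵐ y : ℝ, ∀ᵐ x : ℝ, P (x, y) := by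
  have h' : ∀ᵐ p : ℝ × ℝ, P p.swap :=
    (Measure.measurePreserving_swap (μ := (volume : Measure ℝ))
      (ν := (volume : Measure ℝ))).quasiMeasurePreserving.ae h
  exact Measure.ae_ae_of_ae_prod h'

theorem ae_ae_slice {P : ℝ × ℝ → Prop} (h : ∀ᵐ p : ℝ × ℝ, P p) : ∀ᵐ x : ℝ, ∀ᵐ y : ℝ, P (x, y) :=
  Measure.ae_ae_of_ae_prod h

theorem ae_ne_zero : ∀ᵐ x : ℝ, x ≠ 0 := by simp [ae_iff, measure_singleton]

theorem ae_fst {P : ℝ → Prop} (h : ∀ᵐ x : ℝ, P x) : ∀ᵐ p : ℝ × ℝ, P p.1 :=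
  Measure.quasiMeasurePreserving_fst.ae h

theorem ae_snd {P : ℝ → Prop} (h : ∀ᵐ x : ℝ, P x) : ∀ᵐ p : ℝ × ℝ, P p.2 :=
  Measure.quasiMeasurePreserving_snd.ae h

theorem fderiv_eq_zero_of_eq_zero {F : ℝ × ℝ → ℝ} {R : ℝ} (h0 : ∀ p, R < ‖p‖ → F p = 0)
    {p : ℝ × ℝ} (hp : R < ‖p‖) : fderiv ℝ F p = 0 := by
  have : F =ᶠ[𝓝 p] fun _ => 0 := by
    filter_upwards [(isOpen_lt continuous_const continuous_norm).mem_nhds hp] with q hq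
      using h0 q hq
  rw [this.fderiv_eq, fderiv_fun_const]; rfl

theorem abs_fderiv_le {F : ℝ × ℝ → ℝ} {K : NNReal} (hF : LipschitzWith K F) (p v : ℝ × ℝ)
    (hv : ‖v‖ ≤ 1) : |fderiv ℝ F p v| ≤ K := by
  calc |fderiv ℝ F p v| ≤ ‖fderiv ℝ F p‖ * ‖v‖ := (fderiv ℝ F p).le_opNorm v
    _ ≤ K * 1 := by gcongr; exact norm_fderiv_le_of_lipschitz ℝ hF
    _ = K := mul_one _

theorem integrable_fderiv {F : ℝ × ℝ → ℝ} {K : NNReal} {R : ℝ} (hF : LipschitzWith K F)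
    (h0 : ∀ p, R < ‖p‖ → F p = 0) (v : ℝ × ℝ) (hv : ‖v‖ ≤ 1) :
    Integrable (fun p => fderiv ℝ F p v) volume :=
  integrable_of_bounded_of_eq_zero (c := K) (R := R)
    (measurable_fderiv_apply_const ℝ F v).aestronglyMeasurable (fun p => abs_fderiv_le hF p v hv)
    (fun p hp => by rw [fderiv_eq_zero_of_eq_zero h0 hp]; rfl)

/-- By Rademacher and Fubini, on almost every slice `F` is differentiable at almost every point, so
the slice derivative agrees a.e. with the partial derivative and the one-dimensional bound applies.
-/
theorem ae_forall_abs_le_slice_fst {F : ℝ × ℝ → ℝ} {K : NNReal} {R : ℝ} (hF : LipschitzWith K F)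
    (h0 : ∀ p, R < ‖p‖ → F p = 0) :
    ∀ᵐ y : ℝ, ∀ x, |F (x, y)| ≤ ∫ s, |fderiv ℝ F (s, y) (1, 0)| := by
  filter_upwards [ae_ae_swap (hF.ae_differentiableAt (μ := volume))] with y hy x
  refine (abs_le_integral_abs_deriv (lipschitzWith_slice_fst hF y)
    (slice_fst_eq_zero h0 y) x).trans_eq (integral_congr_ae ?_)
  filter_upwards [hy] with s hs
  rw [(hasDerivAt_slice_fst hs).deriv]

theorem ae_forall_abs_le_slice_snd {F : ℝ × ℝ → ℝ} {K : NNReal} {R : ℝ} (hF : LipschitzWith K F)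
    (h0 : ∀ p, R < ‖p‖ → F p = 0) :
    ∀ᵐ x : ℝ, ∀ y, |F (x, y)| ≤ ∫ t, |fderiv ℝ F (x, t) (0, 1)| := by
  filter_upwards [ae_ae_slice (hF.ae_differentiableAt (μ := volume))] with x hx y
  refine (abs_le_integral_abs_deriv (lipschitzWith_slice_snd hF x)
    (slice_snd_eq_zero h0 x) y).trans_eq (integral_congr_ae ?_)
  filter_upwards [hx] with t ht
  rw [(hasDerivAt_slice_snd ht).deriv]

/-- Integration by parts in the first variable against a Lipschitz function. -/
theorem integral_mul_fderiv_fst {F F' φ : ℝ × ℝ → ℝ} {K : NNReal} {R : ℝ}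
    (hφ : LipschitzWith K φ) (h0 : ∀ p, R < ‖p‖ → φ p = 0)
    (hF : ∀ᵐ y : ℝ, ContDiff ℝ 1 fun s => F (s, y))
    (hF' : ∀ᵐ y : ℝ, ∀ᵐ x : ℝ, deriv (fun s => F (s, y)) x = F' (x, y))
    (h1 : Integrable fun p => F p * fderiv ℝ φ p (1, 0))
    (h2 : Integrable fun p => F' p * φ p) :
    ∫ p, F p * fderiv ℝ φ p (1, 0) = -∫ p, F' p * φ p := by
  rw [← integral_neg, Measure.volume_eq_prod, integral_prod_symm _ h1, integral_prod_symm _ h2.fun_neg]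
  apply integral_congr_ae
  filter_upwards [hF, hF', ae_ae_swap (hφ.ae_differentiableAt (μ := volume))] with y hy hy' hd
  rw [integral_neg]
  have h := integral_mul_deriv_eq_neg hy (lipschitzWith_slice_fst hφ y) (slice_fst_eq_zero h0 y)
  rw [integral_congr_ae (g := fun x => F (x, y) * deriv (fun s => φ (s, y)) x), h,
    integral_congr_ae (g := fun x => F' (x, y) * φ (x, y))]
  · filter_upwards [hy'] with x hx
    rw [hx]
  · filter_upwards [hd] with x hx
    rw [(hasDerivAt_slice_fst hx).deriv]

/-- Integration by parts in the second variable against a Lipschitz function. -/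
theorem integral_mul_fderiv_snd {F F' φ : ℝ × ℝ → ℝ} {K : NNReal} {R : ℝ}
    (hφ : LipschitzWith K φ) (h0 : ∀ p, R < ‖p‖ → φ p = 0)
    (hF : ∀ᵐ x : ℝ, ContDiff ℝ 1 fun t => F (x, t))
    (hF' : ∀ᵐ x : ℝ, ∀ᵐ y : ℝ, deriv (fun t => F (x, t)) y = F' (x, y))
    (h1 : Integrable fun p => F p * fderiv ℝ φ p (0, 1))
    (h2 : Integrable fun p => F' p * φ p) :
    ∫ p, F p * fderiv ℝ φ p (0, 1) = -∫ p, F' p * φ p := by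
  rw [← integral_neg, Measure.volume_eq_prod, integral_prod _ h1, integral_prod _ h2.fun_neg]
  apply integral_congr_ae
  filter_upwards [hF, hF', ae_ae_slice (hφ.ae_differentiableAt (μ := volume))] with x hx hx' hd
  rw [integral_neg]
  have h := integral_mul_deriv_eq_neg hx (lipschitzWith_slice_snd hφ x) (slice_snd_eq_zero h0 x)
  rw [integral_congr_ae (g := fun y => F (x, y) * deriv (fun t => φ (x, t)) y), h,
    integral_congr_ae (g := fun y => F' (x, y) * φ (x, y))]
  · filter_upwards [hx'] with y hy
    rw [hy]
  · filter_upwards [hd] with y hy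
    rw [(hasDerivAt_slice_snd hy).deriv]

/-! ### The bump function `Φ_N` and the Orlicz–Sobolev inequality -/

/-- The two branches switch where `log |t| = 2N`, so a maximum merges them. In this form the slope
factor is visibly monotone in `|t|`, which drives the estimates below. -/
theorem bump_eq (N t : ℝ) : bump N t = |t| * max (2 * N) (Real.log |t|) ^ N := by
  unfold bump
  split_ifs with h
  · rw [max_eq_right ((Real.le_log_iff_exp_le ((Real.exp_pos _).trans_le h)).2 h)]
  · rcases eq_or_ne t 0 with rfl | ht
    · simp
    · rw [max_eq_left, mul_comm]
      rw [not_le, ← Real.log_lt_iff_lt_exp (abs_pos.2 ht)] at h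
      exact h.le

theorem bump_zero (N : ℝ) : bump N 0 = 0 := by simp [bump_eq]

theorem bump_nonneg {N : ℝ} (hN : 0 ≤ N) (t : ℝ) : 0 ≤ bump N t := by
  rw [bump_eq]
  have : 0 ≤ max (2 * N) (Real.log |t|) := le_max_of_le_left (by positivity)
  positivity

/-- A substitute for convexity through the origin: the logarithmic factor only decreases when `|t|`
does. It lets a large constant be absorbed when an integral must be brought below one. -/
theorem bump_div_le {N k : ℝ} (hN : 0 ≤ N) (hk : 1 ≤ k) (t : ℝ) :
    bump N (t / k) ≤ bump N t / k := by
  rcases eq_or_ne t 0 with rfl | ht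
  · simp [bump_zero]
  have hk0 : 0 < k := one_pos.trans_le hk
  have ht0 := abs_pos.2 ht
  have h2 : |t / k| = |t| / k := by rw [abs_div, abs_of_pos hk0]
  have h1 : max (2 * N) (Real.log (|t| / k)) ≤ max (2 * N) (Real.log |t|) :=
    max_le_max le_rfl (Real.log_le_log (by positivity) (div_le_self ht0.le hk))
  rw [bump_eq, bump_eq, h2, div_mul_eq_mul_div]
  gcongr

theorem continuous_bump {N : ℝ} (hN : 0 < N) : Continuous (bump N) := by
  have h : bump N = fun t => |t| * max (2 * N) (Real.log |t|) ^ N := funext (bump_eq N)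
  rw [continuous_iff_continuousAt]
  intro t
  rcases eq_or_ne t 0 with rfl | ht
  · have h1 : bump N =ᶠ[𝓝 0] fun t => |t| * (2 * N) ^ N := by
      filter_upwards [Metric.ball_mem_nhds (0 : ℝ) (Real.exp_pos (2 * N))] with t ht
      rw [bump, if_neg, mul_comm]
      simpa using ht
    exact ContinuousAt.congr (by fun_prop) h1.symm
  · rw [h]
    have h2 : ContinuousAt (fun t : ℝ => Real.log |t|) t :=
      continuous_abs.continuousAt.log (abs_ne_zero.2 ht)
    exact continuous_abs.continuousAt.mul
      ((continuousAt_const.max h2).rpow_const (Or.inr hN.le))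

/-- The sum is at most three times its largest term. -/
theorem add_add_rpow_le {N u v w : ℝ} (hN : 0 ≤ N) (hu : 0 ≤ u) (hv : 0 ≤ v) (hw : 0 ≤ w) :
    (u + v + w) ^ N ≤ 3 ^ N * (u ^ N + v ^ N + w ^ N) := by
  have hmul : ∀ z : ℝ, 0 ≤ z → (3 * z) ^ N = 3 ^ N * z ^ N := fun z hz =>
    Real.mul_rpow (by norm_num) hz
  have h1 : 0 ≤ u ^ N := by positivity
  have h2 : 0 ≤ v ^ N := by positivity
  have h3 : 0 ≤ w ^ N := by positivity
  have key : ∀ z : ℝ, 0 ≤ z → u + v + w ≤ 3 * z → z ^ N ≤ u ^ N + v ^ N + w ^ N →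
      (u + v + w) ^ N ≤ 3 ^ N * (u ^ N + v ^ N + w ^ N) := fun z hz h h' => by
    calc (u + v + w) ^ N ≤ (3 * z) ^ N := Real.rpow_le_rpow (by positivity) h hN
      _ = 3 ^ N * z ^ N := hmul z hz
      _ ≤ _ := by gcongr
  rcases le_total u v with h | h <;> rcases le_total v w with h' | h' <;>
    rcases le_total u w with h'' | h''
  all_goals first
    | exact key u hu (by linarith) (by linarith)
    | exact key v hv (by linarith) (by linarith)
    | exact key w hw (by linarith) (by linarith)

/-- The elementary inequality behind the `L¹` Orlicz–Sobolev inequality. -/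
theorem exists_bump_le {α N : ℝ} (hα : 0 < α) (hN : 1 ≤ N) :
    ∃ C : ℝ, 0 ≤ C ∧ ∀ x h a b : ℝ, x ≠ 0 → 0 ≤ h → h ≤ a → |gfun α x| * h ≤ b →
      bump N h ≤ a * (C * (1 + b + |x| ^ (-(α * N)))) := by
  have hN0 : 0 < N := by linarith
  set C₁ : ℝ := 2 * N + |Real.log α| with hC₁
  have hC₁0 : 0 ≤ C₁ := by positivity
  refine ⟨3 ^ N * (C₁ ^ N + N ^ N + 1), by positivity, fun x h a b hx hh ha hb => ?_⟩
  rw [bump_eq, abs_of_nonneg hh]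
  have hb0 : 0 ≤ b := le_trans (by positivity) hb
  have hxp : 0 < |x| := abs_pos.2 hx
  have hX : 0 ≤ |x| ^ (-α) := by positivity
  -- From `α exp(-|x|^(-α)) h ≤ |g| h ≤ b`, taking logarithms; `C₁` absorbs both `2N` and `|log α|`.
  have hm : max (2 * N) (Real.log h) ≤ C₁ + max (Real.log b) 0 + |x| ^ (-α) := by
    have hl := le_max_left (Real.log b) 0
    have hl' := le_max_right (Real.log b) 0
    apply max_le
    · have := abs_nonneg (Real.log α); linarith
    · rcases hh.eq_or_lt with rfl | hpos
      · rw [Real.log_zero]; positivity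
      have hg := le_abs_gfun hα hx
      have hE : 0 < α * Real.exp (-|x| ^ (-α)) := by positivity
      have h1 : α * Real.exp (-|x| ^ (-α)) * h ≤ b :=
        (mul_le_mul_of_nonneg_right hg hh).trans hb
      have h2 := Real.log_le_log (by positivity) h1
      rw [Real.log_mul hE.ne' hpos.ne', Real.log_mul hα.ne' (Real.exp_pos _).ne', Real.log_exp] at h2
      have := neg_abs_le (Real.log α)
      linarith
  -- The inequality `log b ≤ N b^(1/N)` turns the power of the logarithm into something linear in
  -- `b`, whose integral is under control.
  have hlog : (max (Real.log b) 0) ^ N ≤ N ^ N * b := by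
    rcases le_total b 1 with h1 | h1
    · rw [max_eq_right (Real.log_nonpos hb0 h1), Real.zero_rpow hN0.ne']; positivity
    · rw [max_eq_left (Real.log_nonneg h1)]
      have h2 : Real.log b ≤ N * b ^ (1 / N) := by
        have := Real.log_le_rpow_div hb0 (ε := 1 / N) (by positivity)
        rwa [div_div_eq_mul_div, div_one, mul_comm] at this
      calc Real.log b ^ N ≤ (N * b ^ (1 / N)) ^ N :=
            Real.rpow_le_rpow (Real.log_nonneg h1) h2 hN0.le
        _ = N ^ N * b := by
            rw [Real.mul_rpow hN0.le (by positivity), ← Real.rpow_mul hb0, one_div,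
              inv_mul_cancel₀ hN0.ne', Real.rpow_one]
  have hm0 : 0 ≤ max (2 * N) (Real.log h) := le_max_of_le_left (by positivity)
  have hpow : max (2 * N) (Real.log h) ^ N ≤
      3 ^ N * (C₁ ^ N + N ^ N + 1) * (1 + b + |x| ^ (-(α * N))) := by
    have hXN : (|x| ^ (-α)) ^ N = |x| ^ (-(α * N)) := by
      rw [← Real.rpow_mul hxp.le, neg_mul]
    calc max (2 * N) (Real.log h) ^ N ≤ (C₁ + max (Real.log b) 0 + |x| ^ (-α)) ^ N :=
          Real.rpow_le_rpow hm0 hm hN0.le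
      _ ≤ 3 ^ N * (C₁ ^ N + max (Real.log b) 0 ^ N + (|x| ^ (-α)) ^ N) :=
          add_add_rpow_le hN0.le hC₁0 (le_max_right _ _) hX
      _ ≤ 3 ^ N * (C₁ ^ N + N ^ N * b + |x| ^ (-(α * N))) := by
          rw [hXN]; gcongr
      _ ≤ 3 ^ N * ((C₁ ^ N + N ^ N + 1) * (1 + b + |x| ^ (-(α * N)))) := by
          gcongr
          have h1 : 0 ≤ C₁ ^ N := by positivity
          have h2 : 0 ≤ N ^ N := by positivity
          have h3 : 0 ≤ |x| ^ (-(α * N)) := by positivity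
          nlinarith [mul_nonneg h1 hb0, mul_nonneg h1 h3, mul_nonneg h2 h3]
      _ = _ := by ring
  calc h * max (2 * N) (Real.log h) ^ N ≤ a * max (2 * N) (Real.log h) ^ N := by gcongr
    _ ≤ _ := by
      have : 0 ≤ a := hh.trans ha
      gcongr

/-- Applied with `p = αN`: this is where the condition `αN < 1` acts. -/
theorem integrableOn_abs_rpow_neg {p : ℝ} (hp : p < 1) :
    IntegrableOn (fun x : ℝ => |x| ^ (-p)) (Set.Ioo (-1) 1) volume := by
  have h : IntervalIntegrable (fun x : ℝ => x ^ (-p)) volume 0 1 :=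
    intervalIntegral.intervalIntegrable_rpow' (by linarith)
  have h1 : IntegrableOn (fun x : ℝ => |x| ^ (-p)) (Set.Ioo 0 1) volume := by
    rw [intervalIntegrable_iff_integrableOn_Ioo_of_le zero_le_one] at h
    refine h.congr_fun (fun x hx => ?_) measurableSet_Ioo
    simp only [abs_of_pos hx.1]
  have h2 : IntegrableOn (fun x : ℝ => |x| ^ (-p)) (Set.Ioo (-1) 0) volume := by
    have h3 := h1.comp_neg
    simpa using h3
  have h4 : IntegrableOn (fun x : ℝ => |x| ^ (-p)) {0} volume := by simp
  refine (h2.union (h4.union h1)).mono_set fun x hx => ?_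
  rcases lt_trichotomy x 0 with h | h | h
  · exact Or.inl ⟨hx.1, h⟩
  · exact Or.inr (Or.inl h)
  · exact Or.inr (Or.inr ⟨h, hx.2⟩)

/-- The `L¹` Orlicz–Sobolev inequality, for Lipschitz functions. -/
theorem exists_lintegral_bump_le {α N : ℝ} (hα : 0 < α) (hN : 1 ≤ N) (hαN : α * N < 1) :
    ∃ K : ℝ, 0 ≤ K ∧ ∀ (F : ℝ × ℝ → ℝ) (L : NNReal) (R : ℝ), LipschitzWith L F →
      (∀ p, R < ‖p‖ → F p = 0) → (∀ p, 1 ≤ |p.1| → F p = 0) → (∀ p, 0 ≤ F p) →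
      ∫ p, |fderiv ℝ F p (1, 0)| ≤ 1 → ∫ p, |gfun α p.1| * |fderiv ℝ F p (0, 1)| ≤ 1 →
      ∫⁻ p, ENNReal.ofReal (bump N (F p)) ≤ ENNReal.ofReal K := by
  obtain ⟨C, hC, hpt⟩ := exists_bump_le hα hN
  set J : ℝ := ∫ x in Set.Ioo (-1 : ℝ) 1, |x| ^ (-(α * N)) with hJ
  have hJ0 : 0 ≤ J := integral_nonneg fun x => by positivity
  refine ⟨C * (3 + J), by positivity, fun F L R hF h0 h1 hpos hx hy => ?_⟩
  set a : ℝ → ℝ := fun y => ∫ s, |fderiv ℝ F (s, y) (1, 0)| with ha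
  set b : ℝ → ℝ := fun x => ∫ t, |gfun α x| * |fderiv ℝ F (x, t) (0, 1)| with hb
  have hv1 : ‖((1, 0) : ℝ × ℝ)‖ ≤ 1 := by simp
  have hv2 : ‖((0, 1) : ℝ × ℝ)‖ ≤ 1 := by simp
  have hix : Integrable (fun p => |fderiv ℝ F p (1, 0)|) (volume.prod volume) :=
    (integrable_fderiv hF h0 (1, 0) hv1).abs
  have hiy : Integrable (fun p : ℝ × ℝ => |gfun α p.1| * |fderiv ℝ F p (0, 1)|)
      (volume.prod volume) := by
    refine integrable_of_bounded_of_eq_zero (c := (2 * α + 1) * L) (R := R) ?_ ?_ ?_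
    · exact (((measurable_gfun α).comp measurable_fst).abs.mul
        (measurable_fderiv_apply_const ℝ F (0, 1)).abs).aestronglyMeasurable
    · intro p
      rw [abs_of_nonneg (by positivity)]
      rcases le_or_gt |p.1| 1 with h | h
      · gcongr
        · exact abs_gfun_le_const hα h
        · exact abs_fderiv_le hF p _ hv2
      · have : F =ᶠ[𝓝 p] fun _ => 0 := by
          filter_upwards [(isOpen_lt continuous_const
            (continuous_abs.comp continuous_fst)).mem_nhds h] with q hq using h1 q (le_of_lt hq)
        rw [this.fderiv_eq, fderiv_fun_const]
        simp; positivity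
    · intro p hp
      rw [fderiv_eq_zero_of_eq_zero h0 hp]
      simp
  have hia : Integrable a volume := hix.integral_prod_right
  have hib : Integrable b volume := hiy.integral_prod_left
  have hIa : ∫ y, a y ≤ 1 := by
    rw [ha, ← integral_prod_symm _ hix]; exact hx
  have hIb : ∫ x, b x ≤ 1 := by
    rw [hb, ← integral_prod _ hiy]; exact hy
  have ha0 : ∀ y, 0 ≤ a y := fun y => integral_nonneg fun _ => abs_nonneg _
  have hb0 : ∀ y, 0 ≤ b y := fun y => integral_nonneg fun _ => by positivity
  -- The pointwise majorant is `κ(x) a(y)`, so its integral factors. In `C(3 + J)` the `3` is the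
  -- length `2` of `(-1, 1)` plus the bound `1` for `∫ b`.
  set κ : ℝ → ℝ := (Set.Ioo (-1 : ℝ) 1).indicator
    fun x => C * (1 + b x + |x| ^ (-(α * N))) with hκ
  have hκ0 : ∀ x, 0 ≤ κ x := fun x => Set.indicator_nonneg (fun x _ => by
    have := hb0 x; positivity) x
  have hiκ' : IntegrableOn (fun x => C * (1 + b x + |x| ^ (-(α * N)))) (Set.Ioo (-1 : ℝ) 1) :=
    (((integrable_const (1 : ℝ)).add hib.integrableOn).add
      (integrableOn_abs_rpow_neg hαN)).const_mul C
  have hiκ : Integrable κ volume := (integrable_indicator_iff measurableSet_Ioo).2 hiκ'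
  have hIκ : ∫ x, κ x ≤ C * (3 + J) := by
    have h1b : IntegrableOn (fun x => 1 + b x) (Set.Ioo (-1 : ℝ) 1) :=
      (integrable_const (1 : ℝ)).add hib.integrableOn
    rw [hκ, integral_indicator measurableSet_Ioo, integral_const_mul,
      integral_add h1b (integrableOn_abs_rpow_neg hαN),
      integral_add (integrable_const (1 : ℝ)) hib.integrableOn]
    have h2 : ∫ x in Set.Ioo (-1 : ℝ) 1, b x ≤ 1 :=
      (setIntegral_le_integral hib (Eventually.of_forall hb0)).trans hIb
    have h3 : ∫ x in Set.Ioo (-1 : ℝ) 1, (1 : ℝ) = 2 := by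
      simp; norm_num
    rw [h3]
    gcongr
    linarith
  have hprod : Integrable (fun p : ℝ × ℝ => κ p.1 * a p.2) (volume.prod volume) := hiκ.mul_prod hia
  calc ∫⁻ p, ENNReal.ofReal (bump N (F p))
      ≤ ∫⁻ p : ℝ × ℝ, ENNReal.ofReal (κ p.1 * a p.2) := by
        apply lintegral_mono_ae
        filter_upwards [ae_snd (ae_forall_abs_le_slice_fst hF h0),
          ae_fst (ae_forall_abs_le_slice_snd hF h0), ae_fst ae_ne_zero] with p h2 h3 h4
        apply ENNReal.ofReal_le_ofReal
        rcases le_or_gt 1 |p.1| with h | h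
        · rw [h1 p h, bump_zero]
          exact mul_nonneg (hκ0 _) (ha0 _)
        · have h5 : p.1 ∈ Set.Ioo (-1 : ℝ) 1 := abs_lt.1 h
          rw [hκ, Set.indicator_of_mem h5, mul_comm]
          apply hpt _ _ _ _ h4 (hpos p)
          · exact (le_abs_self _).trans (h2 p.1)
          · rw [hb]
            simp only [integral_const_mul]
            gcongr
            exact (le_abs_self _).trans (h3 p.2)
    _ = ENNReal.ofReal (∫ p : ℝ × ℝ, κ p.1 * a p.2) :=
        (ofReal_integral_eq_lintegral_ofReal hprod
          (Eventually.of_forall fun p => mul_nonneg (hκ0 _) (ha0 _))).symm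
    _ ≤ ENNReal.ofReal (C * (3 + J)) := by
        apply ENNReal.ofReal_le_ofReal
        rw [Measure.volume_eq_prod, integral_prod_mul]
        calc (∫ x, κ x) * ∫ y, a y ≤ (C * (3 + J)) * 1 := by
              apply mul_le_mul hIκ hIa (integral_nonneg ha0) (by positivity)
          _ = _ := mul_one _

theorem lipschitzWith_sq {φ : ℝ × ℝ → ℝ} {L : NNReal} (hφ : LipschitzWith L φ) {M : ℝ}
    (hM : ∀ p, |φ p| ≤ M) : ∃ L' : NNReal, LipschitzWith L' fun p => φ p ^ 2 := by
  have hM0 : 0 ≤ M := (abs_nonneg _).trans (hM 0)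
  refine ⟨(2 * M).toNNReal * L, LipschitzWith.of_dist_le_mul fun p q => ?_⟩
  have h1 := hφ.dist_le_mul p q
  rw [Real.dist_eq] at h1 ⊢
  have h2 : |φ p + φ q| ≤ 2 * M := (abs_add_le _ _).trans (by linarith [hM p, hM q])
  calc |φ p ^ 2 - φ q ^ 2| = |φ p + φ q| * |φ p - φ q| := by rw [← abs_mul]; congr 1; ring
    _ ≤ (2 * M) * (L * dist p q) := by gcongr
    _ = _ := by
      rw [NNReal.coe_mul, Real.coe_toNNReal _ (by positivity)]
      ring

theorem integrable_mul_fderiv {m : ℝ × ℝ → ℝ} {φ : ℝ × ℝ → ℝ} {R c : ℝ} {v : ℝ × ℝ}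
    (hm : Measurable m) (hb : ∀ p, |m p * fderiv ℝ φ p v| ≤ c) (h0 : ∀ p, R < ‖p‖ → φ p = 0) :
    Integrable fun p => m p * fderiv ℝ φ p v :=
  integrable_of_bounded_of_eq_zero (c := c) (R := R)
    (hm.mul (measurable_fderiv_apply_const ℝ φ v)).aestronglyMeasurable hb
    (fun p hp => by rw [fderiv_eq_zero_of_eq_zero h0 hp]; simp)

theorem fderiv_eq_zero_of_strip {φ : ℝ × ℝ → ℝ} {ρ : ℝ} (h1 : ∀ p, ρ ≤ |p.1| → φ p = 0)
    {p : ℝ × ℝ} (hp : ρ < |p.1|) : fderiv ℝ φ p = 0 := by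
  have : φ =ᶠ[𝓝 p] fun _ => 0 := by
    filter_upwards [(isOpen_lt continuous_const
      (continuous_abs.comp continuous_fst)).mem_nhds hp] with q hq using h1 q (le_of_lt hq)
  rw [this.fderiv_eq, fderiv_fun_const]; rfl

/-- The Orlicz–Sobolev inequality at unit scale, for Lipschitz functions. -/
theorem exists_lintegral_bump_sq_le {α N : ℝ} (hα : 0 < α) (hN : 1 ≤ N) (hαN : α * N < 1) :
    ∃ K : ℝ, 0 ≤ K ∧ ∀ (φ : ℝ × ℝ → ℝ) (L : NNReal) (R : ℝ), LipschitzWith L φ →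
      (∀ p, R < ‖p‖ → φ p = 0) → (∀ p, 1 ≤ |p.1| → φ p = 0) →
      ∫ p, (fderiv ℝ φ p (1, 0)) ^ 2 ≤ 1 / 32 →
      ∫ p, (gfun α p.1 * fderiv ℝ φ p (0, 1)) ^ 2 ≤ 1 / 32 →
      ∫⁻ p, ENNReal.ofReal (bump N (φ p ^ 2)) ≤ ENNReal.ofReal K := by
  obtain ⟨K, hK, H⟩ := exists_lintegral_bump_le hα hN hαN
  refine ⟨K, hK, fun φ L R hφ h0 h1 hx hy => ?_⟩
  have hv1 : ‖((1, 0) : ℝ × ℝ)‖ ≤ 1 := by simp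
  have hv2 : ‖((0, 1) : ℝ × ℝ)‖ ≤ 1 := by simp
  obtain ⟨M, hM⟩ : ∃ M, ∀ p, |φ p| ≤ M := by
    obtain ⟨M, hM⟩ := (isCompact_closedBall (0 : ℝ × ℝ) R).bddAbove_image
      (hφ.continuous.abs.continuousOn)
    refine ⟨max M 0, fun p => ?_⟩
    rcases le_or_gt ‖p‖ R with h | h
    · exact (hM ⟨p, by simpa using h, rfl⟩).trans (le_max_left _ _)
    · rw [h0 p h, abs_zero]; exact le_max_right _ _
  have hM0 : 0 ≤ M := (abs_nonneg _).trans (hM 0)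
  obtain ⟨L', hL'⟩ := lipschitzWith_sq hφ hM
  have hF0 : ∀ p, R < ‖p‖ → φ p ^ 2 = 0 := fun p hp => by rw [h0 p hp]; simp
  have hF1 : ∀ p : ℝ × ℝ, 1 ≤ |p.1| → φ p ^ 2 = 0 := fun p hp => by rw [h1 p hp]; simp
  have hder : ∀ᵐ p : ℝ × ℝ, ∀ v, fderiv ℝ (fun q => φ q ^ 2) p v = 2 * φ p * fderiv ℝ φ p v := by
    filter_upwards [hφ.ae_differentiableAt (μ := volume)] with p hp v
    have := (hp.hasFDerivAt.pow 2).fderiv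
    rw [this]; simp
  have hiF : Integrable fun p => φ p ^ 2 :=
    integrable_of_bounded_of_eq_zero (c := M ^ 2) (R := R)
      hL'.continuous.aestronglyMeasurable
      (fun p => by rw [abs_of_nonneg (sq_nonneg _), ← sq_abs]; gcongr; exact hM p) hF0
  have hiX : Integrable fun p => (fderiv ℝ φ p (1, 0)) ^ 2 := by
    simp only [sq]
    refine integrable_mul_fderiv (c := L * L) (R := R) (measurable_fderiv_apply_const ℝ φ _) ?_ h0
    intro p
    rw [abs_mul]
    gcongr <;> exact abs_fderiv_le hφ p _ hv1
  have hgL : ∀ p : ℝ × ℝ, |gfun α p.1 * fderiv ℝ φ p (0, 1)| ≤ (2 * α + 1) * L := fun p => by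
    rcases le_or_gt |p.1| 1 with h | h
    · rw [abs_mul]
      gcongr
      · exact abs_gfun_le_const hα h
      · exact abs_fderiv_le hφ p _ hv2
    · rw [fderiv_eq_zero_of_strip h1 h]; simp; positivity
  have hgm : Measurable fun p : ℝ × ℝ => gfun α p.1 := (measurable_gfun α).comp measurable_fst
  have hiY : Integrable fun p : ℝ × ℝ => (gfun α p.1 * fderiv ℝ φ p (0, 1)) ^ 2 := by
    have : ∀ p : ℝ × ℝ, (gfun α p.1 * fderiv ℝ φ p (0, 1)) ^ 2 =
        (gfun α p.1 * (gfun α p.1 * fderiv ℝ φ p (0, 1))) * fderiv ℝ φ p (0, 1) := fun p => by ring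
    simp only [this]
    refine integrable_mul_fderiv (c := ((2 * α + 1) * L) ^ 2) (R := R)
      (hgm.mul (hgm.mul (measurable_fderiv_apply_const ℝ φ _))) ?_ h0
    intro p
    rw [← this, abs_of_nonneg (sq_nonneg _), ← sq_abs]
    gcongr
    exact hgL p
  set A : ℝ := ∫ p, φ p ^ 2 with hA
  set S : ℝ := ∫ p, |fderiv ℝ (fun q => φ q ^ 2) p (1, 0)| with hS
  have hiS : Integrable (fun p => |fderiv ℝ (fun q => φ q ^ 2) p (1, 0)|) (volume.prod volume) :=
    (integrable_fderiv hL' hF0 (1, 0) hv1).abs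
  -- From `2|φ φ_x| ≤ φ²/4 + 4 φ_x²`. The weight `1/4` is small enough to be absorbed through `A ≤
  -- 2S` below.
  have hS1 : S ≤ A / 4 + 4 * (1 / 32) := by
    calc S ≤ ∫ p, (φ p ^ 2 / 4 + 4 * (fderiv ℝ φ p (1, 0)) ^ 2) := by
          apply integral_mono_ae hiS ((hiF.div_const 4).add (hiX.const_mul 4))
          filter_upwards [hder] with p hp
          rw [hp (1, 0), abs_le, Pi.add_apply]
          constructor
          · nlinarith [sq_nonneg (φ p / 2 + 2 * fderiv ℝ φ p (1, 0))]
          · nlinarith [sq_nonneg (φ p / 2 - 2 * fderiv ℝ φ p (1, 0))]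
      _ = A / 4 + 4 * ∫ p, (fderiv ℝ φ p (1, 0)) ^ 2 := by
          rw [integral_add (hiF.div_const 4) (hiX.const_mul 4), integral_div, integral_const_mul]
      _ ≤ _ := by gcongr
  -- A Poincaré inequality: `φ²` is supported in a strip of width two and is bounded on each
  -- horizontal slice by the integral of `|∂_x φ²|`. Together with the previous bound it gives `S ≤
  -- 1/4` and `A ≤ 1/2`.
  have hS2 : A ≤ 2 * S := by
    have hia : Integrable (fun y => ∫ s, |fderiv ℝ (fun q => φ q ^ 2) (s, y) (1, 0)|) volume :=
      hiS.integral_prod_right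
    have hi1 : Integrable ((Set.Ioo (-1 : ℝ) 1).indicator fun _ => (1 : ℝ)) volume :=
      (integrable_indicator_iff measurableSet_Ioo).2 (integrable_const _)
    have hprod := hi1.mul_prod hia
    calc A ≤ ∫ p : ℝ × ℝ, (Set.Ioo (-1 : ℝ) 1).indicator (fun _ => (1 : ℝ)) p.1 *
          ∫ s, |fderiv ℝ (fun q => φ q ^ 2) (s, p.2) (1, 0)| := by
          apply integral_mono_ae hiF hprod
          filter_upwards [ae_snd (ae_forall_abs_le_slice_fst hL' hF0)] with p hp
          rcases le_or_gt 1 |p.1| with h | h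
          · rw [hF1 p h]
            exact mul_nonneg (Set.indicator_nonneg (fun _ _ => zero_le_one) _)
              (integral_nonneg fun _ => abs_nonneg _)
          · have h5 : p.1 ∈ Set.Ioo (-1 : ℝ) 1 := abs_lt.1 h
            rw [Set.indicator_of_mem h5, one_mul]
            exact (le_abs_self _).trans (hp p.1)
      _ = 2 * S := by
          rw [Measure.volume_eq_prod, integral_prod_mul (μ := (volume : Measure ℝ))
              (ν := (volume : Measure ℝ)) ((Set.Ioo (-1 : ℝ) 1).indicator fun _ => (1 : ℝ))
              (fun y => ∫ s, |fderiv ℝ (fun q => φ q ^ 2) (s, y) (1, 0)|),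
            ← integral_prod_symm _ hiS, integral_indicator measurableSet_Ioo]
          congr 1
          simp; norm_num
  refine H _ L' R hL' hF0 hF1 (fun p => sq_nonneg _) (by linarith) ?_
  calc ∫ p, |gfun α p.1| * |fderiv ℝ (fun q => φ q ^ 2) p (0, 1)|
      ≤ ∫ p, (φ p ^ 2 + (gfun α p.1 * fderiv ℝ φ p (0, 1)) ^ 2) := by
        apply integral_mono_of_nonneg (Eventually.of_forall fun p => by positivity)
          (hiF.add hiY)
        filter_upwards [hder] with p hp
        rw [hp (0, 1), ← abs_mul, abs_le, Pi.add_apply]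
        constructor
        · nlinarith [sq_nonneg (φ p + gfun α p.1 * fderiv ℝ φ p (0, 1))]
        · nlinarith [sq_nonneg (φ p - gfun α p.1 * fderiv ℝ φ p (0, 1))]
    _ = A + ∫ p, (gfun α p.1 * fderiv ℝ φ p (0, 1)) ^ 2 := integral_add hiF hiY
    _ ≤ 1 := by linarith

theorem integral_sq_le_of_eLpNorm_le {X : Type*} [MeasurableSpace X] {μ : Measure X} {f : X → ℝ}
    {c : ℝ} (hf : AEStronglyMeasurable f μ) (hc : 0 ≤ c)
    (h : eLpNorm f 2 μ ≤ ENNReal.ofReal c) : ∫ x, f x ^ 2 ∂μ ≤ c ^ 2 := by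
  have h1 : ∫⁻ x, ENNReal.ofReal (f x ^ 2) ∂μ ≤ ENNReal.ofReal (c ^ 2) := by
    have h2 : ∫⁻ x, ENNReal.ofReal (f x ^ 2) ∂μ = eLpNorm f 2 μ ^ (2 : ℕ) := by
      rw [eLpNorm_eq_lintegral_rpow_enorm_toReal two_ne_zero ENNReal.ofNat_ne_top,
        ← ENNReal.rpow_natCast, ← ENNReal.rpow_mul]
      simp only [ENNReal.toReal_ofNat, Nat.cast_ofNat]
      norm_num
      refine lintegral_congr fun x => ?_
      rw [← sq_abs, ENNReal.ofReal_pow (abs_nonneg _), Real.enorm_eq_ofReal_abs]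
    rw [h2, ENNReal.ofReal_pow hc]
    gcongr
  rw [integral_eq_lintegral_of_nonneg_ae (Eventually.of_forall fun x => sq_nonneg _)
    (hf.pow 2)]
  exact ENNReal.toReal_le_of_le_ofReal (sq_nonneg _) h1

/-- The norm of `ℝ × ℝ` is the maximum norm, which is dominated by the Euclidean one. -/
theorem eLpNorm_le_ofReal_sqrt {X : Type*} [MeasurableSpace X] {μ : Measure X} {G : X → ℝ × ℝ}
    (hG : MemLp G 2 μ) :
    eLpNorm G 2 μ ≤ ENNReal.ofReal √(∫ x, ((G x).1 ^ 2 + (G x).2 ^ 2) ∂μ) := by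
  have h1 : Integrable (fun x => (G x).1 ^ 2) μ := hG.fst.integrable_sq
  have h2 : Integrable (fun x => (G x).2 ^ 2) μ := hG.snd.integrable_sq
  have h12 : Integrable (fun x => (G x).1 ^ 2 + (G x).2 ^ 2) μ := h1.add h2
  have h3 : 0 ≤ ∫ x, ((G x).1 ^ 2 + (G x).2 ^ 2) ∂μ := integral_nonneg fun x => by positivity
  rw [eLpNorm_eq_lintegral_rpow_enorm_toReal two_ne_zero ENNReal.ofNat_ne_top, Real.sqrt_eq_rpow,
    ← ENNReal.ofReal_rpow_of_nonneg h3 (by norm_num),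
    ofReal_integral_eq_lintegral_ofReal h12 (Eventually.of_forall fun x => by positivity)]
  simp only [ENNReal.toReal_ofNat]
  gcongr with x
  rw [← ofReal_norm, ENNReal.ofReal_rpow_of_nonneg (norm_nonneg _) (by norm_num)]
  apply ENNReal.ofReal_le_ofReal
  rw [Real.rpow_two, Prod.norm_def, Real.norm_eq_abs, Real.norm_eq_abs]
  rcases max_choice |(G x).1| |(G x).2| with h | h <;> rw [h, sq_abs] <;>
    nlinarith [sq_nonneg (G x).1, sq_nonneg (G x).2]

theorem eq_zero_of_notMem_of_tsupport_subset {φ : ℝ × ℝ → ℝ} {B : Set (ℝ × ℝ)}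
    (h : tsupport φ ⊆ B) {p : ℝ × ℝ} (hp : p ∉ B) : φ p = 0 :=
  image_eq_zero_of_notMem_tsupport fun h' => hp (h h')

theorem fderiv_eq_zero_of_notMem {φ : ℝ × ℝ → ℝ} {B : Set (ℝ × ℝ)}
    (h : tsupport φ ⊆ B) {p : ℝ × ℝ} (hp : p ∉ B) : fderiv ℝ φ p = 0 := by
  by_contra h'
  exact hp (h (support_fderiv_subset ℝ h'))

theorem measurable_aGrad (α : ℝ) (φ : ℝ × ℝ → ℝ) : Measurable (aGrad (gfun α) φ) :=
  (measurable_fderiv_apply_const ℝ φ _).prodMk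
    (((measurable_gfun α).comp measurable_fst).mul (measurable_fderiv_apply_const ℝ φ _))

theorem integral_avgMeasure {B : Set (ℝ × ℝ)} (f : ℝ × ℝ → ℝ) :
    ∫ p, f p ∂(avgMeasure B) = (volume B).toReal⁻¹ * ∫ p in B, f p := by
  rw [avgMeasure, integral_smul_measure, ENNReal.toReal_inv, smul_eq_mul]

/-- The Orlicz–Sobolev inequality for Lipschitz functions with compact support in `B`. -/
theorem exists_lintegral_bumpSq_div_le {α N : ℝ} (hα : 0 < α) (hN : 1 ≤ N) (hαN : α * N < 1)
    {B : Set (ℝ × ℝ)} (hB : ∀ p ∈ B, |p.1| < 1) (hV0 : volume B ≠ 0) (hV : volume B ≠ ⊤) :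
    ∃ C : ℝ, 0 < C ∧ ∀ φ : ℝ × ℝ → ℝ, (∃ L, LipschitzWith L φ) → HasCompactSupport φ →
      tsupport φ ⊆ B → ∀ k : ℝ, 0 < k →
      eLpNorm (aGrad (gfun α) φ) 2 (volume.restrict B) ≤ ENNReal.ofReal (k / C) →
      ∫⁻ p, ENNReal.ofReal (bumpSq N (φ p / k)) ∂(avgMeasure B) ≤ 1 := by
  obtain ⟨K, hK, H⟩ := exists_lintegral_bump_sq_le hα hN hαN
  set V : ℝ := (volume B).toReal with hVdef
  have hVpos : 0 < V := ENNReal.toReal_pos hV0 hV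
  -- With `c² = K'/k²`, the function `cφ` has squared gradient components of integral at most
  -- `1/32`, as the unit-scale inequality requires. Then `(φ/k)² = (cφ)²/K'`, and the factor `1/K'`
  -- brings the average, at most `K/V`, below one.
  set K' : ℝ := max 1 (K / V) with hK'
  have hK'1 : 1 ≤ K' := le_max_left _ _
  have hK'0 : 0 < K' := by linarith
  refine ⟨√(32 * K'), by positivity, fun φ ⟨L, hL⟩ hcs hts k hk hle => ?_⟩
  obtain ⟨R, hR⟩ := exists_eq_zero_of_hasCompactSupport hcs
  set c : ℝ := √K' / k with hc
  have hc0 : 0 < c := by positivity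
  have hc2 : c ^ 2 = K' / k ^ 2 := by rw [hc, div_pow, Real.sq_sqrt hK'0.le]
  have hC2 : (k / √(32 * K')) ^ 2 = k ^ 2 / (32 * K') := by
    rw [div_pow, Real.sq_sqrt (by positivity)]
  have hfd : ∀ p v, fderiv ℝ (fun q => c * φ q) p v = c * fderiv ℝ φ p v := fun p v => by
    change fderiv ℝ (c • φ) p v = _
    rw [fderiv_const_smul_field]; rfl
  have hset : ∀ f : ℝ × ℝ → ℝ, (∀ p ∉ B, f p = 0) → ∫ p, f p = ∫ p in B, f p := fun f hf =>
    (setIntegral_eq_integral_of_forall_compl_eq_zero hf).symm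
  have hma := (measurable_aGrad α φ).aestronglyMeasurable (μ := volume.restrict B)
  have h1 := integral_sq_le_of_eLpNorm_le (f := fun p => (aGrad (gfun α) φ p).1) hma.fst
    (by positivity) ((eLpNorm_mono fun p => norm_fst_le _).trans hle)
  have h2 := integral_sq_le_of_eLpNorm_le (f := fun p => (aGrad (gfun α) φ p).2) hma.snd
    (by positivity) ((eLpNorm_mono fun p => norm_snd_le _).trans hle)
  have hscale : ∀ D : ℝ, D ≤ (k / √(32 * K')) ^ 2 → c ^ 2 * D ≤ 1 / 32 := fun D hD => by
    calc c ^ 2 * D ≤ c ^ 2 * (k / √(32 * K')) ^ 2 := by gcongr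
      _ = 1 / 32 := by rw [hC2, hc2]; field_simp
  have key := H (fun q => c * φ q) _ R (((lipschitzWith_smul c).comp hL))
    (fun p hp => by rw [hR p hp, mul_zero])
    (fun p hp => by
      rw [eq_zero_of_notMem_of_tsupport_subset hts (fun h => (hB p h).not_ge hp), mul_zero])
    (by
      simp only [hfd, mul_pow]
      rw [integral_const_mul]
      apply hscale
      rw [hset _ fun p hp => by rw [fderiv_eq_zero_of_notMem hts hp]; simp]
      exact h1)
    (by
      have : ∀ p : ℝ × ℝ, (gfun α p.1 * fderiv ℝ (fun q => c * φ q) p (0, 1)) ^ 2 =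
        c ^ 2 * (gfun α p.1 * fderiv ℝ φ p (0, 1)) ^ 2 := fun p => by rw [hfd]; ring
      simp only [this]
      rw [integral_const_mul]
      apply hscale
      rw [hset _ fun p hp => by rw [fderiv_eq_zero_of_notMem hts hp]; simp]
      exact h2)
  have hpt : ∀ p, ENNReal.ofReal (bumpSq N (φ p / k)) ≤
      ENNReal.ofReal K'⁻¹ * ENNReal.ofReal (bump N ((c * φ p) ^ 2)) := fun p => by
    rw [← ENNReal.ofReal_mul (by positivity)]
    apply ENNReal.ofReal_le_ofReal
    have : (φ p / k) ^ 2 = (c * φ p) ^ 2 / K' := by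
      rw [mul_pow, hc2]; field_simp
    rw [bumpSq, this, inv_mul_eq_div]
    exact bump_div_le (by linarith) hK'1 _
  calc ∫⁻ p, ENNReal.ofReal (bumpSq N (φ p / k)) ∂(avgMeasure B)
      ≤ (volume B)⁻¹ * ∫⁻ p, ENNReal.ofReal K'⁻¹ * ENNReal.ofReal (bump N ((c * φ p) ^ 2)) := by
        rw [avgMeasure, lintegral_smul_measure, smul_eq_mul]
        exact mul_le_mul' le_rfl
          ((lintegral_mono hpt).trans (setLIntegral_le_lintegral _ _))
    _ ≤ (volume B)⁻¹ * (ENNReal.ofReal K'⁻¹ * ENNReal.ofReal K) := by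
        rw [lintegral_const_mul' _ _ ENNReal.ofReal_ne_top]
        gcongr
    _ ≤ 1 := by
        rw [← ENNReal.ofReal_toReal hV, ← hVdef, ← ENNReal.ofReal_inv_of_pos hVpos,
          ← ENNReal.ofReal_mul (by positivity), ← ENNReal.ofReal_mul (by positivity),
          ← ENNReal.ofReal_one]
        apply ENNReal.ofReal_le_ofReal
        have h3 : K / V ≤ K' := le_max_right _ _
        rw [inv_mul_eq_div, inv_mul_eq_div, div_div, mul_comm, ← div_div, div_le_one hK'0]
        exact h3

/-- The inequality passes from Lipschitz functions to their closure: a subsequence of the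
approximants converges almost everywhere, and Fatou's lemma applies because `Ψ_N` is continuous. -/
theorem orliczSobolev {α N : ℝ} (hα : 0 < α) (hN : 1 ≤ N) (hαN : α * N < 1)
    {B : Set (ℝ × ℝ)} (hB : ∀ p ∈ B, |p.1| < 1) (hV0 : volume B ≠ 0) (hV : volume B ≠ ⊤) :
    OrliczSobolev (gfun α) B (bumpSq N) := by
  obtain ⟨C, hC, H⟩ := exists_lintegral_bumpSq_div_le hα hN hαN hB hV0 hV
  set V : ℝ := (volume B).toReal with hVdef
  have hVpos : 0 < V := ENNReal.toReal_pos hV0 hV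
  -- The factor `√V` compensates for the averaging in the energy.
  refine ⟨C * √V, by positivity, fun w G hw => ?_⟩
  obtain ⟨⟨hwm, hGm, -⟩, φ, hφ, hφw, hφG⟩ := hw
  set E : ℝ := ∫ p in B, ((G p).1 ^ 2 + (G p).2 ^ 2) with hE
  have hT : C * √V * √(∫ p, ((G p).1 ^ 2 + (G p).2 ^ 2) ∂(avgMeasure B)) = C * √E := by
    rw [integral_avgMeasure, mul_assoc, ← Real.sqrt_mul hVpos.le, ← mul_assoc,
      mul_inv_cancel₀ hVpos.ne', one_mul]
  rw [hT]
  -- A strict inequality leaves room for the gradients of the approximants to lie eventually below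
  -- `k/C`; afterwards `k` decreases to `C√E`.
  have key : ∀ k : ℝ, C * √E < k →
      luxNorm (fun t => ENNReal.ofReal (bumpSq N t)) (avgMeasure B) w ≤ ENNReal.ofReal k := by
    intro k hk
    have hk0 : 0 < k := lt_of_le_of_lt (by positivity) hk
    suffices hle : ∫⁻ p, ENNReal.ofReal (bumpSq N (w p / k)) ∂(avgMeasure B) ≤ 1 from
      iInf_le_of_le k (iInf_le_of_le hk0 (iInf_le_of_le hle le_rfl))
    have hGk : eLpNorm G 2 (volume.restrict B) < ENNReal.ofReal (k / C) := by
      refine (eLpNorm_le_ofReal_sqrt hGm).trans_lt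
        ((ENNReal.ofReal_lt_ofReal_iff (by positivity)).2 ?_)
      rw [lt_div_iff₀ hC, mul_comm]
      exact hk
    have hev : ∀ᶠ n in atTop, eLpNorm (aGrad (gfun α) (φ n)) 2 (volume.restrict B) ≤
        ENNReal.ofReal (k / C) := by
      have hlim : Tendsto (fun n => eLpNorm G 2 (volume.restrict B) +
          eLpNorm (fun p => G p - aGrad (gfun α) (φ n) p) 2 (volume.restrict B)) atTop
          (𝓝 (eLpNorm G 2 (volume.restrict B) + 0)) := tendsto_const_nhds.add hφG
      rw [add_zero] at hlim
      filter_upwards [hlim.eventually (ge_mem_nhds hGk)] with n hn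
      refine le_trans ?_ hn
      have hma := (measurable_aGrad α (φ n)).aestronglyMeasurable (μ := volume.restrict B)
      have h1 : aGrad (gfun α) (φ n) = G - fun p => G p - aGrad (gfun α) (φ n) p := by
        ext p <;> simp
      calc eLpNorm (aGrad (gfun α) (φ n)) 2 (volume.restrict B)
          = eLpNorm (G - fun p => G p - aGrad (gfun α) (φ n) p) 2 (volume.restrict B) := by
            rw [← h1]
        _ ≤ _ := eLpNorm_sub_le hGm.1 (hGm.1.sub hma) one_le_two
    have hφm : ∀ n, AEStronglyMeasurable (φ n) (volume.restrict B) := fun n => by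
      obtain ⟨⟨L, hL⟩, -⟩ := hφ n
      exact hL.continuous.aestronglyMeasurable
    have hmeas : TendstoInMeasure (volume.restrict B) φ atTop w := by
      refine tendstoInMeasure_of_tendsto_eLpNorm two_ne_zero hφm hwm.1 ?_
      refine hφw.congr fun n => ?_
      rw [← eLpNorm_neg]
      congr 1
      ext p; simp
    obtain ⟨ns, hns, hae⟩ := hmeas.exists_seq_tendsto_ae
    have hae' : ∀ᵐ p ∂(avgMeasure B), Tendsto (fun i => φ (ns i) p) atTop (𝓝 (w p)) :=
      Measure.ae_smul_measure hae _
    have hcont : Continuous fun t : ℝ => ENNReal.ofReal (bumpSq N (t / k)) :=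
      ENNReal.continuous_ofReal.comp ((continuous_bump (by linarith)).comp
        ((continuous_id.div_const k).pow 2))
    calc ∫⁻ p, ENNReal.ofReal (bumpSq N (w p / k)) ∂(avgMeasure B)
        = ∫⁻ p, liminf (fun i => ENNReal.ofReal (bumpSq N (φ (ns i) p / k))) atTop
            ∂(avgMeasure B) := by
          apply lintegral_congr_ae
          filter_upwards [hae'] with p hp
          exact (((hcont.tendsto (w p)).comp hp).liminf_eq).symm
      _ ≤ liminf (fun i => ∫⁻ p, ENNReal.ofReal (bumpSq N (φ (ns i) p / k))
            ∂(avgMeasure B)) atTop := by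
          apply lintegral_liminf_le
          intro i
          obtain ⟨⟨L, hL⟩, -⟩ := hφ (ns i)
          exact (hcont.comp hL.continuous).measurable
      _ ≤ 1 := by
          refine liminf_le_of_frequently_le' (Eventually.frequently ?_)
          filter_upwards [hns.tendsto_atTop.eventually hev] with i hi
          exact H _ (hφ _).1 (hφ _).2.1 (hφ _).2.2 k hk0 hi
  have hlim : Tendsto ENNReal.ofReal (𝓝[>] (C * √E)) (𝓝 (ENNReal.ofReal (C * √E))) :=
    (ENNReal.continuous_ofReal.tendsto _).mono_left nhdsWithin_le_nhds
  refine ge_of_tendsto hlim ?_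
  filter_upwards [self_mem_nhdsWithin] with k hk
  exact key k hk

/-! ### Cutoffs, profiles and pointwise bounds for `χ(y/ψ(x)) ℓ(x)` -/

/-- A smooth cutoff function, equal to `1` on `[-1, 1]` and to `0` off `[-2, 2]`. -/
structure IsCutoff (χ : ℝ → ℝ) : Prop where
  contDiff : ContDiff ℝ ∞ χ
  eq_one : ∀ s ∈ Set.Icc (-1 : ℝ) 1, χ s = 1
  eq_zero : ∀ s ∉ Set.Icc (-2 : ℝ) 2, χ s = 0

namespace IsCutoff

variable {χ : ℝ → ℝ}

theorem eq_zero_of_lt (h : IsCutoff χ) {s : ℝ} (hs : 2 < |s|) : χ s = 0 :=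
  h.eq_zero s fun h' => (abs_le.2 h').not_gt hs

theorem deriv_eq_zero (h : IsCutoff χ) {s : ℝ} (hs : 2 < |s|) : deriv χ s = 0 :=
  deriv_eq_zero_of_eq_zero (fun _ hx => h.eq_zero_of_lt hx) hs

theorem deriv_deriv_eq_zero (h : IsCutoff χ) {s : ℝ} (hs : 2 < |s|) : deriv (deriv χ) s = 0 :=
  deriv_eq_zero_of_eq_zero (fun _ hx => h.deriv_eq_zero hx) hs

theorem contDiff_deriv (h : IsCutoff χ) : ContDiff ℝ ∞ (deriv χ) :=
  (contDiff_infty_iff_deriv.1 h.contDiff).2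

theorem contDiff_deriv_deriv (h : IsCutoff χ) : ContDiff ℝ ∞ (deriv (deriv χ)) :=
  (contDiff_infty_iff_deriv.1 h.contDiff_deriv).2

theorem hasDerivAt (h : IsCutoff χ) (s : ℝ) : HasDerivAt χ (deriv χ s) s :=
  (h.contDiff.differentiable (by simp) s).hasDerivAt

theorem hasDerivAt_deriv (h : IsCutoff χ) (s : ℝ) : HasDerivAt (deriv χ) (deriv (deriv χ) s) s :=
  (h.contDiff_deriv.differentiable (by simp) s).hasDerivAt

theorem exists_bound (h : IsCutoff χ) : ∃ D : ℝ, 0 ≤ D ∧ ∀ s, |χ s| ≤ D ∧ |deriv χ s| ≤ D ∧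
    |deriv (deriv χ) s| ≤ D := by
  have key : ∀ f : ℝ → ℝ, Continuous f → (∀ s, 2 < |s| → f s = 0) → ∃ D : ℝ, 0 ≤ D ∧
      ∀ s, |f s| ≤ D := fun f hf h0 => by
    obtain ⟨D, hD⟩ := (isCompact_Icc (a := (-2 : ℝ)) (b := 2)).bddAbove_image
      hf.abs.continuousOn
    refine ⟨max D 0, le_max_right _ _, fun s => ?_⟩
    rcases le_or_gt |s| 2 with h | h
    · exact (hD ⟨s, abs_le.1 h, rfl⟩).trans (le_max_left _ _)
    · rw [h0 s h, abs_zero]; exact le_max_right _ _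
  obtain ⟨D₀, h0, h0'⟩ := key χ h.contDiff.continuous fun s => h.eq_zero_of_lt
  obtain ⟨D₁, h1, h1'⟩ := key _ h.contDiff_deriv.continuous fun s => h.deriv_eq_zero
  obtain ⟨D₂, h2, h2'⟩ := key _ h.contDiff_deriv_deriv.continuous fun s => h.deriv_deriv_eq_zero
  exact ⟨D₀ + D₁ + D₂, by positivity, fun s => ⟨(h0' s).trans (by linarith),
    (h1' s).trans (by linarith), (h2' s).trans (by linarith)⟩⟩

end IsCutoff

theorem exists_isCutoff : ∃ χ : ℝ → ℝ, IsCutoff χ := by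
  let f : ContDiffBump (0 : ℝ) := ⟨1, 2, by norm_num, by norm_num⟩
  refine ⟨f, f.contDiff, fun s hs => ?_, fun s hs => ?_⟩
  · apply f.one_of_mem_closedBall
    simpa [Real.norm_eq_abs, abs_le] using hs
  · apply f.zero_of_le_dist
    rw [Real.dist_eq, sub_zero]
    by_contra h
    exact hs (abs_le.1 (not_le.1 h).le)

/-- Functions on the line with an at most logarithmic singularity at the origin. -/
structure IsProfile (l : ℝ → ℝ) : Prop where
  contDiffOn : ContDiffOn ℝ ∞ l {0}ᶜ
  measurable : Measurable l
  map_zero : l 0 = 0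
  bound : ∀ ε : ℝ, 0 < ε → ∃ C : ℝ, 0 ≤ C ∧ ∀ x : ℝ, x ≠ 0 → |x| < 1 →
    |l x| ≤ C * |x| ^ (-ε) ∧ |deriv l x| ≤ C * |x| ^ (-1 - ε) ∧
      |deriv (deriv l) x| ≤ C * |x| ^ (-2 - ε)

theorem IsProfile.contDiffAt {l : ℝ → ℝ} (h : IsProfile l) {x : ℝ} (hx : x ≠ 0) :
    ContDiffAt ℝ ∞ l x :=
  h.contDiffOn.contDiffAt (isOpen_compl_singleton.mem_nhds hx)

theorem IsProfile.hasDerivAt {l : ℝ → ℝ} (h : IsProfile l) {x : ℝ} (hx : x ≠ 0) :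
    HasDerivAt l (deriv l x) x :=
  ((h.contDiffAt hx).differentiableAt (by simp)).hasDerivAt

theorem IsProfile.hasDerivAt_deriv {l : ℝ → ℝ} (h : IsProfile l) {x : ℝ} (hx : x ≠ 0) :
    HasDerivAt (deriv l) (deriv (deriv l) x) x := by
  have h1 : ContDiffOn ℝ 1 (deriv l) {0}ᶜ :=
    h.contDiffOn.deriv_of_isOpen isOpen_compl_singleton (by norm_cast)
  exact ((h1.contDiffAt (isOpen_compl_singleton.mem_nhds hx)).differentiableAt
    (by simp)).hasDerivAt

/-- The function `χ(y / ψ(x)) ℓ(x)`. -/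
def ansatz (α : ℝ) (χ l : ℝ → ℝ) (p : ℝ × ℝ) : ℝ := χ (p.2 / psi α p.1) * l p.1

/-- `∂_x v`, as a derivative along the slice. -/
def slopeX (v : ℝ × ℝ → ℝ) (p : ℝ × ℝ) : ℝ := deriv (fun s => v (s, p.2)) p.1

/-- `∂_x² v`. -/
def slopeXX (v : ℝ × ℝ → ℝ) (p : ℝ × ℝ) : ℝ := deriv (deriv fun s => v (s, p.2)) p.1

/-- `∂_y v`. -/
def slopeY (v : ℝ × ℝ → ℝ) (p : ℝ × ℝ) : ℝ := deriv (fun t => v (p.1, t)) p.2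

/-- `∂_y² v`. -/
def slopeYY (v : ℝ × ℝ → ℝ) (p : ℝ × ℝ) : ℝ := deriv (deriv fun t => v (p.1, t)) p.2

/-- The derivative of `z = y/ψ` is again `z` times a function of `x`, so derivatives of the ansatz
are polynomial in `z`, `ψ'/ψ` and its derivative. The powers of `z` are harmless: the derivatives of
`χ` vanish for `|z| > 2`. -/
theorem hasDerivAt_div_psi (α : ℝ) {x : ℝ} (hx : x ≠ 0) (y : ℝ) :
    HasDerivAt (fun s => y / psi α s) (-(y / psi α x * logDerivPsi α x)) x := by
  have hψ := (psi_pos α hx).ne'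
  convert! (hasDerivAt_psi α hx).fun_inv hψ |>.const_mul y using 1
  field_simp

section Ansatz

variable {α : ℝ} {χ l : ℝ → ℝ}

theorem ansatz_eq_zero (hχ : IsCutoff χ) {x y : ℝ} (hx : x ≠ 0) (hy : 2 * psi α x < |y|) :
    ansatz α χ l (x, y) = 0 := by
  have hψ := psi_pos α hx
  have : 2 < |y / psi α x| := by rwa [abs_div, abs_of_pos hψ, lt_div_iff₀ hψ]
  simp [ansatz, hχ.eq_zero_of_lt this]

theorem hasDerivAt_ansatz_fst (hχ : IsCutoff χ) (hl : IsProfile l) {x : ℝ} (hx : x ≠ 0) (y : ℝ) :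
    HasDerivAt (fun s => ansatz α χ l (s, y))
      (χ (y / psi α x) * deriv l x -
        deriv χ (y / psi α x) * (y / psi α x * logDerivPsi α x) * l x) x := by
  have h := ((hχ.hasDerivAt _).comp x (hasDerivAt_div_psi α hx y)).mul (hl.hasDerivAt hx)
  convert! h using 1
  simp only [Function.comp]
  ring

theorem slopeX_ansatz (hχ : IsCutoff χ) (hl : IsProfile l) {p : ℝ × ℝ} (hx : p.1 ≠ 0) :
    slopeX (ansatz α χ l) p = χ (p.2 / psi α p.1) * deriv l p.1 -
        deriv χ (p.2 / psi α p.1) * (p.2 / psi α p.1 * logDerivPsi α p.1) * l p.1 :=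
  (hasDerivAt_ansatz_fst hχ hl hx p.2).deriv

theorem slopeXX_ansatz (hχ : IsCutoff χ) (hl : IsProfile l) {p : ℝ × ℝ} (hx : p.1 ≠ 0) :
    slopeXX (ansatz α χ l) p = χ (p.2 / psi α p.1) * deriv (deriv l) p.1 -
      2 * (deriv χ (p.2 / psi α p.1) * (p.2 / psi α p.1) * logDerivPsi α p.1) * deriv l p.1 +
      deriv (deriv χ) (p.2 / psi α p.1) * (p.2 / psi α p.1) ^ 2 * logDerivPsi α p.1 ^ 2 * l p.1 -
      deriv χ (p.2 / psi α p.1) * (p.2 / psi α p.1) *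
        (logDerivPsi' α p.1 - logDerivPsi α p.1 ^ 2) * l p.1 := by
  obtain ⟨x, y⟩ := p
  simp only at hx ⊢
  have hev : (deriv fun s => ansatz α χ l (s, y)) =ᶠ[𝓝 x] fun s => χ (y / psi α s) * deriv l s -
      deriv χ (y / psi α s) * (y / psi α s * logDerivPsi α s) * l s := by
    filter_upwards [isOpen_ne.mem_nhds hx] with s hs using (hasDerivAt_ansatz_fst hχ hl hs y).deriv
  have hz := hasDerivAt_div_psi α hx y
  have h := (((hχ.hasDerivAt _).comp x hz).mul (hl.hasDerivAt_deriv hx)).sub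
    ((((hχ.hasDerivAt_deriv _).comp x hz).mul
      (hz.mul (hasDerivAt_logDerivPsi α hx))).mul (hl.hasDerivAt hx))
  have h' : slopeXX (ansatz α χ l) (x, y) = _ := hev.deriv_eq.trans h.deriv
  rw [h']
  simp only [Function.comp, Pi.mul_apply]
  ring

theorem hasDerivAt_ansatz_snd (hχ : IsCutoff χ) (x y : ℝ) :
    HasDerivAt (fun t => ansatz α χ l (x, t)) (deriv χ (y / psi α x) / psi α x * l x) y := by
  have h := ((hχ.hasDerivAt _).comp y ((hasDerivAt_id y).div_const (psi α x))).mul_const (l x)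
  convert! h using 1
  simp only [id]
  ring

theorem slopeY_ansatz (hχ : IsCutoff χ) (p : ℝ × ℝ) :
    slopeY (ansatz α χ l) p = deriv χ (p.2 / psi α p.1) / psi α p.1 * l p.1 :=
  (hasDerivAt_ansatz_snd hχ p.1 p.2).deriv

theorem slopeYY_ansatz (hχ : IsCutoff χ) (p : ℝ × ℝ) :
    slopeYY (ansatz α χ l) p = deriv (deriv χ) (p.2 / psi α p.1) / psi α p.1 ^ 2 * l p.1 := by
  have h := (((hχ.hasDerivAt_deriv _).comp p.2
    ((hasDerivAt_id p.2).div_const (psi α p.1))).div_const (psi α p.1)).mul_const (l p.1)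
  have h1 : (deriv fun t => ansatz α χ l (p.1, t)) =
      fun t => deriv χ (t / psi α p.1) / psi α p.1 * l p.1 :=
    funext fun t => (hasDerivAt_ansatz_snd hχ p.1 t).deriv
  rw [slopeYY, h1]
  have h' : deriv (fun t => deriv χ (t / psi α p.1) / psi α p.1 * l p.1) p.2 = _ := h.deriv
  rw [h']
  simp only [id]
  ring

/-- The choice `g = ψ'` makes the exponentially large `1/ψ` produced by `∂_y` combine with `g` into
`ψ'/ψ`, of polynomial size. -/
theorem gfun_mul_slopeY_ansatz (hχ : IsCutoff χ) {p : ℝ × ℝ} (hx : p.1 ≠ 0) :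
    gfun α p.1 * slopeY (ansatz α χ l) p =
      logDerivPsi α p.1 * deriv χ (p.2 / psi α p.1) * l p.1 := by
  have := (psi_pos α hx).ne'
  rw [slopeY_ansatz hχ, gfun_eq α hx]; field_simp

theorem gfun_sq_mul_slopeYY_ansatz (hχ : IsCutoff χ) {p : ℝ × ℝ} (hx : p.1 ≠ 0) :
    gfun α p.1 ^ 2 * slopeYY (ansatz α χ l) p =
      logDerivPsi α p.1 ^ 2 * deriv (deriv χ) (p.2 / psi α p.1) * l p.1 := by
  have := (psi_pos α hx).ne'
  rw [slopeYY_ansatz hχ, gfun_eq α hx]; field_simp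

theorem contDiff_ansatz_snd (hχ : IsCutoff χ) (x : ℝ) :
    ContDiff ℝ ∞ fun t => ansatz α χ l (x, t) :=
  (hχ.contDiff.comp (contDiff_id.div_const (psi α x))).mul (contDiff_const (c := l x))

theorem contDiffAt_ansatz (hχ : IsCutoff χ) (hl : IsProfile l) {p : ℝ × ℝ} (hx : p.1 ≠ 0) :
    ContDiffAt ℝ ∞ (ansatz α χ l) p := by
  have h1 : ContDiffAt ℝ ∞ (fun q : ℝ × ℝ => q.2 / psi α q.1) p :=
    contDiffAt_snd.div ((contDiffAt_psi α hx (n := ⊤)).comp p contDiffAt_fst) (psi_pos α hx).ne'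
  exact (hχ.contDiff.contDiffAt.comp p h1).mul ((hl.contDiffAt hx).comp p contDiffAt_fst)

/-- For `y ≠ 0` the slice vanishes near `x = 0`, because `2ψ(s) ≤ 2|s| < |y|` there; the singularity
of `ℓ` is never met. -/
theorem contDiff_ansatz_fst (hα : 0 < α) (hχ : IsCutoff χ) (hl : IsProfile l) {y : ℝ}
    (hy : y ≠ 0) : ContDiff ℝ ∞ fun s => ansatz α χ l (s, y) := by
  rw [contDiff_iff_contDiffAt]
  intro x
  rcases eq_or_ne x 0 with rfl | hx
  · have h0 : (fun s => ansatz α χ l (s, y)) =ᶠ[𝓝 0] fun _ => 0 := by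
      have hpos : 0 < min 1 (|y| / 2) := lt_min one_pos (half_pos (abs_pos.2 hy))
      filter_upwards [Metric.ball_mem_nhds (0 : ℝ) hpos] with s hs
      rcases eq_or_ne s 0 with rfl | hs0
      · simp [ansatz, hl.map_zero]
      · rw [Metric.mem_ball, dist_zero_right, Real.norm_eq_abs, lt_min_iff] at hs
        apply ansatz_eq_zero hχ hs0
        have := psi_le_abs hα hs.1.le
        linarith
    exact contDiffAt_const.congr_of_eventuallyEq h0
  · exact (contDiffAt_ansatz hχ hl (p := (x, y)) hx).comp x
      (contDiffAt_id.prodMk contDiffAt_const)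

set_option maxHeartbeats 600000 in
-- Each application of `∂_x` or `g ∂_y` costs at most a factor of order `|x|^(-α-1)`, the size of
-- `ψ'/ψ`. The arbitrarily small `ε` pays for the logarithmic growth of `ℓ`.
theorem ansatz_bounds (hα : 0 < α) (hχ : IsCutoff χ) (hl : IsProfile l) {ε : ℝ} (hε : 0 < ε) :
    ∃ K : ℝ, 0 ≤ K ∧ ∀ p : ℝ × ℝ, p.1 ≠ 0 → |p.1| < 1 →
      |ansatz α χ l p| ≤ K * |p.1| ^ (-ε) ∧
      |slopeX (ansatz α χ l) p| ≤ K * |p.1| ^ (-(α + 1 + ε)) ∧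
      |gfun α p.1 * slopeY (ansatz α χ l) p| ≤ K * |p.1| ^ (-(α + 1 + ε)) ∧
      |slopeXX (ansatz α χ l) p| ≤ K * |p.1| ^ (-(2 * α + 2 + ε)) ∧
      |gfun α p.1 ^ 2 * slopeYY (ansatz α χ l) p| ≤ K * |p.1| ^ (-(2 * α + 2 + ε)) := by
  obtain ⟨C, hC, hb⟩ := hl.bound ε hε
  obtain ⟨D, hD, hDb⟩ := hχ.exists_bound
  set Q : ℝ := 2 * α + 1 with hQ
  have hQ1 : 1 ≤ Q := by linarith
  -- Here `13 = 1 + 4 + 6 + 2`, the sum of the coefficients in the bound for the second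
  -- `x`-derivative, the worst of the five.
  refine ⟨13 * (D * C * Q ^ 2), by positivity, fun p hx hx1 => ?_⟩
  obtain ⟨x, y⟩ := p
  simp only at hx hx1
  have hp : 0 < |x| := abs_pos.2 hx
  set a : ℝ := |x| ^ (-α) with ha
  set e : ℝ := |x| ^ (-ε) with he
  set r : ℝ := |x|⁻¹ with hr
  have ha1 : 1 ≤ a := Real.one_le_rpow_of_pos_of_le_one_of_nonpos hp hx1.le (by linarith)
  have he0 : 0 < e := by positivity
  have hr0 : 0 < r := by positivity
  have er : |x| ^ (-1 - ε) = e * r := by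
    rw [sub_eq_add_neg, Real.rpow_add hp, Real.rpow_neg_one, mul_comm]
  have er2 : |x| ^ (-2 - ε) = e * r ^ 2 := by
    rw [show -2 - ε = -1 + (-1 - ε) by ring, Real.rpow_add hp, Real.rpow_neg_one, er]; ring
  have are : |x| ^ (-(α + 1 + ε)) = a * r * e := by
    rw [show -(α + 1 + ε) = -α + (-1 - ε) by ring, Real.rpow_add hp, er]; ring
  have are2 : |x| ^ (-(2 * α + 2 + ε)) = a ^ 2 * r ^ 2 * e := by
    rw [show -(2 * α + 2 + ε) = -α + (-α + (-2 - ε)) by ring, Real.rpow_add hp, Real.rpow_add hp,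
      er2]; ring
  obtain ⟨b0, b1, b2⟩ := hb x hx hx1
  rw [er] at b1
  rw [er2] at b2
  have hq : |logDerivPsi α x| ≤ Q * (a * r) := by
    have h := abs_logDerivPsi_le hα hx hx1
    rwa [sub_eq_add_neg, Real.rpow_add hp, Real.rpow_neg_one] at h
  have hq' : |logDerivPsi' α x| ≤ Q ^ 2 * (a * r ^ 2) := by
    have h := abs_logDerivPsi'_le hα hx hx1
    rw [show -α - 2 = -α + (-1 + -1) by ring, Real.rpow_add hp, Real.rpow_add hp,
      Real.rpow_neg_one, ← sq] at h
    refine h.trans ?_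
    gcongr
    linarith
  rw [are, are2, slopeX_ansatz hχ hl hx, slopeXX_ansatz hχ hl hx, gfun_mul_slopeY_ansatz hχ hx,
    gfun_sq_mul_slopeYY_ansatz hχ hx]
  simp only [ansatz]
  set q := logDerivPsi α x
  set q' := logDerivPsi' α x
  set z := y / psi α x with hz
  obtain ⟨d0, d1, d2⟩ := hDb z
  have hz1 : |deriv χ z * z| ≤ 2 * D := by
    rcases le_or_gt |z| 2 with h | h
    · rw [abs_mul, mul_comm]; gcongr
    · rw [hχ.deriv_eq_zero h]; simp; exact hD
  have hz2 : |deriv (deriv χ) z * z ^ 2| ≤ 4 * D := by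
    rcases le_or_gt |z| 2 with h | h
    · rw [abs_mul, mul_comm, abs_pow]
      have : |z| ^ 2 ≤ 4 := by nlinarith [abs_nonneg z]
      gcongr
    · rw [hχ.deriv_deriv_eq_zero h]; simp; exact hD
  set P : ℝ := D * C * e with hP
  have hP0 : 0 ≤ P := by positivity
  have hqq : |q ^ 2| ≤ (Q * (a * r)) ^ 2 := by rw [abs_pow]; gcongr
  have hQ2 : Q ≤ Q ^ 2 := by nlinarith
  have hQ12 : 1 ≤ Q ^ 2 := hQ1.trans hQ2
  have haa : a ≤ a ^ 2 := by nlinarith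
  have ha12 : 1 ≤ a ^ 2 := ha1.trans haa
  have hQa : 1 ≤ Q * a := one_le_mul_of_one_le_of_one_le hQ1 ha1
  have hQa2 : Q * a ≤ Q ^ 2 * a ^ 2 := by gcongr
  have hQ2a : Q ^ 2 * a ≤ Q ^ 2 * a ^ 2 := by gcongr
  have hQ2a1 : Q * a ≤ Q ^ 2 * a := by gcongr
  refine ⟨?_, ?_, ?_, ?_, ?_⟩
  · calc |χ z * l x| ≤ D * (C * e) := by rw [abs_mul]; gcongr
      _ = P * 1 := by ring
      _ ≤ P * (13 * Q ^ 2) :=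
          mul_le_mul_of_nonneg_left (by linarith) (by positivity)
      _ = _ := by ring
  · have e1 : |χ z * deriv l x| ≤ D * (C * (e * r)) := by rw [abs_mul]; gcongr
    have e2 : |deriv χ z * (z * q) * l x| ≤ 2 * D * (Q * (a * r)) * (C * e) := by
      rw [← mul_assoc, abs_mul, abs_mul]; gcongr
    calc |χ z * deriv l x - deriv χ z * (z * q) * l x|
        ≤ D * (C * (e * r)) + 2 * D * (Q * (a * r)) * (C * e) := (abs_sub _ _).trans (add_le_add e1 e2)
      _ = P * r * (1 + 2 * (Q * a)) := by ring
      _ ≤ P * r * (13 * (Q ^ 2 * a)) :=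
          mul_le_mul_of_nonneg_left (by linarith) (by positivity)
      _ = _ := by ring
  · calc |q * deriv χ z * l x| ≤ Q * (a * r) * D * (C * e) := by
          rw [abs_mul, abs_mul]; gcongr
      _ = P * r * (Q * a) := by ring
      _ ≤ P * r * (13 * (Q ^ 2 * a)) :=
          mul_le_mul_of_nonneg_left (by linarith) (by positivity)
      _ = _ := by ring
  · have e1 : |χ z * deriv (deriv l) x| ≤ D * (C * (e * r ^ 2)) := by rw [abs_mul]; gcongr
    have e2 : |2 * (deriv χ z * z * q) * deriv l x| ≤
        2 * (2 * D * (Q * (a * r))) * (C * (e * r)) := by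
      rw [abs_mul, abs_mul, abs_mul (deriv χ z * z), abs_two]; gcongr
    have e3 : |deriv (deriv χ) z * z ^ 2 * q ^ 2 * l x| ≤
        4 * D * (Q * (a * r)) ^ 2 * (C * e) := by
      rw [abs_mul, abs_mul (deriv (deriv χ) z * z ^ 2)]; gcongr
    have e4 : |deriv χ z * z * (q' - q ^ 2) * l x| ≤
        2 * D * (Q ^ 2 * (a * r ^ 2) + (Q * (a * r)) ^ 2) * (C * e) := by
      rw [abs_mul, abs_mul (deriv χ z * z)]
      have := (abs_sub q' (q ^ 2)).trans (add_le_add hq' hqq)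
      gcongr
    calc _ ≤ D * (C * (e * r ^ 2)) + 2 * (2 * D * (Q * (a * r))) * (C * (e * r)) +
          4 * D * (Q * (a * r)) ^ 2 * (C * e) +
          2 * D * (Q ^ 2 * (a * r ^ 2) + (Q * (a * r)) ^ 2) * (C * e) :=
          (abs_sub _ _).trans (add_le_add ((abs_add_le _ _).trans
            (add_le_add ((abs_sub _ _).trans (add_le_add e1 e2)) e3)) e4)
      _ = P * r ^ 2 * (1 + 4 * (Q * a) + 6 * (Q ^ 2 * a ^ 2) + 2 * (Q ^ 2 * a)) := by ring
      _ ≤ P * r ^ 2 * (13 * (Q ^ 2 * a ^ 2)) :=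
          mul_le_mul_of_nonneg_left (by linarith) (by positivity)
      _ = _ := by ring
  · calc |q ^ 2 * deriv (deriv χ) z * l x| ≤ (Q * (a * r)) ^ 2 * D * (C * e) := by
          rw [abs_mul, abs_mul]; gcongr
      _ = P * r ^ 2 * (Q ^ 2 * a ^ 2) := by ring
      _ ≤ P * r ^ 2 * (13 * (Q ^ 2 * a ^ 2)) :=
          mul_le_mul_of_nonneg_left (by nlinarith [sq_nonneg (Q * a)]) (by positivity)
      _ = _ := by ring

end Ansatz

/-! ### Integrability in the thin region `|y| ≤ 2ψ(x)` -/

theorem measurableSet_strip : MeasurableSet {p : ℝ × ℝ | |p.1| < 1} :=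
  (isOpen_lt (continuous_abs.comp continuous_fst) continuous_const).measurableSet

theorem ae_fst_ne_zero : ∀ᵐ p : ℝ × ℝ, p.1 ≠ 0 :=
  ae_fst ae_ne_zero

/-- Functions supported in the thin region `|y| ≤ 2 ψ(x)` with controlled growth at `x = 0` have
finite integral. -/
theorem lintegral_strip_lt_top {α : ℝ} {h : ℝ × ℝ → ℝ≥0∞} {κ : ℝ → ℝ} {K : ℝ}
    (hκm : Measurable κ) (hκ0 : ∀ x, 0 ≤ κ x)
    (hκ : ∀ x, x ≠ 0 → |x| < 1 → κ x * psi α x ≤ K)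
    (hle : ∀ p : ℝ × ℝ, p.1 ≠ 0 → |p.1| < 1 → h p ≤ ENNReal.ofReal (κ p.1))
    (h0 : ∀ p : ℝ × ℝ, p.1 ≠ 0 → 2 * psi α p.1 < |p.2| → h p = 0) :
    ∫⁻ p in {p : ℝ × ℝ | |p.1| < 1}, h p < ⊤ := by
  set T : Set (ℝ × ℝ) := {p | |p.2| ≤ 2 * psi α p.1} with hT
  have hTm : MeasurableSet T :=
    measurableSet_le (continuous_abs.measurable.comp measurable_snd)
      (((measurable_psi α).comp measurable_fst).const_mul 2)
  set S : Set (ℝ × ℝ) := {p | |p.1| < 1} with hS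
  have hSm : MeasurableSet S := measurableSet_strip
  set H : ℝ × ℝ → ℝ≥0∞ := (S ∩ T).indicator fun p => ENNReal.ofReal (κ p.1) with hH
  have hHm : Measurable H := (hκm.comp measurable_fst).ennreal_ofReal.indicator (hSm.inter hTm)
  calc ∫⁻ p in S, h p ≤ ∫⁻ p in S, H p := by
        apply lintegral_mono_ae
        filter_upwards [ae_restrict_mem hSm, ae_restrict_of_ae ae_fst_ne_zero] with p hp hp0
        rcases le_or_gt |p.2| (2 * psi α p.1) with h' | h'
        · rw [hH, Set.indicator_of_mem (show p ∈ S ∩ T from ⟨hp, h'⟩)]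
          exact hle p hp0 hp
        · rw [h0 p hp0 h']; exact zero_le
    _ ≤ ∫⁻ p, H p := setLIntegral_le_lintegral _ _
    _ = ∫⁻ x, ∫⁻ y, H (x, y) := by
        rw [Measure.volume_eq_prod, lintegral_prod _ hHm.aemeasurable]
    _ ≤ ∫⁻ x, (Set.Ioo (-1 : ℝ) 1).indicator (fun _ => ENNReal.ofReal (4 * K)) x := by
        apply lintegral_mono_ae
        filter_upwards [ae_ne_zero] with x hx
        by_cases hx1 : |x| < 1
        · rw [Set.indicator_of_mem (show x ∈ Set.Ioo (-1 : ℝ) 1 from abs_lt.1 hx1)]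
          -- The section over `x` is an interval of length `4ψ(x)`, so it contributes at most `4
          -- κ(x) ψ(x) ≤ 4K`.
          calc ∫⁻ y, H (x, y) ≤ ∫⁻ y, (Set.Icc (-(2 * psi α x)) (2 * psi α x)).indicator
                (fun _ => ENNReal.ofReal (κ x)) y := by
                apply lintegral_mono
                intro y
                change H (x, y) ≤ _
                by_cases hy : (x, y) ∈ S ∩ T
                · have : y ∈ Set.Icc (-(2 * psi α x)) (2 * psi α x) := abs_le.1 hy.2
                  rw [hH, Set.indicator_of_mem hy, Set.indicator_of_mem this]
                · rw [hH, Set.indicator_of_notMem hy]; exact zero_le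
            _ = ENNReal.ofReal (κ x) * ENNReal.ofReal (4 * psi α x) := by
                rw [lintegral_indicator measurableSet_Icc, setLIntegral_const, Real.volume_Icc]
                congr 2; ring
            _ ≤ ENNReal.ofReal (4 * K) := by
                rw [← ENNReal.ofReal_mul (hκ0 x)]
                apply ENNReal.ofReal_le_ofReal
                have := hκ x hx hx1
                linarith
        · have : ∀ y, H (x, y) = 0 := fun y => by
            rw [hH, Set.indicator_of_notMem]
            exact fun h' => hx1 h'.1
          simp only [this, lintegral_zero]
          exact zero_le
    _ < ⊤ := by
        rw [lintegral_indicator measurableSet_Ioo, setLIntegral_const, Real.volume_Ioo]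
        exact ENNReal.mul_lt_top ENNReal.ofReal_lt_top ENNReal.ofReal_lt_top

/-- Functions supported in the thin region `|y| ≤ 2 ψ(x)` of at most polynomial growth at
`x = 0`. -/
structure IsThin (α : ℝ) (f : ℝ × ℝ → ℝ) : Prop where
  aestronglyMeasurable : AEStronglyMeasurable f volume
  bound : ∃ m K : ℝ, ∀ p : ℝ × ℝ, p.1 ≠ 0 → |p.1| < 1 → |f p| ≤ K * |p.1| ^ (-m)
  eq_zero : ∀ p : ℝ × ℝ, p.1 ≠ 0 → 2 * psi α p.1 < |p.2| → f p = 0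

/-- Squaring doubles the exponent of the polynomial bound, and `ψ` beats any power of `1/|x|`. -/
theorem IsThin.memLp_strip {α : ℝ} (hα : 0 < α) {f : ℝ × ℝ → ℝ} (hf : IsThin α f) :
    MemLp f 2 (volume.restrict {p : ℝ × ℝ | |p.1| < 1}) := by
  obtain ⟨m, K, hb⟩ := hf.bound
  obtain ⟨K', hK', hpsi⟩ := exists_rpow_mul_exp_mul_psi_le hα (β := 0) hα (2 * m) 0
  refine ⟨hf.aestronglyMeasurable.restrict, ?_⟩
  rw [eLpNorm_lt_top_iff_lintegral_rpow_enorm_lt_top two_ne_zero ENNReal.ofNat_ne_top]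
  refine lintegral_strip_lt_top (α := α) (κ := fun x => K ^ 2 * |x| ^ (-(2 * m)))
    (K := K ^ 2 * K') (by fun_prop)
    (fun x => by positivity) (fun x hx hx1 => ?_) (fun p hp hp1 => ?_) (fun p hp hy => ?_)
  · have := hpsi x hx hx1
    simp only [zero_mul, Real.exp_zero, mul_one] at this
    rw [mul_assoc]
    gcongr
  · rw [Real.enorm_eq_ofReal_abs, ENNReal.ofReal_rpow_of_nonneg (abs_nonneg _) (by simp)]
    apply ENNReal.ofReal_le_ofReal
    have h1 := hb p hp hp1
    have h2 : |p.1| ^ (-(2 * m)) = (|p.1| ^ (-m)) ^ 2 := by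
      rw [← Real.rpow_natCast, ← Real.rpow_mul (abs_nonneg _)]; congr 1; push_cast; ring
    rw [h2, ← mul_pow, ENNReal.toReal_ofNat, Real.rpow_two]
    gcongr
  · rw [hf.eq_zero p hp hy]; simp

theorem IsThin.memLp {α : ℝ} (hα : 0 < α) {f : ℝ × ℝ → ℝ} (hf : IsThin α f) {B : Set (ℝ × ℝ)}
    (hB : ∀ p ∈ B, |p.1| < 1) : MemLp f 2 (volume.restrict B) :=
  (hf.memLp_strip hα).mono_measure (Measure.restrict_mono (fun p hp => hB p hp) le_rfl)

theorem IsThin.add {α : ℝ} {f h : ℝ × ℝ → ℝ} (hf : IsThin α f) (hh : IsThin α h) :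
    IsThin α fun p => f p + h p := by
  obtain ⟨m, K, hb⟩ := hf.bound
  obtain ⟨m', K', hb'⟩ := hh.bound
  refine ⟨hf.aestronglyMeasurable.add hh.aestronglyMeasurable,
    ⟨max m m', |K| + |K'|, fun p hp hp1 => ?_⟩, fun p hp hy => ?_⟩
  · have h0 := abs_pos.2 hp
    have h1 : |p.1| ^ (-m) ≤ |p.1| ^ (-max m m') :=
      Real.rpow_le_rpow_of_exponent_ge h0 hp1.le (neg_le_neg (le_max_left _ _))
    have h2 : |p.1| ^ (-m') ≤ |p.1| ^ (-max m m') :=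
      Real.rpow_le_rpow_of_exponent_ge h0 hp1.le (neg_le_neg (le_max_right _ _))
    calc |f p + h p| ≤ |f p| + |h p| := abs_add_le _ _
      _ ≤ K * |p.1| ^ (-m) + K' * |p.1| ^ (-m') := add_le_add (hb p hp hp1) (hb' p hp hp1)
      _ ≤ |K| * |p.1| ^ (-max m m') + |K'| * |p.1| ^ (-max m m') := by
          gcongr
          · exact le_abs_self _
          · exact le_abs_self _
      _ = _ := by ring
  · rw [hf.eq_zero p hp hy, hh.eq_zero p hp hy, add_zero]

section Ansatz

variable {α : ℝ} {χ l : ℝ → ℝ}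

theorem two_lt_abs_div_psi {p : ℝ × ℝ} (hx : p.1 ≠ 0) (hy : 2 * psi α p.1 < |p.2|) :
    2 < |p.2 / psi α p.1| := by
  have hψ := psi_pos α hx
  rwa [abs_div, abs_of_pos hψ, lt_div_iff₀ hψ]

theorem measurable_snd_div_psi (α : ℝ) : Measurable fun p : ℝ × ℝ => p.2 / psi α p.1 :=
  measurable_snd.div ((measurable_psi α).comp measurable_fst)

theorem measurable_ansatz (hχ : IsCutoff χ) (hl : IsProfile l) : Measurable (ansatz α χ l) :=
  (hχ.contDiff.continuous.measurable.comp (measurable_snd_div_psi α)).mul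
    (hl.measurable.comp measurable_fst)

theorem isThin_ansatz (hα : 0 < α) (hχ : IsCutoff χ) (hl : IsProfile l) :
    IsThin α (ansatz α χ l) := by
  obtain ⟨K, -, hK⟩ := ansatz_bounds hα hχ hl one_pos
  exact ⟨(measurable_ansatz hχ hl).aestronglyMeasurable, ⟨_, K, fun p hp hp1 => (hK p hp hp1).1⟩,
    fun p hp hy => ansatz_eq_zero hχ hp hy⟩

theorem isThin_slopeX (hα : 0 < α) (hχ : IsCutoff χ) (hl : IsProfile l) :
    IsThin α (slopeX (ansatz α χ l)) := by
  obtain ⟨K, -, hK⟩ := ansatz_bounds hα hχ hl one_pos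
  have hz := measurable_snd_div_psi α
  have hq := (measurable_logDerivPsi α).comp (measurable_fst : Measurable (Prod.fst : ℝ × ℝ → ℝ))
  have hl0 := hl.measurable.comp (measurable_fst : Measurable (Prod.fst : ℝ × ℝ → ℝ))
  have hl1 := (measurable_deriv l).comp (measurable_fst : Measurable (Prod.fst : ℝ × ℝ → ℝ))
  refine ⟨?_, ⟨_, K, fun p hp hp1 => (hK p hp hp1).2.1⟩, fun p hp hy => ?_⟩
  · refine ((((hχ.contDiff.continuous.measurable.comp hz).mul hl1).sub
      (((hχ.contDiff_deriv.continuous.measurable.comp hz).mul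
        (hz.mul hq)).mul hl0)).aestronglyMeasurable).congr ?_
    filter_upwards [ae_fst_ne_zero] with p hp
    exact (slopeX_ansatz hχ hl hp).symm
  · rw [slopeX_ansatz hχ hl hp, hχ.eq_zero_of_lt (two_lt_abs_div_psi hp hy),
      hχ.deriv_eq_zero (two_lt_abs_div_psi hp hy)]
    ring

theorem isThin_slopeY (hα : 0 < α) (hχ : IsCutoff χ) (hl : IsProfile l) :
    IsThin α fun p => gfun α p.1 * slopeY (ansatz α χ l) p := by
  obtain ⟨K, -, hK⟩ := ansatz_bounds hα hχ hl one_pos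
  have hz := measurable_snd_div_psi α
  have hq := (measurable_logDerivPsi α).comp (measurable_fst : Measurable (Prod.fst : ℝ × ℝ → ℝ))
  have hl0 := hl.measurable.comp (measurable_fst : Measurable (Prod.fst : ℝ × ℝ → ℝ))
  refine ⟨?_, ⟨_, K, fun p hp hp1 => (hK p hp hp1).2.2.1⟩, fun p hp hy => ?_⟩
  · refine (((hq.mul (hχ.contDiff_deriv.continuous.measurable.comp hz)).mul
      hl0).aestronglyMeasurable).congr ?_
    filter_upwards [ae_fst_ne_zero] with p hp
    exact (gfun_mul_slopeY_ansatz hχ hp).symm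
  · rw [gfun_mul_slopeY_ansatz hχ hp, hχ.deriv_eq_zero (two_lt_abs_div_psi hp hy)]
    ring

theorem measurable_logDerivPsi' (α : ℝ) : Measurable (logDerivPsi' α) := by
  unfold logDerivPsi'; fun_prop

theorem isThin_slopeXX (hα : 0 < α) (hχ : IsCutoff χ) (hl : IsProfile l) :
    IsThin α (slopeXX (ansatz α χ l)) := by
  obtain ⟨K, -, hK⟩ := ansatz_bounds hα hχ hl one_pos
  have hz := measurable_snd_div_psi α
  have hq := (measurable_logDerivPsi α).comp (measurable_fst : Measurable (Prod.fst : ℝ × ℝ → ℝ))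
  have hq' := (measurable_logDerivPsi' α).comp (measurable_fst : Measurable (Prod.fst : ℝ × ℝ → ℝ))
  have hl0 := hl.measurable.comp (measurable_fst : Measurable (Prod.fst : ℝ × ℝ → ℝ))
  have hl1 := (measurable_deriv l).comp (measurable_fst : Measurable (Prod.fst : ℝ × ℝ → ℝ))
  have hl2 := (measurable_deriv (deriv l)).comp (measurable_fst : Measurable (Prod.fst : ℝ × ℝ → ℝ))
  have hc0 := hχ.contDiff.continuous.measurable.comp hz
  have hc1 := hχ.contDiff_deriv.continuous.measurable.comp hz
  have hc2 := hχ.contDiff_deriv_deriv.continuous.measurable.comp hz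
  refine ⟨?_, ⟨_, K, fun p hp hp1 => (hK p hp hp1).2.2.2.1⟩, fun p hp hy => ?_⟩
  · refine (((((hc0.mul hl2).sub ((((hc1.mul hz).mul hq).const_mul 2).mul hl1)).add
      (((hc2.mul (hz.pow_const 2)).mul (hq.pow_const 2)).mul hl0)).sub
      (((hc1.mul hz).mul (hq'.sub (hq.pow_const 2))).mul hl0)).aestronglyMeasurable).congr ?_
    filter_upwards [ae_fst_ne_zero] with p hp
    exact (slopeXX_ansatz hχ hl hp).symm
  · have h2 := two_lt_abs_div_psi hp hy
    rw [slopeXX_ansatz hχ hl hp, hχ.eq_zero_of_lt h2, hχ.deriv_eq_zero h2,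
      hχ.deriv_deriv_eq_zero h2]
    ring

theorem isThin_slopeYY (hα : 0 < α) (hχ : IsCutoff χ) (hl : IsProfile l) :
    IsThin α fun p => gfun α p.1 ^ 2 * slopeYY (ansatz α χ l) p := by
  obtain ⟨K, -, hK⟩ := ansatz_bounds hα hχ hl one_pos
  have hz := measurable_snd_div_psi α
  have hq := (measurable_logDerivPsi α).comp (measurable_fst : Measurable (Prod.fst : ℝ × ℝ → ℝ))
  have hl0 := hl.measurable.comp (measurable_fst : Measurable (Prod.fst : ℝ × ℝ → ℝ))
  refine ⟨?_, ⟨_, K, fun p hp hp1 => (hK p hp hp1).2.2.2.2⟩, fun p hp hy => ?_⟩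
  · refine ((((hq.pow_const 2).mul (hχ.contDiff_deriv_deriv.continuous.measurable.comp hz)).mul
      hl0).aestronglyMeasurable).congr ?_
    filter_upwards [ae_fst_ne_zero] with p hp
    exact (gfun_sq_mul_slopeYY_ansatz hχ hp).symm
  · rw [gfun_sq_mul_slopeYY_ansatz hχ hp, hχ.deriv_deriv_eq_zero (two_lt_abs_div_psi hp hy)]
    ring

theorem opL_eq (g : ℝ → ℝ) (v : ℝ × ℝ → ℝ) :
    opL g v = fun p => slopeXX v p + g p.1 ^ 2 * slopeYY v p := rfl

theorem isThin_opL (hα : 0 < α) (hχ : IsCutoff χ) (hl : IsProfile l) :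
    IsThin α (opL (gfun α) (ansatz α χ l)) := by
  rw [opL_eq]
  exact (isThin_slopeXX hα hχ hl).add (isThin_slopeYY hα hχ hl)

end Ansatz

/-! ### Integration by parts and the weak equation -/

/-- A square integrable function times a bounded function vanishing off `B` is integrable. -/
theorem integrable_mul_of_memLp {B : Set (ℝ × ℝ)} (hV : volume B ≠ ⊤) {f m : ℝ × ℝ → ℝ} {c : ℝ}
    (hf : MemLp f 2 (volume.restrict B)) (hm : Measurable m) (hb : ∀ p ∈ B, |m p| ≤ c)
    (h0 : ∀ p ∉ B, m p = 0) : Integrable fun p => f p * m p := by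
  have hfin : IsFiniteMeasure (volume.restrict B) := ⟨by
    rw [Measure.restrict_apply_univ]; exact lt_top_iff_ne_top.2 hV⟩
  have hsub : Function.support (fun p => f p * m p) ⊆ B := fun p hp => by
    by_contra h
    exact hp (by simp [h0 p h])
  rw [← integrableOn_iff_integrable_of_support_subset hsub]
  have hc : ∀ p, |m p| ≤ |c| := fun p => by
    by_cases hp : p ∈ B
    · exact (hb p hp).trans (le_abs_self _)
    · rw [h0 p hp]; simp
  have hi : IntegrableOn f B := hf.integrable one_le_two
  exact hi.mul_bdd (c := |c|) hm.aestronglyMeasurable (Eventually.of_forall hc)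

theorem setIntegral_eq_integral {B : Set (ℝ × ℝ)} {f : ℝ × ℝ → ℝ} (h : ∀ p ∉ B, f p = 0) :
    ∫ p in B, f p = ∫ p, f p :=
  setIntegral_eq_integral_of_forall_compl_eq_zero h

/-- By Hölder, `L²` convergence of one factor gives convergence of the pairing. The `φ n` are not
assumed square integrable; eventually they are, as `h` minus a function of finite norm. -/
theorem tendsto_integral_mul {X : Type*} [MeasurableSpace X] {μ : Measure X} {φ : ℕ → X → ℝ}
    {h k : X → ℝ} (hφ : ∀ n, AEStronglyMeasurable (φ n) μ) (hh : MemLp h 2 μ) (hk : MemLp k 2 μ)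
    (hlim : Tendsto (fun n => eLpNorm (fun p => h p - φ n p) 2 μ) atTop (𝓝 0)) :
    Tendsto (fun n => ∫ p, φ n p * k p ∂μ) atTop (𝓝 (∫ p, h p * k p ∂μ)) := by
  have hd : ∀ n, AEStronglyMeasurable (fun p => h p - φ n p) μ := fun n => hh.1.sub (hφ n)
  have hev : ∀ᶠ n in atTop, eLpNorm (fun p => h p - φ n p) 2 μ < ⊤ :=
    hlim.eventually (gt_mem_nhds ENNReal.zero_lt_top)
  have hint : ∀ᶠ n in atTop, Integrable (fun p => φ n p * k p) μ := by
    filter_upwards [hev] with n hn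
    have h1 : MemLp (φ n) 2 μ := by
      have := hh.sub (⟨hd n, hn⟩ : MemLp (fun p => h p - φ n p) 2 μ)
      refine this.congr_norm (hφ n) (Eventually.of_forall fun p => ?_)
      simp
    exact h1.integrable_mul hk
  refine tendsto_integral_of_L1' _ (hh.integrable_mul hk).aestronglyMeasurable hint ?_
  have hlim2 : Tendsto (fun n => eLpNorm (fun p => h p - φ n p) 2 μ * eLpNorm k 2 μ) atTop
      (𝓝 (0 * eLpNorm k 2 μ)) := ENNReal.Tendsto.mul_const hlim (Or.inr hk.2.ne)
  rw [zero_mul] at hlim2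
  refine tendsto_of_tendsto_of_tendsto_of_le_of_le tendsto_const_nhds hlim2 (fun n => zero_le)
    fun n => ?_
  have h2 : eLpNorm ((fun p => φ n p * k p) - fun p => h p * k p) 1 μ =
      eLpNorm ((fun p => h p - φ n p) • k) 1 μ := by
    rw [← eLpNorm_neg]
    congr 1
    ext p
    simp [sub_mul]
  change eLpNorm ((fun p => φ n p * k p) - fun p => h p * k p) 1 μ ≤ _
  rw [h2]
  exact eLpNorm_smul_le_mul_eLpNorm hk.1 (hd n)

section Ansatz

variable {α : ℝ} {χ l : ℝ → ℝ} {B : Set (ℝ × ℝ)}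

/-- The weak `A`-gradient of `χ(y / ψ(x)) ℓ(x)`. -/
def ansatzGrad (α : ℝ) (χ l : ℝ → ℝ) (p : ℝ × ℝ) : ℝ × ℝ :=
  (slopeX (ansatz α χ l) p, gfun α p.1 * slopeY (ansatz α χ l) p)

theorem memLp_ansatzGrad (hα : 0 < α) (hχ : IsCutoff χ) (hl : IsProfile l)
    (hB : ∀ p ∈ B, |p.1| < 1) : MemLp (ansatzGrad α χ l) 2 (volume.restrict B) := by
  have h1 := (isThin_slopeX hα hχ hl).memLp hα hB
  have h2 := (isThin_slopeY hα hχ hl).memLp hα hB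
  refine (h1.norm.add h2.norm).mono (h1.1.prodMk h2.1) (Eventually.of_forall fun p => ?_)
  change ‖ansatzGrad α χ l p‖ ≤ |‖(ansatzGrad α χ l p).1‖ + ‖(ansatzGrad α χ l p).2‖|
  refine le_trans ?_ (le_abs_self _)
  exact max_le (le_add_of_nonneg_right (norm_nonneg _)) (le_add_of_nonneg_left (norm_nonneg _))

theorem contDiff_one_of_infty {f : ℝ → ℝ} (hf : ContDiff ℝ ∞ f) : ContDiff ℝ 1 f :=
  hf.of_le (by norm_cast)

theorem contDiff_one_deriv_of_infty {f : ℝ → ℝ} (hf : ContDiff ℝ ∞ f) : ContDiff ℝ 1 (deriv f) :=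
  contDiff_one_of_infty (contDiff_infty_iff_deriv.1 hf).2

theorem measurable_gfun_mul_fderiv (α : ℝ) (φ : ℝ × ℝ → ℝ) :
    Measurable fun p : ℝ × ℝ => gfun α p.1 * fderiv ℝ φ p (0, 1) :=
  ((measurable_gfun α).comp measurable_fst).mul (measurable_fderiv_apply_const ℝ φ _)

/-- Integration by parts for `χ(y / ψ(x)) ℓ(x)` against Lipschitz functions. -/
theorem ansatz_integral_by_parts (hα : 0 < α) (hχ : IsCutoff χ) (hl : IsProfile l)
    (hB : ∀ p ∈ B, |p.1| < 1) (hV : volume B ≠ ⊤) {φ : ℝ × ℝ → ℝ} {L : NNReal}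
    (hφ : LipschitzWith L φ) (hcs : HasCompactSupport φ) (hts : tsupport φ ⊆ B) :
    (∫ p in B, ansatz α χ l p * (aGrad (gfun α) φ p).1 =
      -∫ p in B, (ansatzGrad α χ l p).1 * φ p) ∧
    (∫ p in B, ansatz α χ l p * (aGrad (gfun α) φ p).2 =
      -∫ p in B, (ansatzGrad α χ l p).2 * φ p) ∧
    (∫ p in B, (aGrad (gfun α) φ p).1 * (ansatzGrad α χ l p).1) +
      (∫ p in B, (aGrad (gfun α) φ p).2 * (ansatzGrad α χ l p).2) =
      -∫ p in B, φ p * opL (gfun α) (ansatz α χ l) p := by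
  obtain ⟨R, hR⟩ := exists_eq_zero_of_hasCompactSupport hcs
  have hv1 : ‖((1, 0) : ℝ × ℝ)‖ ≤ 1 := by simp
  have hv2 : ‖((0, 1) : ℝ × ℝ)‖ ≤ 1 := by simp
  have hφ0 : ∀ p ∉ B, φ p = 0 := fun p hp => eq_zero_of_notMem_of_tsupport_subset hts hp
  have hd0 : ∀ p ∉ B, fderiv ℝ φ p = 0 := fun p hp => fderiv_eq_zero_of_notMem hts hp
  have hdx0 : ∀ p ∉ B, fderiv ℝ φ p (1, 0) = 0 := fun p hp => by rw [hd0 p hp]; rfl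
  have hdy0 : ∀ p ∉ B, gfun α p.1 * fderiv ℝ φ p (0, 1) = 0 := fun p hp => by
    rw [hd0 p hp]; simp
  obtain ⟨M, hM⟩ := hφ.continuous.bounded_above_of_compact_support hcs
  have hgb : ∀ p ∈ B, |gfun α p.1 * fderiv ℝ φ p (0, 1)| ≤ (2 * α + 1) * L := fun p hp => by
    rw [abs_mul]
    gcongr
    · exact abs_gfun_le_const hα (hB p hp).le
    · exact abs_fderiv_le hφ p _ hv2
  have hxm := measurable_fderiv_apply_const ℝ φ ((1, 0) : ℝ × ℝ)
  have hym := measurable_gfun_mul_fderiv α φ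
  have hφm := hφ.continuous.measurable
  have iφ : ∀ f, IsThin α f → Integrable fun p => f p * φ p := fun f hf =>
    integrable_mul_of_memLp hV (hf.memLp hα hB) hφm (fun p _ => hM p) hφ0
  have ix : ∀ f, IsThin α f → Integrable fun p => f p * fderiv ℝ φ p (1, 0) := fun f hf =>
    integrable_mul_of_memLp hV (hf.memLp hα hB) hxm (fun p _ => abs_fderiv_le hφ p _ hv1) hdx0
  have iy : ∀ f, IsThin α f → Integrable fun p => f p * (gfun α p.1 * fderiv ℝ φ p (0, 1)) :=
    fun f hf => integrable_mul_of_memLp hV (hf.memLp hα hB) hym hgb hdy0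
  have t0 := isThin_ansatz hα hχ hl
  have tX := isThin_slopeX hα hχ hl
  have tY := isThin_slopeY hα hχ hl
  have tXX := isThin_slopeXX hα hχ hl
  have tYY := isThin_slopeYY hα hχ hl
  -- Only the slice `y = 0` can be singular, and it is negligible.
  have hsx : ∀ᵐ y : ℝ, ContDiff ℝ ∞ fun s => ansatz α χ l (s, y) := by
    filter_upwards [ae_ne_zero] with y hy using contDiff_ansatz_fst hα hχ hl hy
  have hsy := contDiff_ansatz_snd (α := α) (l := l) hχ
  have I1 : ∫ p, ansatz α χ l p * fderiv ℝ φ p (1, 0) = -∫ p, slopeX (ansatz α χ l) p * φ p := by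
    refine integral_mul_fderiv_fst hφ hR ?_ ?_ (ix _ t0) (iφ _ tX)
    · filter_upwards [hsx] with y hy using contDiff_one_of_infty hy
    · exact Eventually.of_forall fun y => Eventually.of_forall fun x => rfl
  have I2 : ∫ p, slopeX (ansatz α χ l) p * fderiv ℝ φ p (1, 0) =
      -∫ p, slopeXX (ansatz α χ l) p * φ p := by
    refine integral_mul_fderiv_fst hφ hR ?_ ?_ (ix _ tX) (iφ _ tXX)
    · filter_upwards [hsx] with y hy using contDiff_one_deriv_of_infty hy
    · exact Eventually.of_forall fun y => Eventually.of_forall fun x => rfl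
  have I3 : ∫ p, ansatz α χ l p * (gfun α p.1 * fderiv ℝ φ p (0, 1)) =
      -∫ p, gfun α p.1 * slopeY (ansatz α χ l) p * φ p := by
    -- As `g` depends on `x` alone, it can be moved onto the factor that `∂_y` will hit.
    have e : ∀ p : ℝ × ℝ, ansatz α χ l p * (gfun α p.1 * fderiv ℝ φ p (0, 1)) =
        gfun α p.1 * ansatz α χ l p * fderiv ℝ φ p (0, 1) := fun p => by ring
    have i := iy _ t0
    simp only [e] at i ⊢
    refine integral_mul_fderiv_snd hφ hR ?_ ?_ i (iφ _ tY)
    · exact Eventually.of_forall fun x =>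
        (contDiff_const (c := gfun α x)).mul (contDiff_one_of_infty (hsy x))
    · refine Eventually.of_forall fun x => Eventually.of_forall fun y => ?_
      exact deriv_const_mul_field (gfun α x)
  have I4 : ∫ p, gfun α p.1 * slopeY (ansatz α χ l) p * (gfun α p.1 * fderiv ℝ φ p (0, 1)) =
      -∫ p, gfun α p.1 ^ 2 * slopeYY (ansatz α χ l) p * φ p := by
    have e : ∀ p : ℝ × ℝ, gfun α p.1 * slopeY (ansatz α χ l) p *
        (gfun α p.1 * fderiv ℝ φ p (0, 1)) =
        gfun α p.1 ^ 2 * slopeY (ansatz α χ l) p * fderiv ℝ φ p (0, 1) := fun p => by ring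
    have i := iy _ tY
    simp only [e] at i ⊢
    refine integral_mul_fderiv_snd hφ hR ?_ ?_ i (iφ _ tYY)
    · exact Eventually.of_forall fun x =>
        (contDiff_const (c := gfun α x ^ 2)).mul (contDiff_one_deriv_of_infty (hsy x))
    · refine Eventually.of_forall fun x => Eventually.of_forall fun y => ?_
      exact deriv_const_mul_field (gfun α x ^ 2)
  refine ⟨?_, ?_, ?_⟩
  · rw [setIntegral_eq_integral fun p hp => by simp [aGrad, hd0 p hp],
      setIntegral_eq_integral fun p hp => by simp [hφ0 p hp]]
    exact I1
  · rw [setIntegral_eq_integral fun p hp => by simp [aGrad, hd0 p hp],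
      setIntegral_eq_integral fun p hp => by simp [hφ0 p hp]]
    exact I3
  · rw [setIntegral_eq_integral fun p hp => by simp [aGrad, hd0 p hp],
      setIntegral_eq_integral fun p hp => by simp [aGrad, hd0 p hp],
      setIntegral_eq_integral fun p hp => by simp [hφ0 p hp]]
    refine (congrArg₂ (· + ·)
      ((integral_congr_ae (Eventually.of_forall fun p => mul_comm _ _)).trans I2)
      ((integral_congr_ae (Eventually.of_forall fun p => mul_comm _ _)).trans I4)).trans ?_
    rw [← neg_add, ← integral_add (iφ _ tXX) (iφ _ tYY)]
    congr 1
    refine integral_congr_ae (Eventually.of_forall fun p => ?_)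
    simp only [opL_eq]; ring

theorem hasWeakAGrad_ansatz (hα : 0 < α) (hχ : IsCutoff χ) (hl : IsProfile l)
    (hB : ∀ p ∈ B, |p.1| < 1) (hV : volume B ≠ ⊤) :
    HasWeakAGrad (gfun α) B (ansatz α χ l) (ansatzGrad α χ l) where
  memLp := (isThin_ansatz hα hχ hl).memLp hα hB
  memLp_grad := memLp_ansatzGrad hα hχ hl hB
  weak φ hφ hcs hts := by
    obtain ⟨L, hL⟩ := ContDiff.lipschitzWith_of_hasCompactSupport hcs hφ (by simp)
    have h := ansatz_integral_by_parts hα hχ hl hB hV hL hcs hts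
    exact ⟨h.1, h.2.1⟩

/-- For Lipschitz tests this is integration by parts. Both sides are continuous in the test function
and its `A`-gradient for `L²` convergence, since the right-hand side and the gradient of the
solution are square integrable. -/
theorem isWeakSolution_ansatz (hα : 0 < α) (hχ : IsCutoff χ) (hl : IsProfile l)
    (hB : ∀ p ∈ B, |p.1| < 1) (hV : volume B ≠ ⊤) :
    IsWeakSolution (gfun α) B (opL (gfun α) (ansatz α χ l)) (ansatz α χ l) := by
  refine ⟨ansatzGrad α χ l, hasWeakAGrad_ansatz hα hχ hl hB hV, fun w H hw => ?_⟩
  obtain ⟨⟨hwm, hHm, -⟩, φ, hφ, hφw, hφH⟩ := hw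
  have hfm := (isThin_opL hα hχ hl).memLp hα hB
  have hGm := memLp_ansatzGrad hα hχ hl hB
  refine ⟨hfm.integrable_mul hwm, ?_⟩
  have hma : ∀ n, AEStronglyMeasurable (aGrad (gfun α) (φ n)) (volume.restrict B) := fun n =>
    (measurable_aGrad α (φ n)).aestronglyMeasurable
  have hφm : ∀ n, AEStronglyMeasurable (φ n) (volume.restrict B) := fun n => by
    obtain ⟨⟨L, hL⟩, -⟩ := hφ n
    exact hL.continuous.aestronglyMeasurable
  have L0 := tendsto_integral_mul hφm hwm hfm hφw
  have L1 := tendsto_integral_mul (fun n => (hma n).fst) hHm.fst hGm.fst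
    (tendsto_of_tendsto_of_tendsto_of_le_of_le tendsto_const_nhds hφH (fun n => zero_le)
      fun n => eLpNorm_mono fun p => norm_fst_le (H p - aGrad (gfun α) (φ n) p))
  have L2 := tendsto_integral_mul (fun n => (hma n).snd) hHm.snd hGm.snd
    (tendsto_of_tendsto_of_tendsto_of_le_of_le tendsto_const_nhds hφH (fun n => zero_le)
      fun n => eLpNorm_mono fun p => norm_snd_le (H p - aGrad (gfun α) (φ n) p))
  have hlim := (L1.add L2).congr fun n => by
    obtain ⟨⟨L, hL⟩, hcs, hts⟩ := hφ n
    exact (ansatz_integral_by_parts hα hχ hl hB hV hL hcs hts).2.2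
  have hfin := tendsto_nhds_unique hlim L0.neg
  refine (integral_add (hHm.fst.integrable_mul hGm.fst)
    (hHm.snd.integrable_mul hGm.snd)).trans (hfin.trans ?_)
  congr 1
  exact integral_congr_ae (Eventually.of_forall fun p => mul_comm _ _)

end Ansatz

/-! ### Zero boundary values and unboundedness -/

/-- Dominated convergence in `L²`. -/
theorem tendsto_eLpNorm_two_of_dominated {X E : Type*} [MeasurableSpace X] {μ : Measure X}
    [NormedAddCommGroup E] {f : ℕ → X → E} {b : X → ℝ}
    (hf : ∀ n, AEStronglyMeasurable (f n) μ) (hb : MemLp b 2 μ)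
    (hle : ∀ n, ∀ᵐ x ∂μ, ‖f n x‖ ≤ b x)
    (hlim : ∀ᵐ x ∂μ, Tendsto (fun n => f n x) atTop (𝓝 0)) :
    Tendsto (fun n => eLpNorm (f n) 2 μ) atTop (𝓝 0) := by
  have hfin := (eLpNorm_lt_top_iff_lintegral_rpow_enorm_lt_top two_ne_zero
    ENNReal.ofNat_ne_top).1 hb.2
  have h1 : Tendsto (fun n => ∫⁻ x, ‖f n x‖ₑ ^ (2 : ℝ) ∂μ) atTop (𝓝 (∫⁻ _, 0 ∂μ)) := by
    refine tendsto_lintegral_of_dominated_convergence' (fun x => ‖b x‖ₑ ^ (2 : ℝ))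
      (fun n => (hf n).enorm.pow_const _) (fun n => ?_) hfin.ne ?_
    · filter_upwards [hle n] with x hx
      gcongr
      rw [← ofReal_norm, Real.enorm_eq_ofReal_abs]
      exact ENNReal.ofReal_le_ofReal (hx.trans (le_abs_self _))
    · filter_upwards [hlim] with x hx
      have h2 := ((continuous_enorm.tendsto _).comp hx).ennrpow_const (2 : ℝ)
      simpa using h2
  rw [lintegral_zero] at h1
  have h3 := h1.ennrpow_const (1 / 2 : ℝ)
  rw [ENNReal.zero_rpow_of_pos (by norm_num)] at h3
  refine h3.congr fun n => ?_
  rw [eLpNorm_eq_lintegral_rpow_enorm_toReal two_ne_zero ENNReal.ofNat_ne_top]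
  simp

section Ansatz

variable {α : ℝ} {χ l : ℝ → ℝ} {B : Set (ℝ × ℝ)}

/-- An `L²` majorant, independent of `n`, for the term in which the derivative falls on the
truncating cutoff. -/
theorem isThin_inv_mul (hα : 0 < α) (hχ : IsCutoff χ) (hl : IsProfile l) :
    IsThin α fun p => |p.1|⁻¹ * ansatz α χ l p := by
  have h := isThin_ansatz hα hχ hl
  obtain ⟨m, K, hb⟩ := h.bound
  refine ⟨?_, ⟨m + 1, K, fun p hp hp1 => ?_⟩, fun p hp hy => by rw [h.eq_zero p hp hy, mul_zero]⟩
  · exact (measurable_fst.abs.inv.mul (measurable_ansatz hχ hl)).aestronglyMeasurable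
  · have h0 := abs_pos.2 hp
    rw [abs_mul, abs_inv, abs_abs, neg_add, Real.rpow_add h0, Real.rpow_neg_one]
    calc |p.1|⁻¹ * |ansatz α χ l p| ≤ |p.1|⁻¹ * (K * |p.1| ^ (-m)) := by
          gcongr; exact hb p hp hp1
      _ = _ := by ring

/-- The truncation of `χ(y / ψ(x)) ℓ(x)` near the line `x = 0`. -/
def truncAnsatz (α : ℝ) (χ l : ℝ → ℝ) (n : ℕ) (p : ℝ × ℝ) : ℝ :=
  (1 - χ ((n + 1) * p.1)) * ansatz α χ l p

theorem contDiff_truncAnsatz (hχ : IsCutoff χ) (hl : IsProfile l) (n : ℕ) :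
    ContDiff ℝ ∞ (truncAnsatz α χ l n) := by
  rw [contDiff_iff_contDiffAt]
  intro p
  rcases eq_or_ne p.1 0 with h0 | hx
  · have h : truncAnsatz α χ l n =ᶠ[𝓝 p] fun _ => 0 := by
      have hc : Continuous fun q : ℝ × ℝ => |((n : ℝ) + 1) * q.1| := by fun_prop
      have hp : |((n : ℝ) + 1) * p.1| < 1 := by rw [h0]; simp
      filter_upwards [(isOpen_lt hc continuous_const).mem_nhds hp] with q hq
      have hq' : |((n : ℝ) + 1) * q.1| ≤ 1 := le_of_lt hq
      rw [truncAnsatz, hχ.eq_one _ (abs_le.1 hq'), sub_self, zero_mul]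
    exact contDiffAt_const.congr_of_eventuallyEq h
  · have h1 : ContDiff ℝ ∞ fun q : ℝ × ℝ => 1 - χ (((n : ℝ) + 1) * q.1) :=
      contDiff_const.sub (hχ.contDiff.comp (contDiff_const.mul contDiff_fst))
    exact h1.contDiffAt.mul (contDiffAt_ansatz hχ hl hx)

theorem aGrad_truncAnsatz (hχ : IsCutoff χ) (hl : IsProfile l) (n : ℕ) {p : ℝ × ℝ}
    (hx : p.1 ≠ 0) : ansatzGrad α χ l p - aGrad (gfun α) (truncAnsatz α χ l n) p =
      (χ ((n + 1) * p.1) * slopeX (ansatz α χ l) p +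
        deriv χ ((n + 1) * p.1) * (n + 1) * ansatz α χ l p,
        χ ((n + 1) * p.1) * (gfun α p.1 * slopeY (ansatz α χ l) p)) := by
  obtain ⟨x, y⟩ := p
  simp only at hx ⊢
  have hd : DifferentiableAt ℝ (truncAnsatz α χ l n) (x, y) :=
    (contDiff_truncAnsatz hχ hl n).differentiable (by simp) _
  have hv : DifferentiableAt ℝ (ansatz α χ l) (x, y) :=
    (contDiffAt_ansatz hχ hl (p := (x, y)) hx).differentiableAt (by simp)
  have v1 := hasDerivAt_slice_fst hv
  have v2 := hasDerivAt_slice_snd hv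
  have hρ : HasDerivAt (fun s : ℝ => 1 - χ (((n : ℝ) + 1) * s))
      (-(deriv χ ((n + 1) * x) * (n + 1))) x := by
    have h := ((hχ.hasDerivAt _).comp x ((hasDerivAt_id x).const_mul ((n : ℝ) + 1))).const_sub 1
    simpa using h
  have d1 := (hasDerivAt_slice_fst hd).unique (hρ.mul v1)
  have d2 := (hasDerivAt_slice_snd hd).unique (v2.const_mul (1 - χ (((n : ℝ) + 1) * x)))
  have s1 : slopeX (ansatz α χ l) (x, y) = fderiv ℝ (ansatz α χ l) (x, y) (1, 0) := v1.deriv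
  have s2 : slopeY (ansatz α χ l) (x, y) = fderiv ℝ (ansatz α χ l) (x, y) (0, 1) := v2.deriv
  simp only [ansatzGrad, aGrad, d1, d2, s1, s2, Prod.mk_sub_mk]
  congr 1 <;> ring

/-- Removing a neighbourhood of the line `x = 0` leaves smooth functions. Their support lies in the
box, as `|x| ≤ δ/2` forces `|y| ≤ 2ψ(x) ≤ δ`. They converge by domination, the cutoff derivative
costing only another factor `1/|x|`. -/
theorem hasWeakAGradZero_ansatz (hα : 0 < α) (hχ : IsCutoff χ) (hl : IsProfile l)
    (hB : ∀ p ∈ B, |p.1| < 1) (hV : volume B ≠ ⊤) {δ : ℝ} (hδ : δ ≤ 1)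
    (hbox : ∀ x y : ℝ, |x| ≤ δ → |y| ≤ δ → (x, y) ∈ B) (hl0 : ∀ x, δ / 2 < |x| → l x = 0) :
    HasWeakAGradZero (gfun α) B (ansatz α χ l) (ansatzGrad α χ l) := by
  obtain ⟨D, hD, hDb⟩ := hχ.exists_bound
  have hae := ae_restrict_of_ae (s := B) ae_fst_ne_zero
  have hev : ∀ p : ℝ × ℝ, p.1 ≠ 0 → ∀ᶠ n : ℕ in atTop, 2 < |((n : ℝ) + 1) * p.1| := by
    intro p hp
    obtain ⟨N, hN⟩ := exists_nat_gt (2 / |p.1|)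
    filter_upwards [eventually_ge_atTop N] with n hn
    rw [abs_mul, abs_of_nonneg (by positivity : (0 : ℝ) ≤ n + 1), ← div_lt_iff₀ (abs_pos.2 hp)]
    have : (N : ℝ) ≤ n := by exact_mod_cast hn
    linarith
  refine ⟨hasWeakAGrad_ansatz hα hχ hl hB hV, truncAnsatz α χ l, fun n => ?_, ?_, ?_⟩
  · have hsupp : Function.support (truncAnsatz α χ l n) ⊆ Metric.closedBall 0 δ := by
      intro p hp
      have hv : ansatz α χ l p ≠ 0 := right_ne_zero_of_mul hp
      have hl1 : l p.1 ≠ 0 := right_ne_zero_of_mul hv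
      have hx0 : p.1 ≠ 0 := fun h => hl1 (by rw [h, hl.map_zero])
      have hx : |p.1| ≤ δ / 2 := not_lt.1 fun h => hl1 (hl0 _ h)
      have hy : |p.2| ≤ 2 * psi α p.1 := not_lt.1 fun h => hv (ansatz_eq_zero hχ hx0 h)
      have h0 := abs_nonneg p.1
      have hψ := psi_le_abs (α := α) hα (x := p.1) (by linarith)
      rw [mem_closedBall_zero_iff, Prod.norm_def]
      exact max_le (by rw [Real.norm_eq_abs]; linarith) (by rw [Real.norm_eq_abs]; linarith)
    have hcs : HasCompactSupport (truncAnsatz α χ l n) :=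
      HasCompactSupport.of_support_subset_isCompact (isCompact_closedBall 0 δ) hsupp
    refine ⟨ContDiff.lipschitzWith_of_hasCompactSupport hcs (contDiff_truncAnsatz hχ hl n)
      (by simp), hcs, ?_⟩
    refine (closure_minimal hsupp Metric.isClosed_closedBall).trans fun p hp => ?_
    rw [mem_closedBall_zero_iff] at hp
    exact hbox p.1 p.2 ((norm_fst_le p).trans hp) ((norm_snd_le p).trans hp)
  · refine tendsto_eLpNorm_two_of_dominated (b := fun p => D * |ansatz α χ l p|) (fun n => ?_)
      (((isThin_ansatz hα hχ hl).memLp hα hB).norm.const_mul D) (fun n => ?_) ?_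
    · exact ((measurable_ansatz hχ hl).sub
        (contDiff_truncAnsatz hχ hl n).continuous.measurable).aestronglyMeasurable
    · refine Eventually.of_forall fun p => ?_
      have : ansatz α χ l p - truncAnsatz α χ l n p = χ ((n + 1) * p.1) * ansatz α χ l p := by
        rw [truncAnsatz]; ring
      rw [this, norm_mul]
      exact mul_le_mul_of_nonneg_right (hDb _).1 (norm_nonneg _)
    · filter_upwards [hae] with p hp
      refine tendsto_const_nhds.congr' ?_
      filter_upwards [hev p hp] with n hn
      rw [truncAnsatz, hχ.eq_zero_of_lt hn]; ring
  · have hX := (isThin_slopeX hα hχ hl).memLp hα hB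
    have hY := (isThin_slopeY hα hχ hl).memLp hα hB
    have hI := (isThin_inv_mul hα hχ hl).memLp hα hB
    refine tendsto_eLpNorm_two_of_dominated (b := fun p => D * |slopeX (ansatz α χ l) p| +
      2 * D * |(|p.1|⁻¹ * ansatz α χ l p)| + D * |gfun α p.1 * slopeY (ansatz α χ l) p|)
      (fun n => ?_) (((hX.norm.const_mul D).add (hI.norm.const_mul (2 * D))).add
        (hY.norm.const_mul D)) (fun n => ?_) ?_
    · exact (memLp_ansatzGrad hα hχ hl hB).1.sub (measurable_aGrad α _).aestronglyMeasurable
    · filter_upwards [hae] with p hp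
      rw [aGrad_truncAnsatz hχ hl n hp]
      set t := ((n : ℝ) + 1) * p.1 with ht
      have e1 : |χ t * slopeX (ansatz α χ l) p| ≤ D * |slopeX (ansatz α χ l) p| := by
        rw [abs_mul]; gcongr; exact (hDb t).1
      have e2 : |deriv χ t * (n + 1) * ansatz α χ l p| ≤
          2 * D * |(|p.1|⁻¹ * ansatz α χ l p)| := by
        have h0 := abs_pos.2 hp
        rcases le_or_gt |t| 2 with h | h
        · have h1 : (n : ℝ) + 1 ≤ 2 * |p.1|⁻¹ := by
            rw [ht, abs_mul, abs_of_nonneg (by positivity : (0 : ℝ) ≤ n + 1)] at h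
            rw [← div_eq_mul_inv, le_div_iff₀ h0]; exact h
          rw [abs_mul, abs_mul, abs_mul, abs_inv, abs_abs,
            abs_of_nonneg (by positivity : (0 : ℝ) ≤ n + 1)]
          calc |deriv χ t| * (n + 1) * |ansatz α χ l p|
              ≤ D * (2 * |p.1|⁻¹) * |ansatz α χ l p| := by gcongr; exact (hDb t).2.1
            _ = _ := by ring
        · rw [hχ.deriv_eq_zero h]; simp; positivity
      have e3 : |χ t * (gfun α p.1 * slopeY (ansatz α χ l) p)| ≤
          D * |gfun α p.1 * slopeY (ansatz α χ l) p| := by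
        rw [abs_mul]; gcongr; exact (hDb t).1
      have n1 := abs_nonneg (χ t * slopeX (ansatz α χ l) p)
      have n2 := abs_nonneg (deriv χ t * (n + 1) * ansatz α χ l p)
      have n3 := abs_nonneg (χ t * (gfun α p.1 * slopeY (ansatz α χ l) p))
      rw [Prod.norm_def]
      refine max_le ?_ ?_
      · exact (abs_add_le _ _).trans (by linarith)
      · exact le_trans (le_of_eq (Real.norm_eq_abs _)) (by linarith)
    · filter_upwards [hae] with p hp
      refine tendsto_const_nhds.congr' ?_
      filter_upwards [hev p hp] with n hn
      rw [aGrad_truncAnsatz hχ hl n hp, hχ.eq_zero_of_lt hn, hχ.deriv_eq_zero hn]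
      simp only [zero_mul, add_zero]
      rfl

/-- Where `|y| < ψ(x)` the cutoff is one and the function equals `ℓ(x)`. The part of this region
with `0 < x < m` is open and nonempty, hence of positive measure, and for small `m` it lies in `U ∩
B` while `|ℓ|` exceeds any supposed essential bound. -/
theorem unboundedAtOrigin_ansatz (hα : 0 < α) (hχ : IsCutoff χ) {δ : ℝ} (hδ : 0 < δ)
    (hbox : ∀ x y : ℝ, |x| ≤ δ → |y| ≤ δ → (x, y) ∈ B)
    (hl : ∀ C : ℝ, ∃ η : ℝ, 0 < η ∧ ∀ x, 0 < x → x < η → C < |l x|) :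
    UnboundedAtOrigin B (ansatz α χ l) := by
  intro U hU
  by_contra hne
  obtain ⟨ρ, hρ, hρU⟩ := Metric.mem_nhds_iff.1 hU
  set C := (eLpNorm (ansatz α χ l) ⊤ (volume.restrict (U ∩ B))).toReal with hC
  obtain ⟨η, hη, hηC⟩ := hl C
  set m : ℝ := min (min η 1) (min δ ρ) with hm
  have hmpos : 0 < m := by positivity
  set O : Set (ℝ × ℝ) := {p | 0 < p.1} ∩ ({p | p.1 < m} ∩ {p | |p.2| < psi α p.1}) with hO
  have hOopen : IsOpen O := by
    have h1 : IsOpen {p : ℝ × ℝ | 0 < p.1} := isOpen_lt continuous_const continuous_fst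
    have h2 : IsOpen {p : ℝ × ℝ | p.1 < m} := isOpen_lt continuous_fst continuous_const
    have h3 : ContinuousOn (fun p : ℝ × ℝ => psi α p.1 - |p.2|) {p | 0 < p.1} := fun p hp =>
      ((((hasDerivAt_psi α (ne_of_gt hp)).continuousAt.comp continuousAt_fst)).sub
        (continuous_abs.comp continuous_snd).continuousAt).continuousWithinAt
    have h4 := h3.isOpen_inter_preimage h1 isOpen_Ioi (t := Set.Ioi 0)
    have : O = {p : ℝ × ℝ | p.1 < m} ∩
        ({p : ℝ × ℝ | 0 < p.1} ∩ (fun p : ℝ × ℝ => psi α p.1 - |p.2|) ⁻¹' Set.Ioi 0) := by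
      ext p
      simp only [hO, Set.mem_inter_iff, Set.mem_ofPred_eq, Set.mem_preimage, Set.mem_Ioi, sub_pos]
      tauto
    rw [this]
    exact h2.inter h4
  have hOne : O.Nonempty := ⟨(m / 2, 0), half_pos hmpos, half_lt_self hmpos, by
    simpa using psi_pos α (half_pos hmpos).ne'⟩
  have hOsub : O ⊆ U ∩ B := by
    rintro p ⟨h1, h2, h3⟩
    have h1' : 0 < p.1 := h1
    have h2' : p.1 < m := h2
    have h3' : |p.2| < psi α p.1 := h3
    have hx : |p.1| < m := by rwa [abs_of_pos h1']
    have hm1 : m ≤ 1 := (min_le_left _ _).trans (min_le_right _ _)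
    have hmδ : m ≤ δ := (min_le_right _ _).trans (min_le_left _ _)
    have hmρ : m ≤ ρ := (min_le_right _ _).trans (min_le_right _ _)
    have hy : |p.2| < m := h3'.trans_le ((psi_le_abs hα (hx.le.trans hm1)).trans hx.le)
    refine ⟨hρU ?_, hbox p.1 p.2 (hx.le.trans hmδ) (hy.le.trans hmδ)⟩
    rw [mem_ball_zero_iff, Prod.norm_def]
    exact max_lt (hx.trans_le hmρ) (hy.trans_le hmρ)
  have hpos : 0 < volume O := hOopen.measure_pos volume hOne
  have hae : ∀ᵐ p ∂(volume.restrict O), ‖ansatz α χ l p‖ₑ ≤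
      eLpNorm (ansatz α χ l) ⊤ (volume.restrict (U ∩ B)) := by
    refine ae_mono (Measure.restrict_mono hOsub le_rfl) ?_
    rw [eLpNorm_exponent_top]
    exact ae_le_eLpNormEssSup
  have hfalse : ∀ᵐ p ∂(volume.restrict O), False := by
    filter_upwards [hae, ae_restrict_mem hOopen.measurableSet] with p hp hpO
    obtain ⟨h1, h2, h3⟩ := hpO
    have h1' : 0 < p.1 := h1
    have h2' : p.1 < m := h2
    have h3' : |p.2| < psi α p.1 := h3
    have hψ := psi_pos α h1'.ne'
    have hz : |p.2 / psi α p.1| ≤ 1 := by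
      rw [abs_div, abs_of_pos hψ, div_le_one hψ]; exact h3'.le
    rw [ansatz, hχ.eq_one _ (abs_le.1 hz), one_mul, Real.enorm_eq_ofReal_abs,
      ENNReal.ofReal_le_iff_le_toReal hne] at hp
    exact (hηC p.1 h1' (h2'.trans_le ((min_le_left _ _).trans (min_le_left _ _)))).not_ge hp
  rw [ae_iff] at hfalse
  simp only [not_false_eq_true, Set.ofPred_true, Measure.restrict_apply_univ] at hfalse
  exact hpos.ne' hfalse

end Ansatz

/-! ### Logarithmic profiles -/

/-- As `Real.log` is even with value `0` at `0`, `-Real.log x` is `ln (1/|x|)` on both sides and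
respects the convention on the line `x = 0`. The constant `1/ε` comes from `|log x| |x|^ε < 1/ε`. -/
theorem isProfile_neg_log : IsProfile fun x => -Real.log x := by
  have h1 : ∀ x : ℝ, deriv (fun x => -Real.log x) x = -x⁻¹ := fun x => by
    rw [deriv.fun_neg, Real.deriv_log]
  have h2 : ∀ x : ℝ, deriv (deriv fun x => -Real.log x) x = (x ^ 2)⁻¹ := fun x => by
    rw [funext h1, deriv.fun_neg, deriv_inv, neg_neg]
  refine ⟨(Real.contDiffOn_log).neg, Real.measurable_log.neg, by simp, fun ε hε =>
    ⟨max 1 (1 / ε), by positivity, fun x hx hx1 => ?_⟩⟩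
  have h0 := abs_pos.2 hx
  have he : 1 ≤ |x| ^ (-ε) := Real.one_le_rpow_of_pos_of_le_one_of_nonpos h0 hx1.le (by linarith)
  rw [h1, h2]
  refine ⟨?_, ?_, ?_⟩
  · have h3 := (Real.abs_log_mul_self_rpow_lt |x| ε h0 hx1.le hε).le
    rw [Real.log_abs, abs_mul, abs_of_nonneg (by positivity : 0 ≤ |x| ^ ε),
      ← le_div_iff₀ (by positivity)] at h3
    rw [abs_neg, Real.rpow_neg h0.le, ← div_eq_mul_inv]
    exact h3.trans (div_le_div_of_nonneg_right (le_max_right _ _) (by positivity))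
  · rw [abs_neg, abs_inv, sub_eq_add_neg, Real.rpow_add h0, Real.rpow_neg_one]
    calc |x|⁻¹ = 1 * (|x|⁻¹ * 1) := by ring
      _ ≤ max 1 (1 / ε) * (|x|⁻¹ * |x| ^ (-ε)) := by gcongr; exact le_max_left _ _
  · rw [abs_inv, abs_pow, sub_eq_add_neg, Real.rpow_add h0, Real.rpow_neg h0.le, Real.rpow_two]
    calc (|x| ^ 2)⁻¹ = 1 * ((|x| ^ 2)⁻¹ * 1) := by ring
      _ ≤ max 1 (1 / ε) * ((|x| ^ 2)⁻¹ * |x| ^ (-ε)) := by gcongr; exact le_max_left _ _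

theorem IsProfile.mul {η l : ℝ → ℝ} {D : ℝ} (hη : ContDiff ℝ ∞ η)
    (hD : ∀ s, |η s| ≤ D ∧ |deriv η s| ≤ D ∧ |deriv (deriv η) s| ≤ D) (hl : IsProfile l) :
    IsProfile fun x => η x * l x := by
  have hη' : ContDiff ℝ ∞ (deriv η) := (contDiff_infty_iff_deriv.1 hη).2
  have d0 : ∀ s, HasDerivAt η (deriv η s) s := fun s =>
    (hη.differentiable (by simp) s).hasDerivAt
  have d1 : ∀ s, HasDerivAt (deriv η) (deriv (deriv η) s) s := fun s =>
    (hη'.differentiable (by simp) s).hasDerivAt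
  have h1 : ∀ x, x ≠ 0 → deriv (fun x => η x * l x) x = deriv η x * l x + η x * deriv l x :=
    fun x hx => ((d0 x).mul (hl.hasDerivAt hx)).deriv
  have h2 : ∀ x, x ≠ 0 → deriv (deriv fun x => η x * l x) x =
      deriv (deriv η) x * l x + deriv η x * deriv l x +
        (deriv η x * deriv l x + η x * deriv (deriv l) x) := fun x hx => by
    have hev : (deriv fun x => η x * l x) =ᶠ[𝓝 x] fun x => deriv η x * l x + η x * deriv l x := by
      filter_upwards [isOpen_ne.mem_nhds hx] with s hs using h1 s hs
    rw [hev.deriv_eq]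
    exact (((d1 x).mul (hl.hasDerivAt hx)).add ((d0 x).mul (hl.hasDerivAt_deriv hx))).deriv
  have hD0 : 0 ≤ D := (abs_nonneg _).trans (hD 0).1
  refine ⟨hη.contDiffOn.mul hl.contDiffOn, hη.continuous.measurable.mul hl.measurable,
    by simp [hl.map_zero], fun ε hε => ?_⟩
  obtain ⟨C, hC, hb⟩ := hl.bound ε hε
  -- Four is the number of terms in the product rule for the second derivative.
  refine ⟨4 * D * C, by positivity, fun x hx hx1 => ?_⟩
  obtain ⟨b0, b1, b2⟩ := hb x hx hx1
  obtain ⟨e0, e1, e2⟩ := hD x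
  have h0 := abs_pos.2 hx
  have p1 : |x| ^ (-ε) ≤ |x| ^ (-1 - ε) :=
    Real.rpow_le_rpow_of_exponent_ge h0 hx1.le (by linarith)
  have p2 : |x| ^ (-1 - ε) ≤ |x| ^ (-2 - ε) :=
    Real.rpow_le_rpow_of_exponent_ge h0 hx1.le (by linarith)
  have q0 : 0 ≤ |x| ^ (-ε) := by positivity
  have q1 : 0 ≤ |x| ^ (-1 - ε) := by positivity
  have q2 : 0 ≤ |x| ^ (-2 - ε) := by positivity
  have mulb : ∀ a b b' : ℝ, |a| ≤ D → |b| ≤ C * b' → |a * b| ≤ D * C * b' := fun a b b' ha hb => by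
    rw [abs_mul, mul_assoc]; gcongr
  have hDC : 0 ≤ D * C := by positivity
  rw [h1 x hx, h2 x hx]
  refine ⟨?_, ?_, ?_⟩
  · refine (mulb _ _ _ e0 b0).trans ?_
    nlinarith [mul_nonneg hDC q0]
  · refine (abs_add_le _ _).trans ((add_le_add (mulb _ _ _ e1 b0) (mulb _ _ _ e0 b1)).trans ?_)
    nlinarith [mul_nonneg hDC q1, mul_le_mul_of_nonneg_left p1 hDC]
  · refine (abs_add_le _ _).trans ((add_le_add ((abs_add_le _ _).trans
      (add_le_add (mulb _ _ _ e2 b0) (mulb _ _ _ e1 b1)))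
      ((abs_add_le _ _).trans (add_le_add (mulb _ _ _ e1 b1) (mulb _ _ _ e0 b2)))).trans ?_)
    nlinarith [mul_le_mul_of_nonneg_left p1 hDC, mul_le_mul_of_nonneg_left p2 hDC]

theorem IsCutoff.isProfile_mul_neg_log {χ : ℝ → ℝ} (hχ : IsCutoff χ) (c : ℝ) :
    IsProfile fun x => χ (c * x) * -Real.log x := by
  obtain ⟨D, hD, hDb⟩ := hχ.exists_bound
  have h1 : ∀ x, deriv (fun x => χ (c * x)) x = c * deriv χ (c * x) := fun x =>
    deriv_comp_mul_left c χ x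
  have h2 : ∀ x, deriv (deriv fun x => χ (c * x)) x = c * (c * deriv (deriv χ) (c * x)) :=
    fun x => by
      rw [funext h1, deriv_const_mul_field]
      congr 1
      exact deriv_comp_mul_left c (deriv χ) x
  refine IsProfile.mul (D := (1 + |c|) ^ 2 * D) (hχ.contDiff.comp (contDiff_const.mul contDiff_id))
    (fun s => ?_) isProfile_neg_log
  rw [h1, h2]
  obtain ⟨d0, d1, d2⟩ := hDb (c * s)
  have hc := abs_nonneg c
  have c1 : 1 ≤ (1 + |c|) ^ 2 := by nlinarith
  have c2 : |c| ≤ (1 + |c|) ^ 2 := by nlinarith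
  have c3 : |c| * |c| ≤ (1 + |c|) ^ 2 := by nlinarith
  refine ⟨?_, ?_, ?_⟩
  · calc |χ (c * s)| ≤ 1 * D := by rw [one_mul]; exact d0
      _ ≤ _ := by gcongr
  · rw [abs_mul]; gcongr
  · rw [← mul_assoc, abs_mul, abs_mul]; gcongr

/-! ### Orlicz integrability -/

/-- If `|t| ≤ max(2M, log|s|)^M` then `s t ≤ Φ_M(s)` and `s` contributes nothing. Otherwise `log|s|
≤ |t|^(1/M)`, and the term is at most `|s||t|`. -/
theorem convexConj_bump_le {M : ℝ} (hM : 0 < M) (t : ℝ) :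
    convexConj (bump M) t ≤ ENNReal.ofReal (|t| * Real.exp (|t| ^ (1 / M))) := by
  refine iSup_le fun s => ENNReal.ofReal_le_ofReal ?_
  rcases eq_or_ne s 0 with rfl | hs
  · rw [bump_zero]; simp; positivity
  have hs0 := abs_pos.2 hs
  have hst : s * t ≤ |s| * |t| := by rw [← abs_mul]; exact le_abs_self _
  rcases le_or_gt |t| (max (2 * M) (Real.log |s|) ^ M) with h | h
  · have : s * t ≤ bump M s := hst.trans (by rw [bump_eq]; gcongr)
    have h2 : 0 ≤ |t| * Real.exp (|t| ^ (1 / M)) := by positivity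
    linarith
  · have hmax : 0 ≤ max (2 * M) (Real.log |s|) := le_max_of_le_left (by positivity)
    have h3 : Real.log |s| ≤ |t| ^ (1 / M) := by
      calc Real.log |s| ≤ max (2 * M) (Real.log |s|) := le_max_right _ _
        _ = (max (2 * M) (Real.log |s|) ^ M) ^ (1 / M) := by
            rw [← Real.rpow_mul hmax, mul_one_div_cancel hM.ne', Real.rpow_one]
        _ ≤ |t| ^ (1 / M) := by gcongr
    have h4 : |s| ≤ Real.exp (|t| ^ (1 / M)) := (Real.log_le_iff_le_exp hs0).1 h3
    have h5 := bump_nonneg hM.le s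
    calc s * t - bump M s ≤ |s| * |t| := by linarith
      _ ≤ Real.exp (|t| ^ (1 / M)) * |t| := by gcongr
      _ = _ := mul_comm _ _

/-- For `k ≥ 1`, replacing `f` by `f/k` in the integrand gains a factor `1/k` from the linear term
while the exponential does not grow. So `k` may be the larger of one and the average. -/
theorem memOrlicz_of_lintegral_lt_top {M : ℝ} (hM : 0 < M) {B : Set (ℝ × ℝ)}
    (hV0 : volume B ≠ 0) {f : ℝ × ℝ → ℝ} (hf : AEStronglyMeasurable f volume)
    (h : ∫⁻ p in B, ENNReal.ofReal (|f p| * Real.exp (|f p| ^ (1 / M))) < ⊤) :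
    MemOrlicz (convexConj (bump M)) (avgMeasure B) f := by
  refine ⟨(hf.aemeasurable.restrict).smul_measure _, ?_⟩
  set I := (volume B)⁻¹ * ∫⁻ p in B, ENNReal.ofReal (|f p| * Real.exp (|f p| ^ (1 / M))) with hI
  have hIfin : I ≠ ⊤ := ENNReal.mul_ne_top (ENNReal.inv_ne_top.2 hV0) h.ne
  set k : ℝ := max 1 I.toReal with hk
  have hk1 : 1 ≤ k := le_max_left _ _
  have hk0 : 0 < k := by linarith
  have hle : ∫⁻ p, convexConj (bump M) (f p / k) ∂(avgMeasure B) ≤ 1 := by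
    have hpt : ∀ p, convexConj (bump M) (f p / k) ≤
        ENNReal.ofReal k⁻¹ * ENNReal.ofReal (|f p| * Real.exp (|f p| ^ (1 / M))) := fun p => by
      refine (convexConj_bump_le hM _).trans ?_
      rw [← ENNReal.ofReal_mul (by positivity)]
      apply ENNReal.ofReal_le_ofReal
      have h1 : |f p / k| ≤ |f p| := by
        rw [abs_div, abs_of_pos hk0]; exact div_le_self (abs_nonneg _) hk1
      calc |f p / k| * Real.exp (|f p / k| ^ (1 / M))
          ≤ |f p / k| * Real.exp (|f p| ^ (1 / M)) := by gcongr
        _ = _ := by rw [abs_div, abs_of_pos hk0]; ring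
    calc ∫⁻ p, convexConj (bump M) (f p / k) ∂(avgMeasure B)
        ≤ ∫⁻ p, ENNReal.ofReal k⁻¹ * ENNReal.ofReal (|f p| * Real.exp (|f p| ^ (1 / M)))
            ∂(avgMeasure B) := lintegral_mono hpt
      _ = ENNReal.ofReal k⁻¹ * I := by
          rw [lintegral_const_mul' _ _ ENNReal.ofReal_ne_top, avgMeasure, lintegral_smul_measure,
            smul_eq_mul]
      _ ≤ ENNReal.ofReal k⁻¹ * ENNReal.ofReal k := by
          gcongr
          rw [← ENNReal.ofReal_toReal hIfin]
          exact ENNReal.ofReal_le_ofReal (le_max_right _ _)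
      _ = 1 := by
          rw [← ENNReal.ofReal_mul (by positivity), inv_mul_cancel₀ hk0.ne', ENNReal.ofReal_one]
  exact (iInf_le_of_le k (iInf_le_of_le hk0 (iInf_le_of_le hle le_rfl))).trans_lt
    ENNReal.ofReal_lt_top

/-- The right-hand side is `O(|x|^(-m))` with `m = 2α + 2 + ε`, so the integrand is a power of
`1/|x|` times the exponential of a multiple of `|x|^(-m/M)`. The decay of `ψ` wins when `m/M < α`.
-/
theorem memOrlicz_opL_ansatz {α M : ℝ} {χ l : ℝ → ℝ} {B : Set (ℝ × ℝ)} (hα : 0 < α)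
    (hχ : IsCutoff χ) (hl : IsProfile l) (hB : ∀ p ∈ B, |p.1| < 1) (hV0 : volume B ≠ 0)
    (hM : 2 + 2 / α < M) :
    MemOrlicz (convexConj (bump M)) (avgMeasure B) (opL (gfun α) (ansatz α χ l)) := by
  have hM0 : 0 < M := lt_trans (by positivity) hM
  have hf := isThin_opL hα hχ hl
  refine memOrlicz_of_lintegral_lt_top hM0 hV0 hf.aestronglyMeasurable ?_
  -- Half of the gap between `2α + 2` and `αM`, so that still `m < αM`.
  set ε : ℝ := (α * M - (2 * α + 2)) / 2 with hε
  have hαM : 2 * α + 2 < α * M := by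
    have := mul_lt_mul_of_pos_left hM hα
    rw [mul_add, mul_div_cancel₀ _ hα.ne'] at this
    linarith
  have hε0 : 0 < ε := by rw [hε]; linarith
  obtain ⟨K, hK, hb⟩ := ansatz_bounds hα hχ hl hε0
  set m : ℝ := 2 * α + 2 + ε with hm
  have hβ : m * (1 / M) < α := by
    rw [mul_one_div, div_lt_iff₀ hM0]; linarith
  obtain ⟨K', hK', hpsi⟩ := exists_rpow_mul_exp_mul_psi_le hα hβ m ((2 * K) ^ (1 / M))
  refine (lintegral_mono_set (fun p hp => hB p hp)).trans_lt
    (lintegral_strip_lt_top (α := α)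
      (κ := fun x => 2 * K * (|x| ^ (-m) * Real.exp ((2 * K) ^ (1 / M) * |x| ^ (-(m * (1 / M))))))
      (K := 2 * K * K') (by fun_prop) (fun x => by positivity) (fun x hx hx1 => ?_)
      (fun p hp hp1 => ?_) (fun p hp hy => ?_))
  · rw [mul_assoc]
    have := hpsi x hx hx1
    gcongr
  · apply ENNReal.ofReal_le_ofReal
    have h0 := abs_pos.2 hp
    obtain ⟨-, -, -, b1, b2⟩ := hb p hp hp1
    have h1 : |opL (gfun α) (ansatz α χ l) p| ≤ 2 * K * |p.1| ^ (-m) := by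
      rw [opL_eq]
      exact (abs_add_le _ _).trans (by linarith)
    have h2 : |opL (gfun α) (ansatz α χ l) p| ^ (1 / M) ≤
        (2 * K) ^ (1 / M) * |p.1| ^ (-(m * (1 / M))) := by
      calc |opL (gfun α) (ansatz α χ l) p| ^ (1 / M) ≤ (2 * K * |p.1| ^ (-m)) ^ (1 / M) := by
            gcongr
        _ = _ := by
            rw [Real.mul_rpow (by positivity) (by positivity), ← Real.rpow_mul h0.le, neg_mul]
    rw [← mul_assoc]
    gcongr
  · rw [hf.eq_zero p hp hy]; simp

/-! ### The explicit example and the main theorem -/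

theorem uExample_eq (α : ℝ) (χ : ℝ → ℝ) :
    uExample α χ = ansatz α χ fun x => -Real.log x := by
  funext p
  rw [uExample, ansatz, one_div, Real.log_inv, Real.log_abs]

theorem exists_lt_abs_neg_log (C : ℝ) :
    ∃ η : ℝ, 0 < η ∧ ∀ x, 0 < x → x < η → C < |(-Real.log x)| := by
  refine ⟨Real.exp (-C), Real.exp_pos _, fun x hx hxη => ?_⟩
  have := (Real.log_lt_iff_lt_exp hx).2 hxη
  exact lt_of_lt_of_le (by linarith) (le_abs_self _)

end Degen

end

theorem mainTheorem3 :
    (∀ α : ℝ, 0 < α → ∃ r₀ : ℝ, 0 < r₀ ∧ ∀ r : ℝ, 0 < r → r < r₀ →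
      ∀ B : Set (ℝ × ℝ), B = Degen.subunitBall (Degen.gfun α) (0, 0) r →
        -- the Orlicz–Sobolev inequality
        (∀ N : ℝ, 1 ≤ N → α * N < 1 → Degen.OrliczSobolev (Degen.gfun α) B (Degen.bumpSq N)) ∧
        -- the explicit unbounded solution
        (∀ χ : ℝ → ℝ, ContDiff ℝ ∞ χ → (∀ s ∈ Set.Icc (-1 : ℝ) 1, χ s = 1) →
          (∀ s ∉ Set.Icc (-2 : ℝ) 2, χ s = 0) →
            Degen.MemSobolev (Degen.gfun α) B (Degen.uExample α χ) ∧
            Degen.UnboundedAtOrigin B (Degen.uExample α χ) ∧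
            Degen.IsWeakSolution (Degen.gfun α) B
              (Degen.opL (Degen.gfun α) (Degen.uExample α χ)) (Degen.uExample α χ) ∧
            ∀ M : ℝ, 2 + 2 / α < M →
              Degen.MemOrlicz (Degen.convexConj (Degen.bump M)) (Degen.avgMeasure B)
                (Degen.opL (Degen.gfun α) (Degen.uExample α χ))) ∧
        -- an unbounded solution with zero boundary values
        (∃ w h : ℝ × ℝ → ℝ,
            Degen.MemSobolevZero (Degen.gfun α) B w ∧
            Degen.UnboundedAtOrigin B w ∧
            Degen.IsWeakSolution (Degen.gfun α) B h w ∧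
            ∀ M : ℝ, 2 + 2 / α < M →
              Degen.MemOrlicz (Degen.convexConj (Degen.bump M)) (Degen.avgMeasure B) h)) ∧
    -- every pair `N ≥ 1`, `M > 2 + 2N` is realized by some `α`
    (∀ N M : ℝ, 1 ≤ N → 2 + 2 * N < M → ∃ α : ℝ, 0 < α ∧ α * N < 1 ∧ 2 + 2 / α < M) := by

  refine ⟨fun α hα => ⟨1, one_pos, fun r hr hr1 B hBdef => ?_⟩, fun N M hN hM => ?_⟩
  · have hmem : ∀ p ∈ B, |p.1| < r ∧ |p.2| ≤ 2 * α + 1 := fun p hp =>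
      Degen.subunitBall_subset hα hr1.le (hBdef ▸ hp)
    have hB : ∀ p ∈ B, |p.1| < 1 := fun p hp => (hmem p hp).1.trans hr1
    obtain ⟨δ₀, hδ₀, hbox₀⟩ := Degen.box_subset_subunitBall hα hr
    set δ : ℝ := min δ₀ 1 with hδdef
    have hδ : 0 < δ := lt_min hδ₀ one_pos
    have hbox : ∀ x y : ℝ, |x| ≤ δ → |y| ≤ δ → (x, y) ∈ B := fun x y hx hy => by
      rw [hBdef]
      exact hbox₀ x y (hx.trans (min_le_left _ _)) (hy.trans (min_le_left _ _))
    have hV : volume B ≠ ⊤ := by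
      have hsub : B ⊆ Metric.closedBall 0 (2 * α + 1) := fun p hp => by
        rw [mem_closedBall_zero_iff, Prod.norm_def]
        refine max_le ?_ (hmem p hp).2
        rw [Real.norm_eq_abs]
        linarith [hB p hp]
      exact ((measure_mono hsub).trans_lt
        (isCompact_closedBall (0 : ℝ × ℝ) (2 * α + 1)).measure_lt_top).ne
    have hV0 : volume B ≠ 0 := by
      have hsub : Metric.ball (0 : ℝ × ℝ) δ ⊆ B := fun p hp => by
        rw [mem_ball_zero_iff] at hp
        exact hbox p.1 p.2 ((norm_fst_le p).trans hp.le) ((norm_snd_le p).trans hp.le)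
      exact ((Metric.measure_ball_pos volume (0 : ℝ × ℝ) hδ).trans_le (measure_mono hsub)).ne'
    refine ⟨fun N hN hαN => Degen.orliczSobolev hα hN hαN hB hV0 hV, fun χ h1 h2 h3 => ?_, ?_⟩
    · have hχ : Degen.IsCutoff χ := ⟨h1, h2, h3⟩
      have hl := Degen.isProfile_neg_log
      rw [Degen.uExample_eq]
      exact ⟨⟨_, Degen.hasWeakAGrad_ansatz hα hχ hl hB hV⟩,
        Degen.unboundedAtOrigin_ansatz hα hχ hδ hbox Degen.exists_lt_abs_neg_log,
        Degen.isWeakSolution_ansatz hα hχ hl hB hV,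
        fun M hM => Degen.memOrlicz_opL_ansatz hα hχ hl hB hV0 hM⟩
    · obtain ⟨χ, hχ⟩ := Degen.exists_isCutoff
      -- With the factor `4/δ` the cutoff vanishes for `|x| > δ/2`, which places the support in the
      -- box, and equals one for `|x| ≤ δ/4`, which keeps the singularity.
      have hl := hχ.isProfile_mul_neg_log (4 / δ)
      refine ⟨Degen.ansatz α χ fun x => χ (4 / δ * x) * -Real.log x, _,
        ⟨_, Degen.hasWeakAGradZero_ansatz hα hχ hl hB hV (min_le_right _ _) hbox fun x hx => ?_⟩,
        Degen.unboundedAtOrigin_ansatz hα hχ hδ hbox fun C => ?_,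
        Degen.isWeakSolution_ansatz hα hχ hl hB hV,
        fun M hM => Degen.memOrlicz_opL_ansatz hα hχ hl hB hV0 hM⟩
      · rw [hχ.eq_zero_of_lt, zero_mul]
        rw [abs_mul, abs_of_pos (by positivity), div_mul_eq_mul_div, lt_div_iff₀ hδ]
        linarith
      · obtain ⟨η, hη, hC⟩ := Degen.exists_lt_abs_neg_log C
        refine ⟨min η (δ / 4), by positivity, fun x hx hxη => ?_⟩
        have hx' : |4 / δ * x| ≤ 1 := by
          rw [abs_of_pos (by positivity), div_mul_eq_mul_div, div_le_one hδ]
          linarith [hxη.trans_le (min_le_right _ _)]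
        rw [hχ.eq_one _ (abs_le.1 hx'), one_mul]
        exact hC x hx (hxη.trans_le (min_le_left _ _))
  · have hM0 : 0 < M - 2 := by linarith
    -- The conditions on `α` amount to `2/(M - 2) < α < 1/N`, an interval that is nonempty because
    -- `M > 2 + 2N`.
    set β : ℝ := 2 / (M - 2) with hβ
    have hN0 : 0 < N := by linarith
    have h1 : β < 1 / N := by
      rw [hβ, div_lt_div_iff₀ hM0 hN0]; linarith
    obtain ⟨α, h2, h3⟩ := exists_between h1
    have hα : 0 < α := lt_trans (by positivity) h2
    refine ⟨α, hα, (lt_div_iff₀ hN0).1 h3, ?_⟩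
    have h4 : 2 < α * (M - 2) := (div_lt_iff₀ hM0).1 h2
    have h5 : 2 / α < M - 2 := (div_lt_iff₀' hα).2 h4
    linarith
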